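/- Setting. Let $V$ be a countable set and $p:V\times V\to[0,1]$ a transition kernel, $\sum_{y}p(x,y)=1$ for all $x\in V$. Let $\alpha:V\to(0,\infty)$ and $C>0$ satisfy $\sum_{x}\alpha(x)<\infty$ and $\sum_{y}p(x,y)\alpha(y)\le C\,\alpha(x)$ for all $x$. Write $\|\zeta\|_\alpha=\sum_x\alpha(x)|\zeta(x)|$, $E_0=\{\eta\in\mathbb N_0^V:\sum_x\eta(x)<\infty\}$ and $E_\alpha=\{\eta\in\mathbb N_0^V:\|\eta\|_\alpha<\infty\}$. Let $F^+,F^-:\mathbb N_0\to\mathbb R$ satisfy $F^\pm(0)=0$, $0\le F^+\le F^-$, with $F^+-F^-$ decreasing (in the wide sense). The marks are $(x,+)$, $(x,-)$ and $(x,y)$ for $x,y\in V$; mark $\mathfrak m$ has the transition operator $\Gamma^{\mathfrak m}$ and the rate $R^{\mathfrak m}$ given by $$\Gamma^{(x,+)}\eta=\eta+\delta_x,\quad \Gamma^{(x,-)}\eta=\eta-\delta_x,\quad \Gamma^{(x,y)}\eta=\eta-\delta_x+\delta_y,$$ $$R^{(x,+)}(\eta)=F^+(\eta(x)),\quad R^{(x,-)}(\eta)=F^-(\eta(x)),\quad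 R^{(x,y)}(\eta)=p(x,y)\,\eta(x).$$ Poisson-clock coupling. On a probability space $(\Omega,\mathcal F,\mathbb P)$ let $(\mathcal X^{\mathfrak m})_{\mathfrak m}$ be independent Poisson point processes on $(0,\infty)^2$, each with Lebesgue intensity. For $\eta\in E_0$ and $t\ge0$ put $s^0=0$, $\eta^0=\eta$ and, recursively, let $s^{k}$ be the infimum ($\inf\varnothing=\infty$) of the times $r\in(s^{k-1},t]$ for which there are a mark $\mathfrak m$ and a $u>0$ with $(r,u)\in\mathcal X^{\mathfrak m}$ and $u<R^{\mathfrak m}(\eta^{k-1})$; if $s^k<\infty$, let $\eta^k=\Gamma^{\mathfrak m}(\eta^{k-1})$ for the (almost surely unique) mark $\mathfrak m$ for which this holds at $r=s^k$. Set $\Phi_t(\eta)=\eta^k$ for the index $k$ with $s^k<\infty=s^{k+1}$, which exists almost surely. For $\eta\in E_\alpha$, $\Phi_t(\eta)\in E_\alpha$ is the limit in $\|\cdot\|_\alpha$ of $\Phi_t(\eta_n)$ along every increasing sequence $(\eta_n)$ in $E_0$ with $\|\eta_n-\eta\|_\alpha\to0$. On the exceptional events where the index or the limit does not exist, set $\Phi_t(\eta)=\eta$.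 Let $(\mathcal F_t)_{t\ge0}$ be the filtration $\mathcal F_t=\sigma\{\Phi_s(\xi):0\le s\le t,\ \xi\in E_0\}$ completed with the $\mathbb P$-null sets. Lemma (distance process in $E_\alpha$). Let $\eta,\eta'\in E_\alpha$. Almost surely, the limits defining $\Phi_t(\eta)$ and $\Phi_t(\eta')$ exist for all $t\ge0$. The process $$\bigl(e^{-(C+1)t}\,\|\Phi_t(\eta)-\Phi_t(\eta')\|_\alpha\bigr)_{t\ge0}$$ is a supermartingale with respect to $(\mathcal F_t)_{t\ge0}$ (on the completion of $(\Omega,\mathcal F,\mathbb P)$). Moreover, for all $T>0$ and $A>0$, $$\mathbb P\Bigl(\sup_{0\le t\le T}\|\Phi_t(\eta)-\Phi_t(\eta')\|_\alpha>A\Bigr)\le\frac{e^{(C+1)T}\,\|\eta-\eta'\|_\alpha}{A}.$$ -/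

import Mathlib

open MeasureTheory ProbabilityTheory Filter Topology
open scoped NNReal ENNReal

namespace ReactionDiffusion

/-- `p` is a transition kernel on `V`: entries in `[0,1]` and rows summing to `1`. -/
structure IsTransitionKernel {V : Type*} (p : V → V → ℝ) : Prop where
  mem_unit : ∀ x y, p x y ∈ Set.Icc (0 : ℝ) 1
  row_sum : ∀ x, HasSum (p x) 1

/-- `α : V → (0,∞)` is summable and `∑_y p(x,y) α(y) ≤ C α(x)` for every `x`, with `C > 0`.
(The series converges since `0 ≤ p ≤ 1` and `α` is summable.) -/
structure IsLocalization {V : Type*} (p : V → V → ℝ) (α : V → ℝ) (C : ℝ) : Prop where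
  pos : ∀ x, 0 < α x
  summable : Summable α
  const_pos : 0 < C
  kernel_le : ∀ x, ∑' y, p x y * α y ≤ C * α x

/-- The reaction functions: `F⁺(0) = F⁻(0) = 0`, `0 ≤ F⁺ ≤ F⁻`, and `F⁺ - F⁻` is decreasing
(in the wide sense). -/
structure IsReactionPair (Fp Fm : ℕ → ℝ) : Prop where
  birth_zero : Fp 0 = 0
  death_zero : Fm 0 = 0
  birth_nonneg : ∀ k, 0 ≤ Fp k
  birth_le_death : ∀ k, Fp k ≤ Fm k
  antitone_sub : Antitone fun k => Fp k - Fm k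

/-- The finite configurations. -/
def E0 (V : Type*) : Set (V → ℕ) := {η | Summable fun x => (η x : ℝ)}

/-- The `α`-summable configurations. -/
def Eα {V : Type*} (α : V → ℝ) : Set (V → ℕ) := {η | Summable fun x => α x * (η x : ℝ)}

/-- `‖η - η'‖_α = ∑_x α(x) |η(x) - η'(x)|`. -/
noncomputable def distα {V : Type*} (α : V → ℝ) (η η' : V → ℕ) : ℝ :=
  ∑' x, α x * |(η x : ℝ) - (η' x : ℝ)|

/-- Birth marks `(x,+)`, death marks `(x,-)` and jump marks `(x,y)`. -/
inductive Mark (V : Type*) where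
  | birth (x : V) : Mark V
  | death (x : V) : Mark V
  | jump (x y : V) : Mark V

/-- The transition operators. They are only ever applied at marks of positive rate, where the
site losing a particle is occupied, so that the subtraction in `ℕ` is a genuine one. -/
noncomputable def transition {V : Type*} (m : Mark V) (η : V → ℕ) : V → ℕ :=
  open Classical in
  match m with
  | .birth x => η + Pi.single x 1
  | .death x => η - Pi.single x 1
  | .jump x y => η - Pi.single x 1 + Pi.single y 1

/-- The transition rates. -/
def rate {V : Type*} (p : V → V → ℝ) (Fp Fm : ℕ → ℝ) (m : Mark V) (η : V → ℕ) : ℝ :=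
  match m with
  | .birth x => Fp (η x)
  | .death x => Fm (η x)
  | .jump x y => p x y * (η x : ℝ)

/-- `N` is a Poisson point process with intensity `ν`, viewed as a random set of points: the
number of points in a set of finite intensity is Poisson, and the numbers of points in disjoint
sets are independent. -/
structure IsPoissonPointProcess {Ω S : Type*} [MeasurableSpace Ω] [MeasurableSpace S]
    (N : Ω → Set S) (ν : Measure S) (P : Measure Ω) : Prop where
  measurable_count : ∀ B, MeasurableSet B → Measurable fun ω => (N ω ∩ B).encard
  poisson : ∀ B, MeasurableSet B → ν B ≠ ∞ → ∀ k : ℕ,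
    P {ω | (N ω ∩ B).encard = (k : ℕ∞)} = poissonMeasure (ν B).toNNReal {k}
  indep : ∀ (n : ℕ) (B : Fin n → Set S), (∀ i, MeasurableSet (B i)) →
    Pairwise (fun i j => Disjoint (B i) (B j)) →
    iIndepFun (fun i ω => (N ω ∩ B i).encard) P

/-- The σ-algebra generated by a random set of points, through its counting variables. -/
@[reducible]
noncomputable def countSigma {Ω S : Type*} [MeasurableSpace S] (N : Ω → Set S) : MeasurableSpace Ω :=
  ⨆ (B : Set S) (_ : MeasurableSet B),
    MeasurableSpace.comap (fun ω => (N ω ∩ B).encard) inferInstance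

/-- The open quadrant `(0,∞)²`. -/
def quadrant : Set (ℝ × ℝ) := Set.Ioi 0 ×ˢ Set.Ioi 0

/-- The Poisson clocks: independent Poisson point processes on `(0,∞)²`, one for each mark, with
intensity the Lebesgue measure. -/
structure IsPoissonClocks {V Ω : Type*} [MeasurableSpace Ω]
    (X : Mark V → Ω → Set (ℝ × ℝ)) (P : Measure Ω) : Prop where
  subset : ∀ m ω, X m ω ⊆ quadrant
  poisson : ∀ m, IsPoissonPointProcess (X m) ((volume : Measure (ℝ × ℝ)).restrict quadrant) P
  indep : iIndep (fun m => countSigma (X m)) P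

section Flow

variable {V : Type*}

/-- For a realization `X` of the clocks: the first time `r ∈ (s,t]` at which some clock rings
below its rate in the configuration `η`; it is `∞` if there is none. -/
noncomputable def nextTime (R : Mark V → (V → ℕ) → ℝ) (X : Mark V → Set (ℝ × ℝ)) (t : ℝ≥0)
    (s : ℝ≥0∞) (η : V → ℕ) : ℝ≥0∞ :=
  sInf {r : ℝ≥0∞ | s < r ∧ r ≤ t ∧ ∃ m, ∃ u : ℝ, 0 < u ∧ (r.toReal, u) ∈ X m ∧ u < R m η}

/-- The marks whose clock rings at time `r` below its rate in the configuration `η`. -/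
def ringing (R : Mark V → (V → ℕ) → ℝ) (X : Mark V → Set (ℝ × ℝ)) (r : ℝ≥0∞) (η : V → ℕ) :
    Set (Mark V) :=
  {m | ∃ u : ℝ, 0 < u ∧ (r.toReal, u) ∈ X m ∧ u < R m η}

/-- The configuration after the transition at time `r` (almost surely exactly one mark rings). -/
noncomputable def nextConfig (R : Mark V → (V → ℕ) → ℝ) (X : Mark V → Set (ℝ × ℝ))
    (r : ℝ≥0∞) (η : V → ℕ) : V → ℕ :=
  open Classical in
  if h : r < ∞ ∧ (ringing R X r η).Nonempty then transition h.2.some η else η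

/-- The transition times `s^k` and configurations `η^k` on `[s,t]`. -/
noncomputable def steps (R : Mark V → (V → ℕ) → ℝ) (X : Mark V → Set (ℝ × ℝ)) (s t : ℝ≥0)
    (η : V → ℕ) : ℕ → ℝ≥0∞ × (V → ℕ)
  | 0 => ((s : ℝ≥0∞), η)
  | k + 1 =>
    let q := steps R X s t η k
    let r := nextTime R X t q.1 q.2
    (r, nextConfig R X r q.2)

/-- The random flow `Φ_{s,t}(η)` from a finite configuration `η`: the configuration `η^k` for
the index `k` with `s^k < ∞ = s^{k+1}`. Such an index exists almost surely; the value is `η`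
on the exceptional event. -/
noncomputable def finiteFlow (R : Mark V → (V → ℕ) → ℝ) (X : Mark V → Set (ℝ × ℝ))
    (s t : ℝ≥0) (η : V → ℕ) : V → ℕ :=
  open Classical in
  if h : ∃ k, (steps R X s t η k).1 < ∞ ∧ (steps R X s t η (k + 1)).1 = ∞
  then (steps R X s t η (Nat.find h)).2 else η

/-- `ξ` is the value at time `t` of the flow from `η ∈ E_α`: it lies in `E_α`, and it is the
limit in `‖·‖_α` of `Φ_t(η_n)` for every increasing sequence `η_n` of finite configurations
converging to `η` in `‖·‖_α`. -/
def IsFlowLimit (α : V → ℝ) (R : Mark V → (V → ℕ) → ℝ) (X : Mark V → Set (ℝ × ℝ))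
    (t : ℝ≥0) (η ξ : V → ℕ) : Prop :=
  ξ ∈ Eα α ∧ ∀ e : ℕ → V → ℕ, (∀ n, e n ∈ E0 V) → Monotone e →
    Tendsto (fun n => distα α (e n) η) atTop (𝓝 0) →
    Tendsto (fun n => distα α (finiteFlow R X 0 t (e n)) ξ) atTop (𝓝 0)

/-- The flow `Φ_t(η)` from `η ∈ E_α`: the limit above, which exists almost surely, with value
`η` on the exceptional event. -/
noncomputable def flow (α : V → ℝ) (R : Mark V → (V → ℕ) → ℝ) (X : Mark V → Set (ℝ × ℝ))
    (t : ℝ≥0) (η : V → ℕ) : V → ℕ :=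
  open Classical in
  if h : ∃ ξ, IsFlowLimit α R X t η ξ then h.choose else η

/-- `σ{Φ_s(η) : s ≤ t, η ∈ E_0}`, completed with the null sets of `P`. -/
@[reducible]
noncomputable def flowSigma {Ω : Type*} [MeasurableSpace Ω] (P : Measure Ω) (R : Mark V → (V → ℕ) → ℝ)
    (X : Mark V → Ω → Set (ℝ × ℝ)) (t : ℝ≥0) : MeasurableSpace Ω :=
  (⨆ (s : ℝ≥0) (_ : s ≤ t) (η : V → ℕ) (_ : η ∈ E0 V),
    MeasurableSpace.comap (fun ω => finiteFlow R (fun m => X m ω) 0 s η) MeasurableSpace.pi) ⊔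
  MeasurableSpace.generateFrom {N : Set Ω | P N = 0}

end Flow

end ReactionDiffusion

/-! The distance of two coupled configurations changes only when a clock rings below exactly one of
the two rates; after a ring below both, the two configurations have moved by the same vector. At a
site `x`, sole births and deaths contribute to the mean drift `α x` times the increment of `F⁺ - F⁻`
from the smaller to the larger occupation number, which is not positive. A sole jump from `x` to `y`
costs at most `α y` and has rate `p(x,y)|η(x) - η'(x)|`, so the kernel bound limits all jumps
together to `C` times the distance (`tsum_drift_le`). Hence the expected distance grows at most like
`e^{Ct}`, and the exponent `C + 1` leaves slack.

To make this rigorous for finite configurations, time is cut into cells of length `h` and at most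
one transition per cell is performed (`cellMap`). Except on an event of probability `O(h²)` this is
the true trajectory (`pairPath_of_not_bad`, `measure_bad_le`), and one cell multiplies the expected
distance by at most `1 + Ch`, up to `O(h²)` (`lintegral_edistα_cellMap_le`). The constants depend on
the number of particles, so the chain is held once there are more than `K`; the same estimate with
weight `1` shows that this is unlikely. `exists_discretization` adds up the errors, and
Borel-Cantelli and Fatou remove them. Independence of the clocks in disjoint time strips and the
cocycle property give the Markov estimate `setLIntegral_edistα_finiteFlow_le`; a discrete maximal
inequality on dyadic grids then yields `measure_exists_lt_edistα_finiteFlow_le`.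

For configurations in `E_α`, attractiveness (`PairPath.mono`) makes `Φ_t(η_n)` increasing in `n`,
and the maximal inequality bounds it at all times, almost surely; so the limit exists and does not
depend on the sequence (`ae_isFlowLimit_flow`). The estimates pass to the limit by Fatou and the
triangle inequality. Finally, each event of the completed filtration agrees almost surely with an
event of the clocks up to the same time (`flowSigma_le`), which turns the set-integral estimates
into the supermartingale property. -/

namespace ReactionDiffusion

/-! ### Joint trajectories of two finite configurations -/

section Paths

variable {V : Type*} {R : Mark V → (V → ℕ) → ℝ} {X : Mark V → Set (ℝ × ℝ)}

/-- A joint trajectory of the flow on `[s,t]` from the pair `(z, z')` to the pair `(w, w')`, with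
finitely many transitions and no two marks ringing at the same time. -/
inductive PairPath (R : Mark V → (V → ℕ) → ℝ) (X : Mark V → Set (ℝ × ℝ)) :
    ℝ≥0 → ℝ≥0 → (V → ℕ) → (V → ℕ) → (V → ℕ) → (V → ℕ) → Prop
  | stay {s t : ℝ≥0} {z z' : V → ℕ} (hst : s ≤ t)
      (h : ∀ q : ℝ≥0, s < q → q ≤ t → ringing R X q z = ∅ ∧ ringing R X q z' = ∅) :
      PairPath R X s t z z' z z'
  | jump {s t r : ℝ≥0} {z z' w w' : V → ℕ} (hsr : s < r) (hrt : r ≤ t)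
      (h : ∀ q : ℝ≥0, s < q → q < r → ringing R X q z = ∅ ∧ ringing R X q z' = ∅)
      (m : Mark V) (hm : ∀ m', m' ∈ ringing R X r z ∨ m' ∈ ringing R X r z' → m' = m)
      (tail : PairPath R X r t (nextConfig R X r z) (nextConfig R X r z') w w') :
      PairPath R X s t z z' w w'

lemma PairPath.le {s t : ℝ≥0} {z z' w w' : V → ℕ} (h : PairPath R X s t z z' w w') : s ≤ t := by
  induction h with
  | stay hst _ => exact hst
  | jump hsr hrt _ _ _ _ _ => exact hsr.le.trans hrt

lemma PairPath.swap {s t : ℝ≥0} {z z' w w' : V → ℕ} (h : PairPath R X s t z z' w w') :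
    PairPath R X s t z' z w' w := by
  induction h with
  | stay hst h => exact .stay hst fun q h1 h2 => (h q h1 h2).symm
  | jump hsr hrt h m hm _ ih =>
    exact .jump hsr hrt (fun q h1 h2 => (h q h1 h2).symm) m (fun m' h' => hm m' h'.symm) ih

lemma PairPath.refl (s : ℝ≥0) (z z' : V → ℕ) : PairPath R X s s z z' z z' :=
  .stay le_rfl fun _ h1 h2 => absurd h1 h2.not_gt

/-- A time without any ring may be prepended. -/
lemma PairPath.prepend {s r t : ℝ≥0} {z z' w w' : V → ℕ} (hsr : s ≤ r)
    (h : ∀ q : ℝ≥0, s < q → q ≤ r → ringing R X q z = ∅ ∧ ringing R X q z' = ∅)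
    (hp : PairPath R X r t z z' w w') : PairPath R X s t z z' w w' := by
  cases hp with
  | stay hst h' =>
    refine .stay (hsr.trans hst) fun q h1 h2 => ?_
    rcases le_or_gt q r with hq | hq
    · exact h q h1 hq
    · exact h' q hq h2
  | jump hrr hrt h' m hm tail =>
    refine .jump (hsr.trans_lt hrr) hrt (fun q h1 h2 => ?_) m hm tail
    rcases le_or_gt q r with hq | hq
    · exact h q h1 hq
    · exact h' q hq h2

lemma PairPath.trans {s r t : ℝ≥0} {z z' v v' w w' : V → ℕ} (h : PairPath R X s r z z' v v')
    (h' : PairPath R X r t v v' w w') : PairPath R X s t z z' w w' := by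
  induction h with
  | stay hst h => exact h'.prepend hst h
  | jump hsr hrt h m hm _ ih => exact .jump hsr (hrt.trans h'.le) h m hm (ih h')

lemma PairPath.split {s r t : ℝ≥0} {z z' w w' : V → ℕ} (h : PairPath R X s t z z' w w')
    (hsr : s ≤ r) (hrt : r ≤ t) :
    ∃ v v', PairPath R X s r z z' v v' ∧ PairPath R X r t v v' w w' := by
  induction h with
  | stay hst h =>
    exact ⟨_, _, .stay hsr fun q h1 h2 => h q h1 (h2.trans hrt),
      .stay hrt fun q h1 h2 => h q (hsr.trans_lt h1) h2⟩
  | @jump s t q z z' w w' hsq hqt h m hm tail ih =>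
    rcases lt_or_ge r q with hrq | hrq
    · exact ⟨_, _, .stay hsr fun q' h1 h2 => h q' h1 (h2.trans_lt hrq),
        .jump hrq hqt (fun q' h1 h2 => h q' (hsr.trans_lt h1) h2) m hm tail⟩
    · obtain ⟨v, v', h1, h2⟩ := ih hrq hrt
      exact ⟨v, v', .jump hsq hrq h m hm h1, h2⟩

lemma nextConfig_mem {S : Set (V → ℕ)} {z : V → ℕ} (hz : z ∈ S)
    (hS : ∀ m, transition m z ∈ S) (r : ℝ≥0∞) : nextConfig R X r z ∈ S := by
  unfold nextConfig
  split_ifs with h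
  · exact hS _
  · exact hz

lemma nextConfig_of_empty {z : V → ℕ} {r : ℝ≥0∞} (h : ringing R X r z = ∅) :
    nextConfig R X r z = z := by
  unfold nextConfig
  rw [dif_neg]
  rintro ⟨-, h'⟩
  simp [h] at h'

lemma nextConfig_of_unique {z : V → ℕ} {r : ℝ≥0} {m : Mark V} (hm : m ∈ ringing R X r z)
    (h : ∀ m' ∈ ringing R X r z, m' = m) : nextConfig R X r z = transition m z := by
  unfold nextConfig
  have h' : (r : ℝ≥0∞) < ∞ ∧ (ringing R X r z).Nonempty := ⟨ENNReal.coe_lt_top, m, hm⟩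
  rw [dif_pos h', h _ h'.2.some_mem]

/-- The points in time on `(s,t]` over which `nextTime` takes its infimum. -/
lemma nextTime_eq (t : ℝ≥0) (s : ℝ≥0∞) (η : V → ℕ) :
    nextTime R X t s η = sInf {r : ℝ≥0∞ | s < r ∧ r ≤ t ∧ (ringing R X r η).Nonempty} := rfl

lemma nextTime_top (t : ℝ≥0) (η : V → ℕ) : nextTime R X t ∞ η = ∞ := by
  simp [nextTime_eq]

lemma nextTime_eq_top {s t : ℝ≥0} {z : V → ℕ}
    (h : ∀ q : ℝ≥0, s < q → q ≤ t → ringing R X q z = ∅) : nextTime R X t s z = ∞ := by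
  rw [nextTime_eq]
  refine sInf_eq_top.2 fun r hr => ?_
  obtain ⟨h1, h2, h3⟩ := hr
  lift r to ℝ≥0 using (h2.trans_lt ENNReal.coe_lt_top).ne
  rw [h r (by exact_mod_cast h1) (by exact_mod_cast h2)] at h3
  simp at h3

lemma nextTime_eq_of_ringing {s r t : ℝ≥0} {z : V → ℕ} (hsr : s < r) (hrt : r ≤ t)
    (h : ∀ q : ℝ≥0, s < q → q < r → ringing R X q z = ∅) (hr : (ringing R X r z).Nonempty) :
    nextTime R X t s z = r := by
  rw [nextTime_eq]
  refine le_antisymm (sInf_le ⟨by exact_mod_cast hsr, by exact_mod_cast hrt, hr⟩)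
    (le_sInf fun q hq => ?_)
  obtain ⟨h1, h2, h3⟩ := hq
  lift q to ℝ≥0 using (h2.trans_lt ENNReal.coe_lt_top).ne
  by_contra hlt
  rw [h q (by exact_mod_cast h1) (by exact_mod_cast not_le.1 hlt)] at h3
  simp at h3

lemma nextTime_congr {s r t : ℝ≥0} {z : V → ℕ} (hsr : s ≤ r)
    (h : ∀ q : ℝ≥0, s < q → q ≤ r → ringing R X q z = ∅) :
    nextTime R X t s z = nextTime R X t r z := by
  rw [nextTime_eq, nextTime_eq]
  congr 1
  ext q
  simp only [Set.mem_ofPred_eq]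
  constructor
  · rintro ⟨h1, h2, h3⟩
    refine ⟨?_, h2, h3⟩
    lift q to ℝ≥0 using (h2.trans_lt ENNReal.coe_lt_top).ne
    by_contra hlt
    rw [h q (by exact_mod_cast h1) (by exact_mod_cast not_lt.1 hlt)] at h3
    simp at h3
  · rintro ⟨h1, h2, h3⟩
    exact ⟨lt_of_le_of_lt (by exact_mod_cast hsr) h1, h2, h3⟩

lemma steps_succ_of_ringing {s r t : ℝ≥0} {z : V → ℕ} (hsr : s < r) (hrt : r ≤ t)
    (h : ∀ q : ℝ≥0, s < q → q < r → ringing R X q z = ∅) (hr : (ringing R X r z).Nonempty)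
    (k : ℕ) : steps R X s t z (k + 1) = steps R X r t (nextConfig R X r z) k := by
  induction k with
  | zero => simp only [steps, nextTime_eq_of_ringing hsr hrt h hr]
  | succ k ih => rw [steps, ih]; rfl

/-- The recursion sees its starting time only through the first `nextTime`. The index is `k + 1`
because index `0` records the starting time itself, which differs. -/
lemma steps_succ_congr {s r t : ℝ≥0} {z : V → ℕ} (hsr : s ≤ r)
    (h : ∀ q : ℝ≥0, s < q → q ≤ r → ringing R X q z = ∅) (k : ℕ) :
    steps R X s t z (k + 1) = steps R X r t z (k + 1) := by
  induction k with
  | zero => simp only [steps, nextTime_congr hsr h]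
  | succ k ih => rw [steps, ih]; rfl

/-- No time lies beyond `∞`, so `∞` is absorbing. This makes the index in the definition of
`finiteFlow` unique. -/
lemma steps_top_of_le {s t : ℝ≥0} {z : V → ℕ} {k l : ℕ} (hkl : k ≤ l)
    (hk : (steps R X s t z k).1 = ∞) : (steps R X s t z l).1 = ∞ := by
  induction l, hkl using Nat.le_induction with
  | base => exact hk
  | succ l _ ih => simp only [steps, ih, nextTime_top]

lemma finiteFlow_eq {s t : ℝ≥0} {z : V → ℕ} {k : ℕ} (h1 : (steps R X s t z k).1 < ∞)
    (h2 : (steps R X s t z (k + 1)).1 = ∞) : finiteFlow R X s t z = (steps R X s t z k).2 := by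
  classical
  have h : ∃ k, (steps R X s t z k).1 < ∞ ∧ (steps R X s t z (k + 1)).1 = ∞ := ⟨k, h1, h2⟩
  have hk : Nat.find h = k := by
    obtain ⟨h3, h4⟩ := Nat.find_spec h
    rcases lt_trichotomy (Nat.find h) k with hlt | heq | hlt
    · exact absurd (steps_top_of_le hlt h4) h1.ne
    · exact heq
    · exact absurd (steps_top_of_le hlt h2) h3.ne
  unfold finiteFlow
  rw [dif_pos h]
  convert rfl
  exact hk.symm

/-- The link between trajectories and the recursion: a path carries finitely many transitions, so
the recursion for each of its two components terminates, at the endpoint of the path. -/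
lemma PairPath.exists_steps {s t : ℝ≥0} {z z' w w' : V → ℕ} (h : PairPath R X s t z z' w w') :
    ∃ k, (steps R X s t z k).1 < ∞ ∧ (steps R X s t z (k + 1)).1 = ∞ ∧
      (steps R X s t z k).2 = w := by
  induction h with
  | stay hst h =>
    exact ⟨0, ENNReal.coe_lt_top, nextTime_eq_top fun q h1 h2 => (h q h1 h2).1, rfl⟩
  | @jump s t r z z' w w' hsr hrt h m hm tail ih =>
    obtain ⟨k, h1, h2, h3⟩ := ih
    rcases (ringing R X r z).eq_empty_or_nonempty with hr | hr
    -- At time `r` nothing rings for `z`, so the recursion for `z` does not stop there and the index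
    -- of the tail is kept instead of being raised by one.
    · rw [nextConfig_of_empty hr] at h1 h2 h3
      have hc := steps_succ_congr (R := R) (X := X) (t := t) (z := z) hsr.le fun q hq1 hq2 => by
        rcases hq2.lt_or_eq with hq | rfl
        · exact (h q hq1 hq).1
        · exact hr
      refine ⟨k, ?_, by rw [hc, h2], ?_⟩
      · cases k with
        | zero => exact ENNReal.coe_lt_top
        | succ k => rw [hc]; exact h1
      · cases k with
        | zero => exact h3
        | succ k => rw [hc]; exact h3
    · have hc := steps_succ_of_ringing (t := t) hsr hrt (fun q hq1 hq2 => (h q hq1 hq2).1) hr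
      exact ⟨k + 1, by rwa [hc], by rwa [hc], by rwa [hc]⟩

lemma PairPath.finiteFlow_left {s t : ℝ≥0} {z z' w w' : V → ℕ}
    (h : PairPath R X s t z z' w w') : finiteFlow R X s t z = w := by
  obtain ⟨k, h1, h2, h3⟩ := h.exists_steps
  rw [finiteFlow_eq h1 h2, h3]

lemma PairPath.finiteFlow_right {s t : ℝ≥0} {z z' w w' : V → ℕ}
    (h : PairPath R X s t z z' w w') : finiteFlow R X s t z' = w' :=
  h.swap.finiteFlow_left

lemma PairPath.mem {S : Set (V → ℕ)} (hS : ∀ z ∈ S, ∀ m, transition m z ∈ S) {s t : ℝ≥0}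
    {z z' w w' : V → ℕ} (h : PairPath R X s t z z' w w') (hz : z ∈ S) (hz' : z' ∈ S) :
    w ∈ S ∧ w' ∈ S := by
  induction h with
  | stay => exact ⟨hz, hz'⟩
  | jump _ _ _ _ _ _ ih =>
    exact ih (nextConfig_mem hz (hS _ hz) _) (nextConfig_mem hz' (hS _ hz') _)

/-- The flow satisfies the cocycle property along a trajectory. -/
lemma PairPath.finiteFlow_cocycle {s r t : ℝ≥0} {z z' w w' : V → ℕ}
    (h : PairPath R X s t z z' w w') (hsr : s ≤ r) (hrt : r ≤ t) :
    finiteFlow R X s t z = finiteFlow R X r t (finiteFlow R X s r z) := by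
  obtain ⟨v, v', h1, h2⟩ := h.split hsr hrt
  rw [h.finiteFlow_left, h1.finiteFlow_left, h2.finiteFlow_left]

/-- Trajectories are constant to the right of any time. -/
lemma PairPath.right_constant {s r t : ℝ≥0} {z z' w w' : V → ℕ}
    (h : PairPath R X s t z z' w w') (hsr : s ≤ r) (hrt : r < t) :
    ∃ r' > r, r' ≤ t ∧ ∀ q, r ≤ q → q < r' →
      finiteFlow R X s q z = finiteFlow R X s r z ∧
      finiteFlow R X s q z' = finiteFlow R X s r z' := by
  obtain ⟨v, v', h1, h2⟩ := h.split hsr hrt.le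
  have key : ∀ {q}, PairPath R X r q v v' v v' →
      finiteFlow R X s q z = finiteFlow R X s r z ∧
      finiteFlow R X s q z' = finiteFlow R X s r z' := fun {q} h3 => by
    have h4 := h1.trans h3
    rw [h1.finiteFlow_left, h1.finiteFlow_right, h4.finiteFlow_left, h4.finiteFlow_right]
    exact ⟨rfl, rfl⟩
  cases h2 with
  | stay hst h =>
    exact ⟨t, hrt, le_rfl, fun q h3 h4 => key (.stay h3 fun q' h5 h6 => h q' h5 (h6.trans h4.le))⟩
  | @jump _ _ r1 _ _ _ _ hsr1 hrt1 h m hm tail =>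
    exact ⟨r1, hsr1, hrt1, fun q h3 h4 => key (.stay h3 fun q' h5 h6 => h q' h5 (h6.trans_lt h4))⟩

end Paths

/-! ### Preservation of the coordinatewise order -/

section Attractive

variable {V : Type*} {p : V → V → ℝ} {Fp Fm : ℕ → ℝ}

lemma rate_nonneg (hp : IsTransitionKernel p) (hF : IsReactionPair Fp Fm) (m : Mark V)
    (η : V → ℕ) : 0 ≤ rate p Fp Fm m η := by
  cases m with
  | birth x => exact hF.birth_nonneg _
  | death x => exact (hF.birth_nonneg _).trans (hF.birth_le_death _)
  | jump x y => exact mul_nonneg (hp.mem_unit x y).1 (Nat.cast_nonneg _)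

lemma transition_le_transition {m : Mark V} {z z' : V → ℕ} (h : z ≤ z') :
    transition m z ≤ transition m z' := by
  classical
  cases m with
  | birth x => exact add_le_add_left h _
  | death x => exact tsub_le_tsub_right h _
  | jump x y => exact add_le_add_left (tsub_le_tsub_right h _) _

/-- A rate that is strictly larger in the smaller configuration cannot be that of a jump, since jump
rates increase with the occupation number. For a birth it forces `z x < z' x`, which leaves room for
the new particle; deaths are harmless. -/
lemma transition_le_of_rate_lt {m : Mark V} {z z' : V → ℕ} (hp : IsTransitionKernel p) (h : z ≤ z')
    (hlt : rate p Fp Fm m z' < rate p Fp Fm m z) : transition m z ≤ z' := by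
  classical
  cases m with
  | birth x =>
    have hx : z x < z' x := lt_of_le_of_ne (h x) fun he => by simp [rate, he] at hlt
    intro y
    simp only [transition, Pi.add_apply, Pi.single_apply]
    split_ifs with hy
    · subst hy; exact hx
    · simpa using h y
  | death x => exact (tsub_le_self).trans h
  | jump x y =>
    exact absurd (mul_le_mul_of_nonneg_left (Nat.cast_le.2 (h x)) (hp.mem_unit x y).1)
      hlt.not_ge

/-- Different rates force different occupation numbers at the site of the mark, so `z'` has a
particle to spare there. -/
lemma le_transition_of_rate_lt {m : Mark V} {z z' : V → ℕ} (h : z ≤ z')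
    (hlt : rate p Fp Fm m z < rate p Fp Fm m z') : z ≤ transition m z' := by
  classical
  have key : ∀ x, z x < z' x → z ≤ z' - Pi.single x 1 := fun x hx y => by
    simp only [Pi.sub_apply, Pi.single_apply]
    split_ifs with hy
    · subst hy; omega
    · simpa using h y
  cases m with
  | birth x => exact h.trans le_self_add
  | death x =>
    exact key x (lt_of_le_of_ne (h x) fun he => by simp [rate, he] at hlt)
  | jump x y =>
    exact (key x (lt_of_le_of_ne (h x) fun he => by simp [rate, he] at hlt)).trans le_self_add

/-- If the mark rings for only one configuration, then the level `u` of the ring lies below one rate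
and not below the other, so the two rates are strictly ordered and the comparison of a moved with an
unmoved configuration applies. -/
lemma nextConfig_le_nextConfig {X : Mark V → Set (ℝ × ℝ)} (hp : IsTransitionKernel p)
    {z z' : V → ℕ} (h : z ≤ z') {r : ℝ≥0} {m : Mark V}
    (hm : ∀ m', m' ∈ ringing (rate p Fp Fm) X r z ∨ m' ∈ ringing (rate p Fp Fm) X r z' → m' = m) :
    nextConfig (rate p Fp Fm) X r z ≤ nextConfig (rate p Fp Fm) X r z' := by
  have e : ∀ {v : V → ℕ}, (∀ m' ∈ ringing (rate p Fp Fm) X r v, m' = m) →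
      m ∉ ringing (rate p Fp Fm) X r v → nextConfig (rate p Fp Fm) X r v = v := fun hv hn =>
    nextConfig_of_empty (Set.eq_empty_iff_forall_notMem.2 fun m' h' => hn (hv m' h' ▸ h'))
  have h1 : ∀ m' ∈ ringing (rate p Fp Fm) X r z, m' = m := fun m' h' => hm m' (.inl h')
  have h2 : ∀ m' ∈ ringing (rate p Fp Fm) X r z', m' = m := fun m' h' => hm m' (.inr h')
  by_cases c1 : m ∈ ringing (rate p Fp Fm) X r z <;> by_cases c2 : m ∈ ringing (rate p Fp Fm) X r z'
  · rw [nextConfig_of_unique c1 h1, nextConfig_of_unique c2 h2]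
    exact transition_le_transition h
  · rw [nextConfig_of_unique c1 h1, e h2 c2]
    obtain ⟨u, hu, hX, hlt⟩ := c1
    refine transition_le_of_rate_lt hp h (lt_of_le_of_lt (not_lt.1 fun h3 => c2 ?_) hlt)
    exact ⟨u, hu, hX, h3⟩
  · rw [e h1 c1, nextConfig_of_unique c2 h2]
    obtain ⟨u, hu, hX, hlt⟩ := c2
    refine le_transition_of_rate_lt h (lt_of_le_of_lt (not_lt.1 fun h3 => c1 ?_) hlt)
    exact ⟨u, hu, hX, h3⟩
  · rw [e h1 c1, e h2 c2]; exact h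

/-- The flow is attractive. -/
lemma PairPath.mono {X : Mark V → Set (ℝ × ℝ)} (hp : IsTransitionKernel p) {s t : ℝ≥0}
    {z z' w w' : V → ℕ} (h : PairPath (rate p Fp Fm) X s t z z' w w') (hz : z ≤ z') : w ≤ w' := by
  induction h with
  | stay => exact hz
  | jump _ _ _ _ hm _ ih => exact ih (nextConfig_le_nextConfig hp hz hm)

end Attractive

/-! ### Discretization in time, with at most one transition per cell -/

section Cells

variable {V : Type*} {R : Mark V → (V → ℕ) → ℝ} {X : Mark V → Set (ℝ × ℝ)}

/-- The points of the time interval `(a,b]` below level `c`. -/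
def box (a b c : ℝ) : Set (ℝ × ℝ) := Set.Ioc a b ×ˢ Set.Ioo 0 c

lemma box_mono {a b c c' : ℝ} (h : c ≤ c') : box a b c ⊆ box a b c' :=
  Set.prod_mono le_rfl (Set.Ioo_subset_Ioo_right h)

/-- The marks with a ring below the rate of `z` in the time interval `(a,b]`. -/
def hitMarks (R : Mark V → (V → ℕ) → ℝ) (X : Mark V → Set (ℝ × ℝ)) (a b : ℝ) (z : V → ℕ) :
    Set (Mark V) := {m | (X m ∩ box a b (R m z)).Nonempty}

/-- The discretized flow on `(a,b]`: the configuration moves once if exactly one mark rings. -/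
noncomputable def cellMap (R : Mark V → (V → ℕ) → ℝ) (X : Mark V → Set (ℝ × ℝ)) (a b : ℝ)
    (z : V → ℕ) : V → ℕ :=
  open Classical in
  if h : ∃ m, hitMarks R X a b z = {m} then transition h.choose z else z

lemma cellMap_of_eq_singleton {a b : ℝ} {z : V → ℕ} {m : Mark V}
    (h : hitMarks R X a b z = {m}) : cellMap R X a b z = transition m z := by
  have h' : ∃ m, hitMarks R X a b z = {m} := ⟨m, h⟩
  unfold cellMap
  rw [dif_pos h']
  rw [Set.singleton_injective (h.symm.trans h'.choose_spec)]

lemma cellMap_of_ne_singleton {a b : ℝ} {z : V → ℕ}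
    (h : ∀ m, hitMarks R X a b z ≠ {m}) : cellMap R X a b z = z := by
  unfold cellMap
  rw [dif_neg]
  rintro ⟨m, hm⟩
  exact h m hm

lemma cellMap_mem {S : Set (V → ℕ)} {z : V → ℕ} (hz : z ∈ S) (hS : ∀ m, transition m z ∈ S)
    (a b : ℝ) : cellMap R X a b z ∈ S := by
  unfold cellMap
  split_ifs with h
  · exact hS _
  · exact hz

/-- A bound for the rates of `m` in the configurations `z`, `z'` and in those after a ring
of `m₀`. -/
noncomputable def cap (R : Mark V → (V → ℕ) → ℝ) (z z' : V → ℕ) (m₀ m : Mark V) : ℝ :=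
  R m z + R m z' + (R m (transition m₀ z) + R m (transition m₀ z'))

/-- The event that more than one ring may matter in the time interval `(a,b]`. -/
def Bad (R : Mark V → (V → ℕ) → ℝ) (X : Mark V → Set (ℝ × ℝ)) (a b : ℝ) (z z' : V → ℕ) : Prop :=
  ∃ m₀, (X m₀ ∩ box a b (R m₀ z + R m₀ z')).Nonempty ∧
    ((X m₀ ∩ box a b (cap R z z' m₀ m₀)).Nontrivial ∨
      ∃ m, m ≠ m₀ ∧ (X m ∩ box a b (cap R z z' m₀ m)).Nonempty)

/-- Outside the bad event at most one point of the clocks can matter in the cell, before or after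
the first transition. Testing the rates at the left end of the cell then finds every transition. -/
lemma pairPath_of_not_bad (hR : ∀ m z, 0 ≤ R m z) {a b : ℝ≥0} (hab : a ≤ b) {z z' : V → ℕ}
    (h : ¬ Bad R X a b z z') :
    PairPath R X a b z z' (cellMap R X a b z) (cellMap R X a b z') := by
  by_cases h0 : ∃ m₀, (X m₀ ∩ box a b (R m₀ z + R m₀ z')).Nonempty
  · obtain ⟨m, hm⟩ := h0
    have h1 : ¬ (X m ∩ box a b (cap R z z' m m)).Nontrivial := fun h' => h ⟨m, hm, .inl h'⟩
    have h2 : ∀ m', m' ≠ m → ¬ (X m' ∩ box a b (cap R z z' m m')).Nonempty :=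
      fun m' h' h'' => h ⟨m, hm, .inr ⟨m', h', h''⟩⟩
    obtain ⟨⟨r, u⟩, hX, hbox⟩ := hm
    obtain ⟨⟨har, hrb⟩, hu0, hu⟩ := id hbox
    simp only at har hrb hu0 hu
    lift r to ℝ≥0 using a.2.trans har.le
    have hc : ∀ m', R m' z ≤ cap R z z' m m' ∧ R m' z' ≤ cap R z z' m m' ∧
        R m' (transition m z) ≤ cap R z z' m m' ∧ R m' (transition m z') ≤ cap R z z' m m' := by
      intro m'
      have := hR m' z
      have := hR m' z'
      have := hR m' (transition m z)
      have := hR m' (transition m z')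
      unfold cap
      refine ⟨?_, ?_, ?_, ?_⟩ <;> linarith
    have hru : ((r : ℝ), u) ∈ X m ∩ box a b (cap R z z' m m) := by
      refine ⟨hX, box_mono ?_ hbox⟩
      have := hR m (transition m z)
      have := hR m (transition m z')
      unfold cap
      linarith
    -- No clock has a point below its cap other than `(r, u)`; so any ring of a configuration whose
    -- rates are below the caps is this one.
    have key : ∀ {q u' : ℝ} {m'} {v : V → ℕ}, R m' v ≤ cap R z z' m m' → (a : ℝ) < q → q ≤ b →
        0 < u' → (q, u') ∈ X m' → u' < R m' v → m' = m ∧ q = r ∧ u' = u := by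
      intro q u' m' v hv hq1 hq2 hu1 hX' hu2
      have hmem : (q, u') ∈ X m' ∩ box a b (cap R z z' m m') :=
        ⟨hX', ⟨hq1, hq2⟩, hu1, hu2.trans_le hv⟩
      by_cases hmm : m' = m
      · subst hmm
        have := Set.not_nontrivial_iff.1 h1 hmem hru
        simp only [Prod.mk.injEq] at this
        exact ⟨rfl, this.1, this.2⟩
      · exact absurd ⟨_, hmem⟩ (h2 m' hmm)
    have hring : ∀ {v : V → ℕ}, (∀ m', R m' v ≤ cap R z z' m m') → ∀ q : ℝ≥0, a < q → q ≤ b →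
        ∀ m' ∈ ringing R X q v, m' = m ∧ q = r ∧ u < R m v := by
      rintro v hv q hq1 hq2 m' ⟨u', h3, h4, h5⟩
      obtain ⟨e1, e2, e3⟩ := key (hv m') hq1 hq2 h3 h4 h5
      subst e1 e3
      exact ⟨rfl, NNReal.eq e2, h5⟩
    have hnext : ∀ {v : V → ℕ}, (∀ m', R m' v ≤ cap R z z' m m') →
        nextConfig R X r v = cellMap R X a b v := by
      intro v hv
      by_cases hv' : u < R m v
      · have h3 : hitMarks R X a b v = {m} := by
          ext m'
          constructor
          · rintro ⟨⟨q, u'⟩, h4, ⟨h5, h6⟩, h7, h8⟩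
            exact (key (hv m') h5 h6 h7 h4 h8).1
          · rintro rfl
            exact ⟨(r, u), hX, ⟨har, hrb⟩, hu0, hv'⟩
        rw [cellMap_of_eq_singleton h3]
        exact nextConfig_of_unique ⟨u, hu0, hX, hv'⟩
          fun m' hm' => (hring hv r (by exact_mod_cast har) (by exact_mod_cast hrb) m' hm').1
      · rw [cellMap_of_ne_singleton, nextConfig_of_empty]
        · refine Set.eq_empty_iff_forall_notMem.2 fun m' h' => hv' ?_
          exact (hring hv r (by exact_mod_cast har) (by exact_mod_cast hrb) m' h').2.2
        · intro m' h3
          have : m' ∈ hitMarks R X a b v := by rw [h3]; rfl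
          obtain ⟨⟨q, u'⟩, h4, ⟨h5, h6⟩, h7, h8⟩ := this
          obtain ⟨e1, e2, e3⟩ := key (hv m') h5 h6 h7 h4 h8
          simp only at e3 h8
          subst e1 e3
          exact hv' h8
    have hz := fun m' => (hc m').1
    have hz' := fun m' => (hc m').2.1
    have har' : a < r := by exact_mod_cast har
    have hrb' : r ≤ b := by exact_mod_cast hrb
    have hno : ∀ {v : V → ℕ}, (∀ m', R m' v ≤ cap R z z' m m') → ∀ q : ℝ≥0, a < q → q ≤ b →
        q ≠ r → ringing R X q v = ∅ := fun hv q h3 h4 h5 =>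
      Set.eq_empty_iff_forall_notMem.2 fun m' h' => h5 (hring hv q h3 h4 m' h').2.1
    refine .jump har' hrb' (fun q h3 h4 => ⟨hno hz q h3 (h4.le.trans hrb') h4.ne,
      hno hz' q h3 (h4.le.trans hrb') h4.ne⟩) m ?_ ?_
    · rintro m' (h' | h')
      · exact (hring hz r har' hrb' m' h').1
      · exact (hring hz' r har' hrb' m' h').1
    -- The caps include the rates after a ring of `m`, so the new configurations are covered too and
    -- there is no second transition in the cell.
    · have hcell : ∀ {v : V → ℕ}, (∀ m', R m' v ≤ cap R z z' m m') →
          (∀ m', R m' (transition m v) ≤ cap R z z' m m') →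
          ∀ m', R m' (cellMap R X a b v) ≤ cap R z z' m m' := by
        intro v hv hv'
        by_cases h3 : ∃ m', hitMarks R X a b v = {m'}
        · obtain ⟨m', h3⟩ := h3
          have h9 : m' ∈ hitMarks R X a b v := by rw [h3]; rfl
          obtain ⟨⟨q, u'⟩, h4, ⟨h5, h6⟩, h7, h8⟩ := h9
          obtain ⟨rfl, -, -⟩ := key (hv m') h5 h6 h7 h4 h8
          rw [cellMap_of_eq_singleton h3]
          exact hv'
        · rw [cellMap_of_ne_singleton fun m' hm' => h3 ⟨m', hm'⟩]
          exact hv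
      rw [hnext hz, hnext hz']
      refine .stay hrb' fun q h3 h4 => ⟨?_, ?_⟩
      · exact hno (hcell hz fun m' => (hc m').2.2.1) q (har'.trans h3) h4 h3.ne'
      · exact hno (hcell hz' fun m' => (hc m').2.2.2) q (har'.trans h3) h4 h3.ne'
  · have hno : ∀ {v : V → ℕ}, (∀ m, R m v ≤ R m z + R m z') → hitMarks R X a b v = ∅ := by
      intro v hv
      refine Set.eq_empty_iff_forall_notMem.2 fun m hm => h0 ⟨m, hm.mono ?_⟩
      exact Set.inter_subset_inter_right _ (box_mono (hv m))
    have hz : ∀ m, R m z ≤ R m z + R m z' := fun m => le_add_of_nonneg_right (hR m z')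
    have hz' : ∀ m, R m z' ≤ R m z + R m z' := fun m => le_add_of_nonneg_left (hR m z)
    have hring : ∀ {v : V → ℕ}, (∀ m, R m v ≤ R m z + R m z') → ∀ q : ℝ≥0, a < q → q ≤ b →
        ringing R X q v = ∅ := by
      intro v hv q h1 h2
      refine Set.eq_empty_iff_forall_notMem.2 fun m hm => ?_
      obtain ⟨u, h3, h4, h5⟩ := hm
      have : m ∈ hitMarks R X a b v := ⟨(q, u), h4, ⟨h1, h2⟩, h3, h5⟩
      rw [hno hv] at this
      exact this
    have hcell : ∀ {v : V → ℕ}, (∀ m, R m v ≤ R m z + R m z') → cellMap R X a b v = v := fun hv =>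
      cellMap_of_ne_singleton fun m hm => by
        rw [hno hv] at hm
        exact (Set.singleton_ne_empty m) hm.symm
    rw [hcell hz, hcell hz']
    exact .stay hab fun q h1 h2 => ⟨hring hz q h1 h2, hring hz' q h1 h2⟩

/-- The discretized flow on pairs of configurations along the grid `t`, held outside `S`. -/
noncomputable def chain (R : Mark V → (V → ℕ) → ℝ) (X : Mark V → Set (ℝ × ℝ))
    (S : Set ((V → ℕ) × (V → ℕ))) (t : ℕ → ℝ≥0) (q : (V → ℕ) × (V → ℕ)) :
    ℕ → (V → ℕ) × (V → ℕ)
  | 0 => q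
  | i + 1 =>
    open Classical in
    if chain R X S t q i ∈ S then
      (cellMap R X (t i) (t (i + 1)) (chain R X S t q i).1,
        cellMap R X (t i) (t (i + 1)) (chain R X S t q i).2)
    else chain R X S t q i

/-- A state outside `S` is held forever, so one that ends in `S` has never left it. -/
lemma chain_mem_of_le {S : Set ((V → ℕ) × (V → ℕ))} {t : ℕ → ℝ≥0} {q : (V → ℕ) × (V → ℕ)}
    {i n : ℕ} (hin : i ≤ n) (h : chain R X S t q n ∈ S) : chain R X S t q i ∈ S := by
  induction n, hin using Nat.le_induction with
  | base => exact h
  | succ n _ ih =>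
    by_contra hi
    by_cases hn : chain R X S t q n ∈ S
    · exact hi (ih hn)
    · rw [chain, if_neg hn] at h
      exact hn h

lemma pairPath_chain (hR : ∀ m z, 0 ≤ R m z) {S : Set ((V → ℕ) × (V → ℕ))} {t : ℕ → ℝ≥0}
    (ht : Monotone t) {q : (V → ℕ) × (V → ℕ)} {n : ℕ} (hS : chain R X S t q n ∈ S)
    (h : ∀ i < n, ¬ Bad R X (t i) (t (i + 1)) (chain R X S t q i).1 (chain R X S t q i).2) :
    PairPath R X (t 0) (t n) q.1 q.2 (chain R X S t q n).1 (chain R X S t q n).2 := by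
  induction n with
  | zero => exact PairPath.refl _ _ _
  | succ n ih =>
    have hn := chain_mem_of_le n.le_succ hS
    refine (ih hn fun i hi => h i (hi.trans n.lt_succ_self)).trans ?_
    rw [chain, if_pos hn]
    exact pairPath_of_not_bad hR (ht n.le_succ) (h n n.lt_succ_self)

end Cells

/-! ### Poisson clocks: void events, independence over disjoint regions, small boxes -/

section Clocks

variable {V Ω : Type*}

/-- The event that the clock of `m` rings in `B`. -/
def hits (X : Mark V → Ω → Set (ℝ × ℝ)) (m : Mark V) (B : Set (ℝ × ℝ)) : Set Ω :=
  {ω | (X m ω ∩ B).Nonempty}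

/-- The σ-algebra generated by the clocks in the region `S`. -/
@[reducible]
def regionSigma (X : Mark V → Ω → Set (ℝ × ℝ)) (S : Set (ℝ × ℝ)) : MeasurableSpace Ω :=
  MeasurableSpace.generateFrom
    {A | ∃ m B, MeasurableSet B ∧ B ⊆ S ∧ A = {ω | X m ω ∩ B = ∅}}

lemma regionSigma_mono (X : Mark V → Ω → Set (ℝ × ℝ)) {S S' : Set (ℝ × ℝ)} (h : S ⊆ S') :
    regionSigma X S ≤ regionSigma X S' :=
  MeasurableSpace.generateFrom_mono fun _ ⟨m, B, h1, h2, h3⟩ => ⟨m, B, h1, h2.trans h, h3⟩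

lemma measurableSet_hits {X : Mark V → Ω → Set (ℝ × ℝ)} {S B : Set (ℝ × ℝ)} (m : Mark V)
    (hB : MeasurableSet B) (hBS : B ⊆ S) : MeasurableSet[regionSigma X S] (hits X m B) := by
  have h : MeasurableSet[regionSigma X S] {ω | X m ω ∩ B = ∅} :=
    MeasurableSpace.measurableSet_generateFrom ⟨m, B, hB, hBS, rfl⟩
  convert h.compl using 1
  ext ω
  simp [hits, Set.nonempty_iff_ne_empty]

/-- Two points of a clock in `B` are separated by disjoint basic open sets. -/
lemma measurableSet_nontrivial {X : Mark V → Ω → Set (ℝ × ℝ)} {S B : Set (ℝ × ℝ)} (m : Mark V)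
    (hB : MeasurableSet B) (hBS : B ⊆ S) :
    MeasurableSet[regionSigma X S] {ω | (X m ω ∩ B).Nontrivial} := by
  have : {ω | (X m ω ∩ B).Nontrivial} =
      ⋃ U ∈ TopologicalSpace.countableBasis (ℝ × ℝ),
        ⋃ U' ∈ TopologicalSpace.countableBasis (ℝ × ℝ), ⋃ _ : Disjoint U U',
          hits X m (B ∩ U) ∩ hits X m (B ∩ U') := by
    ext ω
    simp only [hits, Set.mem_iUnion, Set.mem_inter_iff, exists_prop]
    constructor
    · rintro ⟨x, ⟨hx, hxB⟩, y, ⟨hy, hyB⟩, hxy⟩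
      obtain ⟨U, U', hU, hU', hxU, hyU, hd⟩ := t2_separation hxy
      obtain ⟨W, hW, hxW, hWU⟩ :=
        (TopologicalSpace.isBasis_countableBasis (ℝ × ℝ)).exists_subset_of_mem_open hxU hU
      obtain ⟨W', hW', hyW, hWU'⟩ :=
        (TopologicalSpace.isBasis_countableBasis (ℝ × ℝ)).exists_subset_of_mem_open hyU hU'
      exact ⟨W, hW, W', hW', hd.mono hWU hWU', ⟨x, hx, hxB, hxW⟩, ⟨y, hy, hyB, hyW⟩⟩
    · rintro ⟨W, -, W', -, hd, ⟨x, hx, hxB, hxW⟩, ⟨y, hy, hyB, hyW⟩⟩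
      exact ⟨x, ⟨hx, hxB⟩, y, ⟨hy, hyB⟩, fun h => Set.disjoint_left.1 hd hxW (h ▸ hyW)⟩
  rw [this]
  have hc := TopologicalSpace.countable_countableBasis (ℝ × ℝ)
  have hm : ∀ U ∈ TopologicalSpace.countableBasis (ℝ × ℝ),
      MeasurableSet[regionSigma X S] (hits X m (B ∩ U)) := fun U hU =>
    measurableSet_hits m (hB.inter (TopologicalSpace.isOpen_of_mem_countableBasis hU).measurableSet)
      (Set.inter_subset_left.trans hBS)
  exact MeasurableSet.biUnion hc fun U hU => MeasurableSet.biUnion hc fun U' hU' =>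
    MeasurableSet.iUnion fun _ => (hm U hU).inter (hm U' hU')

lemma measurableSet_void {X : Mark V → Ω → Set (ℝ × ℝ)} (m : Mark V) {B : Set (ℝ × ℝ)} (hB : MeasurableSet B) :
    MeasurableSet[countSigma (X m)] {ω | X m ω ∩ B = ∅} := by
  have h1 : MeasurableSpace.comap (fun ω => (X m ω ∩ B).encard) inferInstance ≤
      countSigma (X m) := le_iSup₂_of_le B hB le_rfl
  refine h1 _ ⟨{0}, measurableSet_singleton _, ?_⟩
  ext ω
  simp [Set.encard_eq_zero]

variable [MeasurableSpace Ω] {P : Measure Ω} {X : Mark V → Ω → Set (ℝ × ℝ)}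

lemma countSigma_le (hX : IsPoissonClocks X P) (m : Mark V) :
    countSigma (X m) ≤ (inferInstance : MeasurableSpace Ω) :=
  iSup₂_le fun B hB => ((hX.poisson m).measurable_count B hB).comap_le

lemma regionSigma_le (hX : IsPoissonClocks X P) (S : Set (ℝ × ℝ)) :
    regionSigma X S ≤ (inferInstance : MeasurableSpace Ω) := by
  refine MeasurableSpace.generateFrom_le ?_
  rintro _ ⟨m, B, hB, -, rfl⟩
  exact countSigma_le hX m _ (measurableSet_void m hB)

lemma measurableSet_hits' (hX : IsPoissonClocks X P) (m : Mark V) {B : Set (ℝ × ℝ)}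
    (hB : MeasurableSet B) : MeasurableSet (hits X m B) :=
  regionSigma_le hX B _ (measurableSet_hits m hB le_rfl)

/-- A union is void when both counts are zero, and counts in disjoint sets are independent. -/
lemma measure_void_union (hX : IsPoissonClocks X P) (m : Mark V) {B B' : Set (ℝ × ℝ)}
    (hB : MeasurableSet B) (hB' : MeasurableSet B') (hd : Disjoint B B') :
    P {ω | X m ω ∩ (B ∪ B') = ∅} = P {ω | X m ω ∩ B = ∅} * P {ω | X m ω ∩ B' = ∅} := by
  have h := (hX.poisson m).indep 2 ![B, B']
    (by simp [Fin.forall_fin_two, hB, hB'])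
    (by
      intro i j hij
      fin_cases i <;> fin_cases j <;> simp_all [hd.symm])
  have h2 := (h.indepFun (i := 0) (j := 1) (by simp)).measure_inter_preimage_eq_mul {0} {0}
    (measurableSet_singleton _) (measurableSet_singleton _)
  convert h2 using 2
  · ext ω
    simp [Set.inter_union_distrib_left, Set.union_empty_iff]
  · congr 1; ext ω; simp
  · congr 1; ext ω; simp

/-- The clocks in disjoint regions are independent. -/
lemma indep_regionSigma [IsProbabilityMeasure P] (hX : IsPoissonClocks X P) {S S' : Set (ℝ × ℝ)}
    (hd : Disjoint S S') : Indep (regionSigma X S) (regionSigma X S') P := by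
  classical
  -- Void events of finitely many clocks form a π-system: an intersection is obtained by uniting the
  -- regions mark by mark. On it, independence is a product formula, from the independence of
  -- different clocks and `measure_void_union`.
  let C : Set (ℝ × ℝ) → Set (Set Ω) := fun S =>
    {A | ∃ (F : Finset (Mark V)) (B : Mark V → Set (ℝ × ℝ)),
      (∀ m, MeasurableSet (B m) ∧ B m ⊆ S) ∧ (∀ m ∉ F, B m = ∅) ∧
      A = ⋂ m ∈ F, {ω | X m ω ∩ B m = ∅}}
  have hle : ∀ S A, A ∈ C S → MeasurableSet[regionSigma X S] A := by
    rintro S _ ⟨F, B, hB, -, rfl⟩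
    exact Finset.measurableSet_biInter _ fun m _ =>
      MeasurableSpace.measurableSet_generateFrom ⟨m, B m, (hB m).1, (hB m).2, rfl⟩
  have hextend : ∀ {F G : Finset (Mark V)} {B : Mark V → Set (ℝ × ℝ)}, F ⊆ G →
      (∀ m ∉ F, B m = ∅) → (⋂ m ∈ F, {ω | X m ω ∩ B m = ∅}) = ⋂ m ∈ G, {ω | X m ω ∩ B m = ∅} := by
    intro F G B hFG hB
    ext ω
    simp only [Set.mem_iInter]
    refine ⟨fun h m _ => ?_, fun h m hm => h m (hFG hm)⟩
    by_cases hm : m ∈ F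
    · exact h m hm
    · simp [hB m hm]
  have hinter : ∀ {G : Finset (Mark V)} {B B' : Mark V → Set (ℝ × ℝ)},
      (⋂ m ∈ G, {ω | X m ω ∩ B m = ∅}) ∩ (⋂ m ∈ G, {ω | X m ω ∩ B' m = ∅}) =
        ⋂ m ∈ G, {ω | X m ω ∩ (B m ∪ B' m) = ∅} := by
    intro G B B'
    ext ω
    simp only [Set.mem_inter_iff, Set.mem_iInter, Set.mem_ofPred_eq, Set.inter_union_distrib_left,
      Set.union_empty_iff]
    exact ⟨fun h m hm => ⟨h.1 m hm, h.2 m hm⟩, fun h => ⟨fun m hm => (h m hm).1,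
      fun m hm => (h m hm).2⟩⟩
  have hpi : ∀ S, IsPiSystem (C S) := by
    rintro S _ ⟨F, B, hB, hBF, rfl⟩ _ ⟨F', B', hB', hBF', rfl⟩ -
    refine ⟨F ∪ F', fun m => B m ∪ B' m, fun m => ⟨(hB m).1.union (hB' m).1,
      Set.union_subset (hB m).2 (hB' m).2⟩, fun m hm => ?_, ?_⟩
    · simp only [Finset.mem_union, not_or] at hm
      simp [hBF m hm.1, hBF' m hm.2]
    · rw [hextend Finset.subset_union_left hBF, hextend Finset.subset_union_right hBF', hinter]
  have hgen : ∀ S, regionSigma X S = MeasurableSpace.generateFrom (C S) := by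
    intro S
    refine le_antisymm (MeasurableSpace.generateFrom_mono ?_)
      (MeasurableSpace.generateFrom_le (hle S))
    rintro _ ⟨m, B, hB, hBS, rfl⟩
    refine ⟨{m}, fun m' => if m' = m then B else ∅, fun m' => ?_, fun m' hm' => ?_, ?_⟩
    · by_cases h : m' = m <;> simp only [h, if_true, if_false]
      · exact ⟨hB, hBS⟩
      · exact ⟨MeasurableSet.empty, Set.empty_subset _⟩
    · simp only [Finset.mem_singleton] at hm'
      simp [hm']
    · simp
  have hprod : ∀ (G : Finset (Mark V)) {B : Mark V → Set (ℝ × ℝ)}, (∀ m, MeasurableSet (B m)) →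
      P (⋂ m ∈ G, {ω | X m ω ∩ B m = ∅}) = ∏ m ∈ G, P {ω | X m ω ∩ B m = ∅} := fun G B hB =>
    hX.indep.meas_biInter fun m _ => measurableSet_void m (hB m)
  refine IndepSets.indep (regionSigma_le hX S) (regionSigma_le hX S') (hpi S) (hpi S') (hgen S)
    (hgen S') ?_
  rw [IndepSets_iff]
  rintro _ _ ⟨F, B, hB, hBF, rfl⟩ ⟨F', B', hB', hBF', rfl⟩
  rw [hextend Finset.subset_union_left hBF, hextend Finset.subset_union_right hBF', hinter,
    hprod _ fun m => (hB m).1, hprod _ fun m => (hB' m).1,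
    hprod _ fun m => (hB m).1.union (hB' m).1, ← Finset.prod_mul_distrib]
  exact Finset.prod_congr rfl fun m _ => measure_void_union hX m (hB m).1 (hB' m).1
    (hd.mono (hB m).2 (hB' m).2)

lemma volume_box {a b c : ℝ} (ha : 0 ≤ a) :
    (volume : Measure (ℝ × ℝ)).restrict quadrant (box a b c) =
      ENNReal.ofReal (b - a) * ENNReal.ofReal c := by
  rw [box, Measure.restrict_apply (measurableSet_Ioc.prod measurableSet_Ioo),
    Set.inter_eq_left.2, Measure.volume_eq_prod, Measure.prod_prod, Real.volume_Ioc,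
    Real.volume_Ioo, sub_zero]
  exact Set.prod_mono (fun x hx => ha.trans_lt hx.1) fun x hx => hx.1

lemma measurableSet_box (a b c : ℝ) : MeasurableSet (box a b c) :=
  measurableSet_Ioc.prod measurableSet_Ioo

lemma measure_hits_compl (hX : IsPoissonClocks X P) (m : Mark V) {a b c : ℝ} (ha : 0 ≤ a)
    (hab : a ≤ b) (hc : 0 ≤ c) :
    P (hits X m (box a b c))ᶜ = ENNReal.ofReal (Real.exp (-((b - a) * c))) := by
  have h := (hX.poisson m).poisson (box a b c) (measurableSet_box a b c)
    (by rw [volume_box ha]; exact ENNReal.mul_ne_top ENNReal.ofReal_ne_top ENNReal.ofReal_ne_top) 0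
  rw [volume_box ha, poissonMeasure_singleton, ← ENNReal.ofReal_mul (by linarith)] at h
  convert h using 1
  · congr 1
    ext ω
    simp [hits, Set.not_nonempty_iff_eq_empty]
  · simp only [ENNReal.coe_toNNReal_eq_toReal, pow_zero, Nat.factorial_zero, Nat.cast_one]
    rw [ENNReal.toReal_ofReal (mul_nonneg (by linarith) hc)]
    simp

lemma measure_hits [IsProbabilityMeasure P] (hX : IsPoissonClocks X P) (m : Mark V) {a b c : ℝ}
    (ha : 0 ≤ a) (hab : a ≤ b) (hc : 0 ≤ c) :
    P (hits X m (box a b c)) = ENNReal.ofReal (1 - Real.exp (-((b - a) * c))) := by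
  have h := prob_compl_eq_one_sub (μ := P) (measurableSet_hits' hX m (measurableSet_box a b c)).compl
  rw [compl_compl, measure_hits_compl hX m ha hab hc] at h
  rw [h, ENNReal.ofReal_sub _ (Real.exp_pos _).le, ENNReal.ofReal_one]

lemma measure_hits_le [IsProbabilityMeasure P] (hX : IsPoissonClocks X P) (m : Mark V) {a b c : ℝ}
    (ha : 0 ≤ a) (hab : a ≤ b) (hc : 0 ≤ c) :
    P (hits X m (box a b c)) ≤ ENNReal.ofReal ((b - a) * c) := by
  rw [measure_hits hX m ha hab hc]
  refine ENNReal.ofReal_le_ofReal ?_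
  have := Real.add_one_le_exp (-((b - a) * c))
  linarith

/-- With `λ = (b - a) * c`, the probability of two points is at most `1 - e^{-λ} - λ e^{-λ}`, and
`e^{-λ} ≥ 1 - λ` bounds this by `λ²`. -/
lemma measure_nontrivial_le [IsProbabilityMeasure P] (hX : IsPoissonClocks X P) (m : Mark V)
    {a b c : ℝ} (ha : 0 ≤ a) (hab : a ≤ b) (hc : 0 ≤ c) :
    P {ω | (X m ω ∩ box a b c).Nontrivial} ≤
      ENNReal.ofReal ((b - a) * c) * ENNReal.ofReal ((b - a) * c) := by
  have hnn : 0 ≤ (b - a) * c := mul_nonneg (by linarith) hc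
  have h1 := (hX.poisson m).poisson (box a b c) (measurableSet_box a b c)
    (by rw [volume_box ha]; exact ENNReal.mul_ne_top ENNReal.ofReal_ne_top ENNReal.ofReal_ne_top) 1
  rw [volume_box ha, poissonMeasure_singleton, ← ENNReal.ofReal_mul (by linarith)] at h1
  simp only [ENNReal.coe_toNNReal_eq_toReal, ENNReal.toReal_ofReal hnn, pow_one, Nat.factorial_one,
    Nat.cast_one, div_one] at h1
  have hsub : {ω | (X m ω ∩ box a b c).Nontrivial} ⊆
      hits X m (box a b c) \ {ω | (X m ω ∩ box a b c).encard = 1} := by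
    intro ω hω
    refine ⟨hω.nonempty, fun h => ?_⟩
    obtain ⟨x, hx⟩ := Set.encard_eq_one.1 h
    have h2 : (X m ω ∩ box a b c).Nontrivial := hω
    rw [hx] at h2
    exact Set.not_nontrivial_singleton h2
  have hm1 : MeasurableSet {ω | (X m ω ∩ box a b c).encard = 1} :=
    (hX.poisson m).measurable_count _ (measurableSet_box a b c) (measurableSet_singleton 1)
  refine (measure_mono hsub).trans ?_
  rw [measure_sdiff _ hm1.nullMeasurableSet (measure_ne_top _ _), measure_hits hX m ha hab hc, h1,
    ← ENNReal.ofReal_sub _ (by positivity), ← ENNReal.ofReal_mul hnn]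
  · refine ENNReal.ofReal_le_ofReal ?_
    have h3 := Real.add_one_le_exp (-((b - a) * c))
    nlinarith
  · intro ω hω
    obtain ⟨x, hx⟩ := Set.encard_eq_one.1 hω
    exact ⟨x, by rw [hx]; rfl⟩

lemma measure_hits_inter (hX : IsPoissonClocks X P) {m m' : Mark V} (hm : m ≠ m')
    {B B' : Set (ℝ × ℝ)} (hB : MeasurableSet B) (hB' : MeasurableSet B') :
    P (hits X m B ∩ hits X m' B') = P (hits X m B) * P (hits X m' B') := by
  have key : ∀ m B, MeasurableSet B → MeasurableSet[countSigma (X m)] (hits X m B) := by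
    intro m B hB
    convert (measurableSet_void (X := X) m hB).compl using 1
    ext ω
    simp [hits, Set.nonempty_iff_ne_empty]
  exact (Indep_iff _ _ _).1 (hX.indep.indep hm) _ _ (key m B hB) (key m' B' hB')

lemma measure_hits_inter_disjoint [IsProbabilityMeasure P] (hX : IsPoissonClocks X P) (m : Mark V)
    {B B' : Set (ℝ × ℝ)} (hB : MeasurableSet B) (hB' : MeasurableSet B') (hd : Disjoint B B') :
    P (hits X m B ∩ hits X m B') = P (hits X m B) * P (hits X m B') :=
  (Indep_iff _ _ _).1 (indep_regionSigma hX hd) _ _ (measurableSet_hits m hB le_rfl)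
    (measurableSet_hits m hB' le_rfl)

end Clocks

/-! ### Integration over an independent randomness -/

section Freezing

variable {Ω β : Type*} {m₁ m₂ : MeasurableSpace Ω} [mΩ : MeasurableSpace Ω] {P : Measure Ω}

/-- Integration of a function of a random element `f` and an independent randomness: one may
freeze `f`. -/
lemma setLIntegral_freeze_le (h1 : m₁ ≤ mΩ) (h2 : m₂ ≤ mΩ)
    (hind : Indep m₁ m₂ P) {D : Set β} (hD : D.Countable) {f : Ω → β} (hfD : ∀ ω, f ω ∈ D)
    (hf : ∀ q ∈ D, MeasurableSet[m₁] {ω | f ω = q}) {g : β → Ω → ℝ≥0∞}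
    (hg : ∀ q ∈ D, Measurable[m₂] (g q)) {φ : β → ℝ≥0∞} (hφ : ∀ q ∈ D, ∫⁻ ω, g q ω ∂P ≤ φ q)
    {G : Set Ω} (hG : MeasurableSet[m₁] G) :
    ∫⁻ ω in G, g (f ω) ω ∂P ≤ ∫⁻ ω in G, φ (f ω) ∂P := by
  -- Since `f` takes countably many values, the integral splits over its level sets. On each of them
  -- the integrand is a fixed `g q`, independent of the level set, and no joint measurability is
  -- needed.
  have hU : G = ⋃ q ∈ D, G ∩ {ω | f ω = q} := by
    ext ω; simp [hfD]
  have hm : ∀ q ∈ D, MeasurableSet (G ∩ {ω | f ω = q}) := fun q hq =>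
    h1 _ (hG.inter (hf q hq))
  have hdisj : D.PairwiseDisjoint fun q => G ∩ {ω | f ω = q} := by
    intro q _ q' _ hqq
    refine Set.disjoint_left.2 ?_
    rintro ω ⟨-, h⟩ ⟨-, h'⟩
    exact hqq (h.symm.trans h')
  rw [hU, lintegral_biUnion hD hm hdisj, lintegral_biUnion hD hm hdisj]
  refine ENNReal.tsum_le_tsum fun ⟨q, hq⟩ => ?_
  have e1 : ∫⁻ ω in G ∩ {ω | f ω = q}, g (f ω) ω ∂P = ∫⁻ ω in G ∩ {ω | f ω = q}, g q ω ∂P :=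
    setLIntegral_congr_fun (hm q hq) fun ω hω => by
      have : f ω = q := hω.2
      simp only [this]
  have e2 : ∫⁻ ω in G ∩ {ω | f ω = q}, φ (f ω) ∂P = ∫⁻ _ in G ∩ {ω | f ω = q}, φ q ∂P :=
    setLIntegral_congr_fun (hm q hq) fun ω hω => by
      have : f ω = q := hω.2
      simp only [this]
  simp only
  rw [e1, e2, setLIntegral_const, ← lintegral_indicator (hm q hq)]
  have e3 : (fun ω => (G ∩ {ω | f ω = q}).indicator (g q) ω) =
      fun ω => (G ∩ {ω | f ω = q}).indicator (fun _ => 1) ω * g q ω := by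
    ext ω
    by_cases hω : ω ∈ G ∩ {ω | f ω = q} <;> simp [hω]
  have e0 : Measurable[m₁] ((G ∩ {ω | f ω = q}).indicator fun _ => (1 : ℝ≥0∞)) := by
    have hs : MeasurableSet[m₁] (G ∩ {ω | f ω = q}) := hG.inter (hf q hq)
    exact (measurable_indicator_const_iff 1).2 hs
  have e4 : ∫⁻ ω, (G ∩ {ω | f ω = q}).indicator (fun _ => 1) ω * g q ω ∂P =
      (∫⁻ ω, (G ∩ {ω | f ω = q}).indicator (fun _ => 1) ω ∂P) * ∫⁻ ω, g q ω ∂P :=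
    lintegral_mul_eq_lintegral_mul_lintegral_of_independent_measurableSpace h1 h2 hind
      e0 (hg q hq)
  rw [e3, e4, lintegral_indicator_const (hm q hq), one_mul, mul_comm]
  gcongr
  exact hφ q hq

end Freezing

/-! ### Marks, finite configurations, weighted distance and total rate -/

section Configurations

variable {V : Type*}

/-- Marks are births, deaths or jumps. -/
def markEquiv (V : Type*) : Mark V ≃ (V ⊕ V) ⊕ (V × V) where
  toFun
    | .birth x => .inl (.inl x)
    | .death x => .inl (.inr x)
    | .jump x y => .inr (x, y)
  invFun
    | .inl (.inl x) => .birth x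
    | .inl (.inr x) => .death x
    | .inr (x, y) => .jump x y
  left_inv m := by cases m <;> rfl
  right_inv m := by rcases m with (x | x) | ⟨x, y⟩ <;> rfl

instance [Countable V] : Countable (Mark V) := (markEquiv V).countable_iff.2 inferInstance

lemma tsum_mark (f : Mark V → ℝ≥0∞) :
    ∑' m, f m = ∑' x, f (.birth x) + ∑' x, f (.death x) + ∑' x, ∑' y, f (.jump x y) := by
  rw [← (markEquiv V).symm.tsum_eq f]
  refine HasSum.tsum_eq (HasSum.sum (HasSum.sum ?_ ?_) ?_)
  · exact ENNReal.summable.hasSum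
  · exact ENNReal.summable.hasSum
  · rw [← ENNReal.tsum_prod (f := fun x y => f (.jump x y))]
    exact ENNReal.summable.hasSum

/-- The terms of a convergent series of natural numbers are below `1`, hence zero, off a finite set.
-/
lemma mem_E0_iff {z : V → ℕ} : z ∈ E0 V ↔ (Function.support z).Finite := by
  constructor
  · intro h
    have h1 := (h : Summable fun x => (z x : ℝ)).tendsto_cofinite_zero.eventually_lt_const one_pos
    refine (Filter.eventually_cofinite.1 h1).subset fun x hx => ?_
    simp only [Set.mem_ofPred_eq, not_lt, Nat.one_le_cast]
    exact Nat.one_le_iff_ne_zero.2 hx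
  · intro h
    refine summable_of_hasFiniteSupport (h.subset fun x hx => ?_)
    simpa using hx

/-- Countability of the state space reduces measurability to level sets and conditioning to a sum
over values. -/
lemma E0_countable [Countable V] : (E0 V).Countable := by
  refine (Set.countable_range fun f : V →₀ ℕ => (f : V → ℕ)).mono fun z hz => ?_
  exact ⟨Finsupp.ofSupportFinite z (mem_E0_iff.1 hz), rfl⟩

lemma transition_mem_E0 {z : V → ℕ} (hz : z ∈ E0 V) (m : Mark V) : transition m z ∈ E0 V := by
  classical
  rw [mem_E0_iff] at hz ⊢
  have h1 : ∀ x : V, (Function.support (Pi.single x 1 : V → ℕ)).Finite := fun x =>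
    (Set.finite_singleton x).subset Pi.support_single_subset
  have h2 : ∀ (z v : V → ℕ), (Function.support z).Finite → (Function.support (z - v)).Finite :=
    fun z v h => h.subset fun x hx => by
      simp only [Function.mem_support, Pi.sub_apply] at hx ⊢
      omega
  have h3 : ∀ {z v : V → ℕ}, (Function.support z).Finite → (Function.support v).Finite →
      (Function.support (z + v)).Finite := fun h h' =>
    (h.union h').subset (Function.support_add _ _)
  cases m with
  | birth x => exact h3 hz (h1 x)
  | death x => exact h2 _ _ hz
  | jump x y => exact h3 (h2 _ _ hz) (h1 y)

/-- The weighted distance, with values in `[0,∞]`. -/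
noncomputable def edistα (α : V → ℝ) (z z' : V → ℕ) : ℝ≥0∞ :=
  ∑' x, ENNReal.ofReal (α x * |(z x : ℝ) - (z' x : ℝ)|)

lemma edistα_self (α : V → ℝ) (z : V → ℕ) : edistα α z z = 0 := by simp [edistα]

lemma edistα_comm (α : V → ℝ) (z z' : V → ℕ) : edistα α z z' = edistα α z' z := by
  simp only [edistα, abs_sub_comm]

lemma edistα_triangle {α : V → ℝ} (hα : ∀ x, 0 ≤ α x) (z v z' : V → ℕ) :
    edistα α z z' ≤ edistα α z v + edistα α v z' := by
  unfold edistα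
  rw [← ENNReal.tsum_add]
  refine ENNReal.tsum_le_tsum fun x => ?_
  rw [← ENNReal.ofReal_add (mul_nonneg (hα x) (abs_nonneg _)) (mul_nonneg (hα x) (abs_nonneg _)),
    ← mul_add]
  exact ENNReal.ofReal_le_ofReal (mul_le_mul_of_nonneg_left (abs_sub_le _ _ _) (hα x))

/-- The number of particles. -/
noncomputable def mass (z : V → ℕ) : ℝ≥0∞ := ∑' x, (z x : ℝ≥0∞)

/-- Through this identity the growth of the number of particles is a special case of the distance
estimates. -/
lemma edistα_one_zero (z : V → ℕ) : edistα (fun _ => 1) z 0 = mass z := by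
  unfold edistα mass
  refine tsum_congr fun x => ?_
  simp

lemma le_mass (z : V → ℕ) (x : V) : (z x : ℝ≥0∞) ≤ mass z :=
  ENNReal.le_tsum (f := fun x => (z x : ℝ≥0∞)) x

lemma edistα_ne_top {α : V → ℝ} {z z' : V → ℕ} (hz : z ∈ E0 V) (hz' : z' ∈ E0 V) :
    edistα α z z' ≠ ∞ := by
  unfold edistα
  have hf := (mem_E0_iff.1 hz).union (mem_E0_iff.1 hz')
  rw [tsum_eq_sum (s := hf.toFinset)]
  · exact ENNReal.sum_ne_top.2 fun _ _ => ENNReal.ofReal_ne_top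
  · intro x hx
    simp only [Set.Finite.mem_toFinset, Set.mem_union, Function.mem_support, not_or, not_not] at hx
    simp [hx.1, hx.2]

lemma zero_mem_E0 : (0 : V → ℕ) ∈ E0 V := by
  rw [mem_E0_iff]; simp

lemma mass_ne_top {z : V → ℕ} (hz : z ∈ E0 V) : mass z ≠ ∞ := by
  rw [← edistα_one_zero]; exact edistα_ne_top hz zero_mem_E0

/-- Only the term at `x` changes. The additive form avoids the truncated subtraction of `[0,∞]` and
holds for infinite distances as well. -/
lemma edistα_update [DecidableEq V] (α : V → ℝ) (z z' : V → ℕ) (x : V) (k : ℕ) :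
    edistα α (Function.update z x k) z' + ENNReal.ofReal (α x * |(z x : ℝ) - z' x|) =
      edistα α z z' + ENNReal.ofReal (α x * |(k : ℝ) - z' x|) := by
  unfold edistα
  have key : ∀ f : V → ℝ≥0∞, ∑' y, f y = f x + ∑' y, if y = x then 0 else f y := fun f =>
    (ENNReal.tsum_eq_add_tsum_ite x).trans (by congr!)
  rw [key, key fun y => ENNReal.ofReal (α y * |(z y : ℝ) - z' y|)]
  have : ∀ y, (if y = x then 0 else
      ENNReal.ofReal (α y * |((Function.update z x k y : ℕ) : ℝ) - z' y|)) =
      if y = x then 0 else ENNReal.ofReal (α y * |(z y : ℝ) - z' y|) := fun y => by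
    split_ifs with h
    · rfl
    · rw [Function.update_of_ne h]
  simp only [this, Function.update_self]
  ring

lemma add_single_eq_update [DecidableEq V] (z : V → ℕ) (x : V) :
    z + Pi.single x 1 = Function.update z x (z x + 1) := by
  ext y
  by_cases h : y = x
  · subst h; simp
  · simp [h]

lemma sub_single_eq_update [DecidableEq V] (z : V → ℕ) (x : V) :
    z - Pi.single x 1 = Function.update z x (z x - 1) := by
  ext y
  by_cases h : y = x
  · subst h; simp
  · simp [h]

lemma edistα_add_single [DecidableEq V] (α : V → ℝ) (z : V → ℕ) (x : V) :
    edistα α (z + Pi.single x 1) z ≤ ENNReal.ofReal (α x) := by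
  have h := edistα_update α z z x (z x + 1)
  rw [edistα_self] at h
  rw [add_single_eq_update]
  simpa using h.le

lemma edistα_sub_single [DecidableEq V] {α : V → ℝ} (hα : ∀ x, 0 ≤ α x) (z : V → ℕ) (x : V) :
    edistα α (z - Pi.single x 1) z ≤ ENNReal.ofReal (α x) := by
  have h := edistα_update α z z x (z x - 1)
  rw [edistα_self] at h
  rw [sub_single_eq_update]
  simp only [sub_self, abs_zero, mul_zero, ENNReal.ofReal_zero, add_zero, zero_add] at h
  rw [h]
  refine ENNReal.ofReal_le_ofReal (mul_le_of_le_one_right (hα x) ?_)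
  rcases Nat.eq_zero_or_pos (z x) with h0 | h0
  · simp [h0]
  · rw [Nat.cast_sub h0]; simp

lemma edistα_transition_le {α : V → ℝ} {M : ℝ≥0} (hα : ∀ x, 0 ≤ α x) (hM : ∀ x, α x ≤ M)
    (m : Mark V) (z : V → ℕ) : edistα α (transition m z) z ≤ 2 * M := by
  classical
  have h1 : ∀ x, ENNReal.ofReal (α x) ≤ M := fun x => by
    rw [← ENNReal.ofReal_coe_nnreal]; exact ENNReal.ofReal_le_ofReal (hM x)
  have h2 : (M : ℝ≥0∞) ≤ 2 * M := by rw [two_mul]; exact le_self_add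
  cases m with
  | birth x => exact (edistα_add_single α z x).trans ((h1 x).trans h2)
  | death x => exact (edistα_sub_single hα z x).trans ((h1 x).trans h2)
  | jump x y =>
    refine (edistα_triangle hα _ (z - Pi.single x 1) _).trans ?_
    rw [two_mul]
    exact add_le_add ((edistα_add_single α _ y).trans (h1 y)) ((edistα_sub_single hα z x).trans (h1 x))

lemma mass_transition_le (m : Mark V) (z : V → ℕ) : mass (transition m z) ≤ mass z + 1 := by
  classical
  have h1 : ∀ (z : V → ℕ) (x : V), mass (z + Pi.single x 1) ≤ mass z + 1 := by
    intro z x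
    rw [← edistα_one_zero, ← edistα_one_zero]
    refine (edistα_triangle (fun _ => zero_le_one) _ z _).trans ?_
    rw [add_comm]
    gcongr
    exact (edistα_add_single (fun _ => 1) z x).trans ENNReal.ofReal_one.le
  have h2 : ∀ (z : V → ℕ) (x : V), mass (z - Pi.single x 1) ≤ mass z := fun z x =>
    ENNReal.tsum_le_tsum fun y => by
      simp only [Pi.sub_apply]
      exact_mod_cast Nat.sub_le _ _
  cases m with
  | birth x => exact h1 z x
  | death x => exact (h2 z x).trans le_self_add
  | jump x y => exact (h1 _ y).trans (by gcongr; exact h2 z x)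

/-- The sum of the rates of all marks. -/
noncomputable def totalRate (R : Mark V → (V → ℕ) → ℝ) (z : V → ℕ) : ℝ≥0∞ :=
  ∑' m, ENNReal.ofReal (R m z)

variable {p : V → V → ℝ} {Fp Fm : ℕ → ℝ}

lemma tsum_ofReal_kernel (hp : IsTransitionKernel p) (x : V) :
    ∑' y, ENNReal.ofReal (p x y) = 1 := by
  rw [← ENNReal.ofReal_tsum_of_nonneg (fun y => (hp.mem_unit x y).1) (hp.row_sum x).summable,
    (hp.row_sum x).tsum_eq, ENNReal.ofReal_one]

/-- The total rate is bounded in terms of the number of particles. -/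
lemma exists_totalRate_le (hp : IsTransitionKernel p) (hF : IsReactionPair Fp Fm) (K : ℕ) :
    ∃ L : ℝ≥0, ∀ z : V → ℕ, mass z ≤ K → totalRate (rate p Fp Fm) z ≤ L := by
  -- Because `F⁻(0) = 0`, this constant gives the linear bound `F⁻(k) ≤ b k` for `k ≤ K`. Empty
  -- sites therefore contribute nothing, and the sum over the sites is at most `b` times the number
  -- of particles.
  let b : ℝ≥0 := ∑ k ∈ Finset.range (K + 1), (Fm k).toNNReal
  have hb : ∀ k ≤ K, ENNReal.ofReal (Fm k) ≤ b * k := by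
    intro k hk
    rcases Nat.eq_zero_or_pos k with rfl | hk0
    · simp [hF.death_zero]
    · have h1 : (Fm k).toNNReal ≤ b :=
        Finset.single_le_sum (f := fun k => (Fm k).toNNReal) (fun _ _ => zero_le)
          (Finset.mem_range.2 (Nat.lt_succ_of_le hk))
      calc ENNReal.ofReal (Fm k) ≤ b := ENNReal.coe_le_coe.2 h1
        _ = b * (1 : ℕ) := by simp
        _ ≤ b * k := by gcongr; exact hk0
  refine ⟨(b + b + 1) * K, fun z hz => ?_⟩
  have hzx : ∀ x, z x ≤ K := fun x => by exact_mod_cast (le_mass z x).trans hz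
  have hd : ∑' x, ENNReal.ofReal (Fm (z x)) ≤ b * K := by
    calc ∑' x, ENNReal.ofReal (Fm (z x)) ≤ ∑' x, (b : ℝ≥0∞) * (z x : ℝ≥0∞) :=
          ENNReal.tsum_le_tsum fun x => hb _ (hzx x)
      _ = b * mass z := by rw [ENNReal.tsum_mul_left]; rfl
      _ ≤ b * K := by gcongr
  have hbirth : ∑' x, ENNReal.ofReal (Fp (z x)) ≤ b * K :=
    (ENNReal.tsum_le_tsum fun x => ENNReal.ofReal_le_ofReal (hF.birth_le_death _)).trans hd
  have hj : ∑' x, ∑' y, ENNReal.ofReal (p x y * (z x : ℝ)) ≤ K := by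
    calc ∑' x, ∑' y, ENNReal.ofReal (p x y * (z x : ℝ))
        = ∑' x, (z x : ℝ≥0∞) := tsum_congr fun x => by
          simp only [ENNReal.ofReal_mul (hp.mem_unit x _).1]
          rw [ENNReal.tsum_mul_right, tsum_ofReal_kernel hp, one_mul, ENNReal.ofReal_natCast]
      _ ≤ K := hz
  unfold totalRate
  rw [tsum_mark]
  push_cast
  calc _ ≤ (b : ℝ≥0∞) * K + b * K + K := add_le_add (add_le_add hbirth hd) hj
    _ = _ := by ring

end Configurations

/-! ### Measurability of the cell events and the probability of a bad cell -/

section CellEvents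

variable {V Ω : Type*} {R : Mark V → (V → ℕ) → ℝ} {X : Mark V → Ω → Set (ℝ × ℝ)}

/-- The region of the clocks in the time interval `(a,b]`. -/
def strip (a b : ℝ) : Set (ℝ × ℝ) := Set.Ioc a b ×ˢ Set.univ

lemma box_subset_strip (a b c : ℝ) : box a b c ⊆ strip a b := Set.prod_mono le_rfl (Set.subset_univ _)

lemma strip_mono {a b a' b' : ℝ} (h : a' ≤ a) (h' : b ≤ b') : strip a b ⊆ strip a' b' :=
  Set.prod_mono (Set.Ioc_subset_Ioc h h') le_rfl

lemma disjoint_strip {a b c : ℝ} : Disjoint (strip a b) (strip b c) :=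
  Set.disjoint_left.2 fun _ h h' => absurd h.1.2 h'.1.1.not_ge

lemma measurableSet_cellMap_eq [Countable V] (a b : ℝ) (z w : V → ℕ) :
    MeasurableSet[regionSigma X (strip a b)] {ω | cellMap R (fun m => X m ω) a b z = w} := by
  have hm : ∀ m, MeasurableSet[regionSigma X (strip a b)]
      {ω | hitMarks R (fun m => X m ω) a b z = {m}} := by
    intro m
    have : {ω | hitMarks R (fun m => X m ω) a b z = {m}} = ⋂ m', {ω | m' ∈ hitMarks R (fun m => X m ω) a b z ↔ m' = m} := by
      ext ω
      simp only [Set.mem_ofPred_eq, Set.mem_iInter]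
      exact Set.ext_iff
    rw [this]
    refine MeasurableSet.iInter fun m' => ?_
    have h1 : MeasurableSet[regionSigma X (strip a b)] {ω | m' ∈ hitMarks R (fun m => X m ω) a b z} :=
      measurableSet_hits m' (measurableSet_box _ _ _) (box_subset_strip _ _ _)
    by_cases hmm : m' = m
    · simp only [hmm, iff_true]
      exact hmm ▸ h1
    · simp only [hmm, iff_false]
      exact h1.compl
  have h2 : {ω | cellMap R (fun m => X m ω) a b z = w} =
      (⋃ m, {ω | hitMarks R (fun m => X m ω) a b z = {m}} ∩ {_ω | transition m z = w}) ∪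
      ((⋂ m, {ω | hitMarks R (fun m => X m ω) a b z = {m}}ᶜ) ∩ {_ω | z = w}) := by
    ext ω
    simp only [Set.mem_union, Set.mem_iUnion, Set.mem_inter_iff, Set.mem_ofPred_eq, Set.mem_iInter,
      Set.mem_compl_iff]
    by_cases h : ∃ m, hitMarks R (fun m => X m ω) a b z = {m}
    · obtain ⟨m, hm⟩ := h
      rw [cellMap_of_eq_singleton hm]
      constructor
      · intro h; exact .inl ⟨m, hm, h⟩
      · rintro (⟨m', h1, h2⟩ | ⟨h1, -⟩)
        · rwa [Set.singleton_injective (hm.symm.trans h1)]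
        · exact absurd hm (h1 m)
    · rw [cellMap_of_ne_singleton fun m hm => h ⟨m, hm⟩]
      constructor
      · intro h'; exact .inr ⟨fun m hm => h ⟨m, hm⟩, h'⟩
      · rintro (⟨m', h1, h2⟩ | ⟨-, h1⟩)
        · exact absurd ⟨m', h1⟩ h
        · exact h1
  rw [h2]
  exact (MeasurableSet.iUnion fun m => (hm m).inter (MeasurableSet.const _)).union
    ((MeasurableSet.iInter fun m => (hm m).compl).inter (MeasurableSet.const _))

lemma setOf_bad_eq (a b : ℝ) (z z' : V → ℕ) :
    {ω | Bad R (fun m => X m ω) a b z z'} = ⋃ m₀, hits X m₀ (box a b (R m₀ z + R m₀ z')) ∩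
      ({ω | (X m₀ ω ∩ box a b (cap R z z' m₀ m₀)).Nontrivial} ∪
        ⋃ m, ⋃ _ : m ≠ m₀, hits X m (box a b (cap R z z' m₀ m))) := by
  ext ω
  simp [Bad, hits]

lemma measurableSet_bad [Countable V] (a b : ℝ) (z z' : V → ℕ) :
    MeasurableSet[regionSigma X (strip a b)] {ω | Bad R (fun m => X m ω) a b z z'} := by
  rw [setOf_bad_eq]
  have h1 : ∀ m c, MeasurableSet[regionSigma X (strip a b)] (hits X m (box a b c)) := fun m c =>
    measurableSet_hits m (measurableSet_box _ _ _) (box_subset_strip _ _ _)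
  exact MeasurableSet.iUnion fun m₀ => (h1 _ _).inter
    ((measurableSet_nontrivial m₀ (measurableSet_box _ _ _) (box_subset_strip _ _ _)).union
      (MeasurableSet.iUnion fun m => MeasurableSet.iUnion fun _ => h1 _ _))

variable [MeasurableSpace Ω] {P : Measure Ω} [IsProbabilityMeasure P]

/-- A bad cell contains two points, one below the rates and another below the caps. Each costs a
factor of the cell length by independence; the sum over the first mark gives the total rates and the
sum over the second gives `L`. The constant is `3`: two terms for the same clock and one for
different clocks. -/
lemma measure_bad_le [Countable V] (hX : IsPoissonClocks X P) (hR : ∀ m z, 0 ≤ R m z) {a b : ℝ}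
    (ha : 0 ≤ a) (hab : a ≤ b) {z z' : V → ℕ} {L : ℝ≥0∞}
    (hL : ∀ m₀, ∑' m, ENNReal.ofReal (cap R z z' m₀ m) ≤ L) :
    P {ω | Bad R (fun m => X m ω) a b z z'} ≤
      3 * (totalRate R z + totalRate R z') * L * ENNReal.ofReal (b - a) ^ 2 := by
  set h := ENNReal.ofReal (b - a) with hh
  have hba : 0 ≤ b - a := sub_nonneg.2 hab
  have hcap : ∀ m₀ m, R m z + R m z' ≤ cap R z z' m₀ m := fun m₀ m =>
    le_add_of_nonneg_right (add_nonneg (hR _ _) (hR _ _))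
  have hsum : ∀ m, 0 ≤ R m z + R m z' := fun m => add_nonneg (hR _ _) (hR _ _)
  have hhit : ∀ m {c}, 0 ≤ c → P (hits X m (box a b c)) ≤ h * ENNReal.ofReal c := fun m c hc => by
    rw [hh, ← ENNReal.ofReal_mul hba]; exact measure_hits_le hX m ha hab hc
  have h1 : ∀ m₀, P (hits X m₀ (box a b (R m₀ z + R m₀ z')) ∩
      ({ω | (X m₀ ω ∩ box a b (cap R z z' m₀ m₀)).Nontrivial} ∪
        ⋃ m, ⋃ _ : m ≠ m₀, hits X m (box a b (cap R z z' m₀ m)))) ≤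
      ENNReal.ofReal (R m₀ z + R m₀ z') * (3 * L * h ^ 2) := by
    intro m₀
    set c := R m₀ z + R m₀ z'
    have hc : 0 ≤ c := hsum m₀
    set d := cap R z z' m₀ m₀
    have hcd : c ≤ d := hcap m₀ m₀
    have hdL : ENNReal.ofReal d ≤ L :=
      (ENNReal.le_tsum (f := fun m => ENNReal.ofReal (cap R z z' m₀ m)) m₀).trans (hL m₀)
    rw [Set.inter_union_distrib_left, Set.inter_iUnion₂]
    -- If two points of one clock lie below the cap and one of them below the rates, then the other
    -- lies either below the rates too or in the disjoint layer between the two levels.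
    have hN : P (hits X m₀ (box a b c) ∩ {ω | (X m₀ ω ∩ box a b d).Nontrivial}) ≤
        h * ENNReal.ofReal c * (h * L) + h * ENNReal.ofReal c * (h * L) := by
      have hsub : hits X m₀ (box a b c) ∩ {ω | (X m₀ ω ∩ box a b d).Nontrivial} ⊆
          {ω | (X m₀ ω ∩ box a b c).Nontrivial} ∪
            (hits X m₀ (box a b c) ∩ hits X m₀ (box a b d \ box a b c)) := by
        rintro ω ⟨h1, h2⟩
        by_cases h3 : (X m₀ ω ∩ box a b c).Nontrivial
        · exact .inl h3
        · refine .inr ⟨h1, ?_⟩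
          by_contra h4
          refine h3 (Set.Nontrivial.mono h2 ?_)
          rintro q ⟨hq, hqd⟩
          refine ⟨hq, ?_⟩
          by_contra hqc
          exact h4 ⟨q, hq, hqd, hqc⟩
      refine (measure_mono hsub).trans ((measure_union_le _ _).trans (add_le_add ?_ ?_))
      · refine (measure_nontrivial_le hX m₀ ha hab hc).trans ?_
        rw [ENNReal.ofReal_mul hba]
        gcongr
        exact (ENNReal.ofReal_le_ofReal hcd).trans hdL
      · rw [measure_hits_inter_disjoint hX m₀ (measurableSet_box _ _ _)
          ((measurableSet_box _ _ _).diff (measurableSet_box _ _ _)) Set.disjoint_sdiff_right]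
        refine mul_le_mul' (hhit m₀ hc) ?_
        refine le_trans (measure_mono ?_) ((hhit m₀ (hc.trans hcd)).trans (by gcongr))
        rintro ω ⟨q, hq, hqd, -⟩
        exact ⟨q, hq, hqd⟩
    have hO : P (⋃ m, ⋃ _ : m ≠ m₀, hits X m₀ (box a b c) ∩ hits X m (box a b (cap R z z' m₀ m))) ≤
        h * ENNReal.ofReal c * (h * L) := by
      refine (measure_iUnion_le _).trans ?_
      calc _ ≤ ∑' m, h * ENNReal.ofReal c * (h * ENNReal.ofReal (cap R z z' m₀ m)) := by
            refine ENNReal.tsum_le_tsum fun m => ?_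
            by_cases hm : m = m₀
            · simp [hm]
            · simp only [ne_eq, hm, not_false_eq_true, Set.iUnion_true]
              rw [measure_hits_inter hX (Ne.symm hm) (measurableSet_box _ _ _)
                (measurableSet_box _ _ _)]
              exact mul_le_mul' (hhit m₀ hc) (hhit m ((hsum m).trans (hcap m₀ m)))
        _ ≤ _ := by
            rw [ENNReal.tsum_mul_left, ENNReal.tsum_mul_left]
            gcongr
            exact hL m₀
    refine (measure_union_le _ _).trans ((add_le_add hN hO).trans (le_of_eq ?_))
    ring
  rw [setOf_bad_eq]
  refine (measure_iUnion_le _).trans ((ENNReal.tsum_le_tsum h1).trans (le_of_eq ?_))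
  rw [ENNReal.tsum_mul_right]
  simp only [ENNReal.ofReal_add (hR _ _) (hR _ _)]
  rw [ENNReal.tsum_add]
  unfold totalRate
  ring

end CellEvents

/-! ### The generator of the coupling applied to the distance -/

section Drift

variable {V : Type*} {p : V → V → ℝ} {Fp Fm : ℕ → ℝ} {α : V → ℝ}

/-- A bound for the change of the weighted distance of `z` and `z'` when only one of them undergoes
the transition `m`. -/
noncomputable def drift (α : V → ℝ) (Fp Fm : ℕ → ℝ) (m : Mark V) (z z' : V → ℕ) : ℝ :=
  open Classical in
  match m with
  | .birth x => if (z' x < z x ↔ Fp (z' x) < Fp (z x)) then α x else -α x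
  | .death x => if (z' x < z x ↔ Fm (z' x) < Fm (z x)) then -α x else α x
  | .jump _ y => α y

/-- Distinct rates mean distinct occupation numbers, so for births and deaths exchanging the
configurations negates both sides of the equivalence that decides the sign. -/
lemma drift_comm {m : Mark V} {z z' : V → ℕ} (h : rate p Fp Fm m z' < rate p Fp Fm m z) :
    drift α Fp Fm m z z' = drift α Fp Fm m z' z := by
  have key : ∀ (F : ℕ → ℝ) (x : V), F (z' x) < F (z x) →
      ((z' x < z x ↔ F (z' x) < F (z x)) ↔ (z x < z' x ↔ F (z x) < F (z' x))) := by
    intro F x hlt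
    have hne : z' x ≠ z x := fun he => by simp [he] at hlt
    have h2 : ¬ F (z x) < F (z' x) := hlt.not_gt
    simp only [hlt, h2, iff_true, iff_false, not_lt]
    exact ⟨fun h => h.le, fun h => lt_of_le_of_ne h hne⟩
  cases m with
  | birth x => simp only [drift, key Fp x h]
  | death x => simp only [drift, key Fm x h]
  | jump x y => rfl

lemma abs_drift_le {M : ℝ≥0} (hα : ∀ x, 0 ≤ α x) (hM : ∀ x, α x ≤ M) (m : Mark V)
    (z z' : V → ℕ) : ENNReal.ofReal (drift α Fp Fm m z z') ≤ M ∧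
      ENNReal.ofReal (-drift α Fp Fm m z z') ≤ M := by
  have key : ∀ r : ℝ, |r| ≤ M → ENNReal.ofReal r ≤ M ∧ ENNReal.ofReal (-r) ≤ M := by
    intro r hr
    obtain ⟨h1, h2⟩ := abs_le.1 hr
    rw [← ENNReal.ofReal_coe_nnreal (p := M)]
    exact ⟨ENNReal.ofReal_le_ofReal h2, ENNReal.ofReal_le_ofReal (by linarith)⟩
  have h1 : ∀ x, |α x| ≤ M := fun x => by rw [abs_of_nonneg (hα x)]; exact hM x
  cases m with
  | birth x =>
    apply key; simp only [drift]
    split_ifs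
    · exact h1 x
    · rw [abs_neg]; exact h1 x
  | death x =>
    apply key; simp only [drift]
    split_ifs
    · rw [abs_neg]; exact h1 x
    · exact h1 x
  | jump x y => exact key _ (h1 y)

/-- Moving one site away from a second configuration. -/
lemma edistα_update_of_abs_eq_add [DecidableEq V] (hα : ∀ x, 0 ≤ α x) {z z' : V → ℕ} {x : V} {k : ℕ}
    (h : |(k : ℝ) - z' x| = |(z x : ℝ) - z' x| + 1) :
    edistα α (Function.update z x k) z' = edistα α z z' + ENNReal.ofReal (α x) := by
  have h1 := edistα_update α z z' x k
  rw [h, mul_add, mul_one, ENNReal.ofReal_add (mul_nonneg (hα x) (abs_nonneg _)) (hα x),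
    add_comm (ENNReal.ofReal (α x * _)), ← add_assoc] at h1
  exact (ENNReal.add_left_inj ENNReal.ofReal_ne_top).1 h1

/-- Moving one site towards a second configuration. -/
lemma edistα_update_of_abs_add_eq [DecidableEq V] (hα : ∀ x, 0 ≤ α x) {z z' : V → ℕ} {x : V} {k : ℕ}
    (h : |(k : ℝ) - z' x| + 1 = |(z x : ℝ) - z' x|) :
    edistα α (Function.update z x k) z' + ENNReal.ofReal (α x) = edistα α z z' := by
  have h1 := edistα_update α z z' x k
  rw [← h, mul_add, mul_one, ENNReal.ofReal_add (mul_nonneg (hα x) (abs_nonneg _)) (hα x),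
    add_comm (ENNReal.ofReal (α x * _)), ← add_assoc] at h1
  exact (ENNReal.add_left_inj ENNReal.ofReal_ne_top).1 h1

/-- The configuration with the larger rate moves alone. A birth or a death moves one site by one
particle, away from the other configuration or towards it as the sign of `drift` says. Positive and
negative parts stand on different sides to avoid truncated subtraction. -/
lemma edistα_transition_of_rate_lt (hp : IsTransitionKernel p) (hF : IsReactionPair Fp Fm)
    (hα : ∀ x, 0 ≤ α x) {m : Mark V} {z z' : V → ℕ}
    (h : rate p Fp Fm m z' < rate p Fp Fm m z) :
    edistα α (transition m z) z' + ENNReal.ofReal (-drift α Fp Fm m z z') ≤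
      edistα α z z' + ENNReal.ofReal (drift α Fp Fm m z z') := by
  classical
  have hpos : 0 < rate p Fp Fm m z := (rate_nonneg hp hF m z').trans_lt h
  cases m with
  | birth x =>
    have h' : Fp (z' x) < Fp (z x) := h
    have hne : z' x ≠ z x := fun he => by simp [he] at h'
    simp only [drift, h', iff_true, transition]
    rw [add_single_eq_update]
    split_ifs with hlt
    · have hc : (z' x : ℝ) + 1 ≤ z x := by exact_mod_cast hlt
      rw [edistα_update_of_abs_eq_add hα, ENNReal.ofReal_of_nonpos (p := -α x) (by linarith [hα x]),
        add_zero]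
      push_cast
      rw [abs_of_nonneg (by linarith), abs_of_nonneg (by linarith)]
      ring
    · have hc : (z x : ℝ) + 1 ≤ z' x := by exact_mod_cast lt_of_le_of_ne (not_lt.1 hlt) hne.symm
      rw [neg_neg, edistα_update_of_abs_add_eq hα]
      · exact le_self_add
      · push_cast
        rw [abs_of_nonpos (by linarith), abs_of_nonpos (by linarith)]
        ring
  | death x =>
    have h' : Fm (z' x) < Fm (z x) := h
    have hne : z' x ≠ z x := fun he => by simp [he] at h'
    have h0 : 1 ≤ z x := Nat.one_le_iff_ne_zero.2 fun he => by
      simp [rate, he, hF.death_zero] at hpos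
    simp only [drift, h', iff_true, transition]
    rw [sub_single_eq_update]
    split_ifs with hlt
    · have hc : (z' x : ℝ) + 1 ≤ z x := by exact_mod_cast hlt
      rw [neg_neg, edistα_update_of_abs_add_eq hα]
      · exact le_self_add
      · rw [Nat.cast_sub h0, Nat.cast_one]
        rw [abs_of_nonneg (by linarith), abs_of_nonneg (by linarith)]
        ring
    · have hc : (z x : ℝ) + 1 ≤ z' x := by exact_mod_cast lt_of_le_of_ne (not_lt.1 hlt) hne.symm
      rw [edistα_update_of_abs_eq_add hα, ENNReal.ofReal_of_nonpos (p := -α x) (by linarith [hα x]),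
        add_zero]
      rw [Nat.cast_sub h0, Nat.cast_one]
      rw [abs_of_nonpos (by linarith), abs_of_nonpos (by linarith)]
      ring
  | jump x y =>
    have h' : p x y * (z' x : ℝ) < p x y * (z x : ℝ) := h
    have hlt : z' x < z x := by exact_mod_cast lt_of_mul_lt_mul_left h' (hp.mem_unit x y).1
    have hc : (z' x : ℝ) + 1 ≤ z x := by exact_mod_cast hlt
    have h0 : 1 ≤ z x := by omega
    simp only [drift, transition]
    rw [ENNReal.ofReal_of_nonpos (p := -α y) (by linarith [hα y]), add_zero]
    refine (edistα_triangle hα _ (z - Pi.single x 1) _).trans ?_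
    rw [add_comm]
    refine add_le_add ?_ (edistα_add_single α _ y)
    -- The larger jump rate belongs to the larger occupation number, so the departure from `x`
    -- lowers the distance by `α x`. This gain is discarded; only the arrival at `y` is charged.
    have h2 := edistα_update_of_abs_add_eq hα (z := z) (z' := z') (x := x) (k := z x - 1) (by
      rw [Nat.cast_sub h0, Nat.cast_one]
      rw [abs_of_nonneg (by linarith), abs_of_nonneg (by linarith)]
      ring)
    rw [sub_single_eq_update, ← h2]
    exact le_self_add

/-- Positive death and jump rates require an occupied site, so the subtraction is genuine and both
configurations are translated by the same vector. -/
lemma edistα_transition_transition (hF : IsReactionPair Fp Fm)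
    {m : Mark V} {z z' : V → ℕ} (h : 0 < rate p Fp Fm m z) (h' : 0 < rate p Fp Fm m z') :
    edistα α (transition m z) (transition m z') = edistα α z z' := by
  classical
  unfold edistα
  refine tsum_congr fun y => ?_
  have key : ∀ x, 1 ≤ z x → 1 ≤ z' x →
      (((z - Pi.single x 1 : V → ℕ) y : ℕ) : ℝ) - ((z' - Pi.single x 1 : V → ℕ) y : ℕ) =
        (z y : ℝ) - z' y := by
    intro x h1 h2
    by_cases hy : y = x
    · subst hy; simp [Nat.cast_sub h1, Nat.cast_sub h2]
    · simp [hy]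
  cases m with
  | birth x => simp [transition]
  | death x =>
    have h1 : 1 ≤ z x := Nat.one_le_iff_ne_zero.2 fun he => by simp [rate, he, hF.death_zero] at h
    have h2 : 1 ≤ z' x := Nat.one_le_iff_ne_zero.2 fun he => by
      simp [rate, he, hF.death_zero] at h'
    simp only [transition]
    rw [key x h1 h2]
  | jump x w =>
    have h1 : 1 ≤ z x := Nat.one_le_iff_ne_zero.2 fun he => by simp [rate, he] at h
    have h2 : 1 ≤ z' x := Nat.one_le_iff_ne_zero.2 fun he => by simp [rate, he] at h'
    simp only [transition, Pi.add_apply _ (Pi.single w 1), Nat.cast_add]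
    rw [add_sub_add_right_eq_sub, key x h1 h2]

/-- The generator of the coupled process, applied to the distance. -/
lemma tsum_drift_le (hp : IsTransitionKernel p) (hF : IsReactionPair Fp Fm) (hα : ∀ x, 0 ≤ α x)
    {C : ℝ} (hker : ∀ x, ∑' y, ENNReal.ofReal (p x y) * ENNReal.ofReal (α y) ≤
      ENNReal.ofReal C * ENNReal.ofReal (α x)) (z z' : V → ℕ) :
    ∑' m, ENNReal.ofReal (drift α Fp Fm m z z') *
        ENNReal.ofReal |rate p Fp Fm m z - rate p Fp Fm m z'| ≤
      ∑' m, ENNReal.ofReal (-drift α Fp Fm m z z') *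
        ENNReal.ofReal |rate p Fp Fm m z - rate p Fp Fm m z'| +
      ENNReal.ofReal C * edistα α z z' := by
  -- Here `b` and `d` are the increments of `F⁺` and `F⁻` from the smaller to the larger occupation
  -- number, and `b ≤ d` because `F⁺ - F⁻` is decreasing. The signed contributions are `a * b` for
  -- births and `-(a * d)` for deaths; their sum is at most `0`, written with positive and negative
  -- parts.
  have aux : ∀ {a δb δd b d : ℝ}, 0 ≤ a → b ≤ d → δb * |b| = a * b → δd * |d| = -(a * d) →
      ENNReal.ofReal δb * ENNReal.ofReal |b| + ENNReal.ofReal δd * ENNReal.ofReal |d| ≤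
        ENNReal.ofReal (-δb) * ENNReal.ofReal |b| + ENNReal.ofReal (-δd) * ENNReal.ofReal |d| := by
    intro a δb δd b d ha hbd hb hd
    simp only [← ENNReal.ofReal_mul' (abs_nonneg _), neg_mul]
    rw [hb, hd, neg_neg, add_comm]
    have := mul_le_mul_of_nonneg_left hbd ha
    exact add_le_add (ENNReal.ofReal_le_ofReal (by linarith)) (ENNReal.ofReal_le_ofReal this)
  have hbd : ∀ x, ENNReal.ofReal (drift α Fp Fm (.birth x) z z') *
        ENNReal.ofReal |Fp (z x) - Fp (z' x)| + ENNReal.ofReal (drift α Fp Fm (.death x) z z') *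
        ENNReal.ofReal |Fm (z x) - Fm (z' x)| ≤
      ENNReal.ofReal (-drift α Fp Fm (.birth x) z z') *
        ENNReal.ofReal |Fp (z x) - Fp (z' x)| + ENNReal.ofReal (-drift α Fp Fm (.death x) z z') *
        ENNReal.ofReal |Fm (z x) - Fm (z' x)| := by
    intro x
    rcases lt_trichotomy (z' x) (z x) with hlt | heq | hlt
    · have hanti := hF.antitone_sub hlt.le
      simp only at hanti
      refine aux (hα x) (by linarith) ?_ ?_
      · simp only [drift, hlt, true_iff]
        split_ifs with hc
        · rw [abs_of_pos (by linarith)]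
        · rw [abs_of_nonpos (by linarith)]; ring
      · simp only [drift, hlt, true_iff]
        split_ifs with hc
        · rw [abs_of_pos (by linarith)]; ring
        · rw [abs_of_nonpos (by linarith)]; ring
    · simp [heq]
    · have hanti := hF.antitone_sub hlt.le
      simp only at hanti
      rw [abs_sub_comm (Fp _), abs_sub_comm (Fm _)]
      refine aux (hα x) (by linarith) ?_ ?_
      · simp only [drift, hlt.not_gt, false_iff, not_lt]
        split_ifs with hc
        · rw [abs_of_nonneg (by linarith)]
        · rw [abs_of_nonpos (by linarith)]; ring
      · simp only [drift, hlt.not_gt, false_iff, not_lt]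
        split_ifs with hc
        · rw [abs_of_nonneg (by linarith)]; ring
        · rw [abs_of_nonpos (by linarith)]; ring
  -- A discrepancy at `x` is carried to `y` with weight `p x y`, so the sum over `y` is bounded by
  -- the kernel inequality at `x`.
  have hj : ∑' x, ∑' y, ENNReal.ofReal (drift α Fp Fm (.jump x y) z z') *
      ENNReal.ofReal |p x y * (z x : ℝ) - p x y * (z' x : ℝ)| ≤ ENNReal.ofReal C * edistα α z z' := by
    unfold edistα
    rw [← ENNReal.tsum_mul_left]
    refine ENNReal.tsum_le_tsum fun x => ?_
    calc _ = (∑' y, ENNReal.ofReal (p x y) * ENNReal.ofReal (α y)) *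
          ENNReal.ofReal |(z x : ℝ) - z' x| := by
          rw [← ENNReal.tsum_mul_right]
          refine tsum_congr fun y => ?_
          rw [← mul_sub, abs_mul, abs_of_nonneg (hp.mem_unit x y).1,
            ENNReal.ofReal_mul (hp.mem_unit x y).1]
          simp only [drift]
          ring
      _ ≤ ENNReal.ofReal C * ENNReal.ofReal (α x) * ENNReal.ofReal |(z x : ℝ) - z' x| := by
          gcongr
          exact hker x
      _ = _ := by rw [ENNReal.ofReal_mul (hα x), mul_assoc]
  rw [tsum_mark, tsum_mark, add_assoc (_ + _)]
  refine add_le_add ?_ (hj.trans le_add_self)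
  rw [← ENNReal.tsum_add, ← ENNReal.tsum_add]
  exact ENNReal.tsum_le_tsum hbd

end Drift

/-! ### The expected distance after one cell -/

section OneStep

variable {V Ω : Type*} {p : V → V → ℝ} {Fp Fm : ℕ → ℝ} {α : V → ℝ}
  {X : Mark V → Ω → Set (ℝ × ℝ)}

/-- The event that the clock of `m` rings in `(a,b]` below exactly one of the rates of `z` and
`z'`. -/
def soleHits (R : Mark V → (V → ℕ) → ℝ) (X : Mark V → Ω → Set (ℝ × ℝ)) (a b : ℝ) (z z' : V → ℕ)
    (m : Mark V) : Set Ω :=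
  symmDiff (hits X m (box a b (R m z))) (hits X m (box a b (R m z')))

lemma edistα_cellMap_le {M : ℝ≥0} (hα : ∀ x, 0 ≤ α x) (hM : ∀ x, α x ≤ M)
    {R : Mark V → (V → ℕ) → ℝ} {X : Mark V → Set (ℝ × ℝ)} (a b : ℝ) (z z' : V → ℕ) :
    edistα α (cellMap R X a b z) (cellMap R X a b z') ≤ edistα α z z' + 4 * M := by
  have h1 : ∀ z, edistα α (cellMap R X a b z) z ≤ 2 * M := by
    intro z
    by_cases h : ∃ m, hitMarks R X a b z = {m}
    · obtain ⟨m, hm⟩ := h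
      rw [cellMap_of_eq_singleton hm]
      exact edistα_transition_le hα hM m z
    · rw [cellMap_of_ne_singleton fun m hm => h ⟨m, hm⟩, edistα_self]
      exact zero_le
  refine (edistα_triangle hα _ z _).trans ?_
  refine (add_le_add (h1 z) (edistα_triangle hα _ z' _)).trans ?_
  rw [edistα_comm α z']
  refine (add_le_add_right (add_le_add_right (h1 z') _) _).trans (le_of_eq ?_)
  ring

open Classical in
/-- The change of the distance over a short time interval, up to terms that need two rings. -/
lemma edistα_cellMap_add_le (hp : IsTransitionKernel p) (hF : IsReactionPair Fp Fm) {M : ℝ≥0}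
    (hα : ∀ x, 0 ≤ α x) (hM : ∀ x, α x ≤ M) (a b : ℝ) (z z' : V → ℕ) (ω : Ω) :
    edistα α (cellMap (rate p Fp Fm) (fun m => X m ω) a b z)
        (cellMap (rate p Fp Fm) (fun m => X m ω) a b z') +
      ∑' m, (soleHits (rate p Fp Fm) X a b z z' m).indicator
        (fun _ => ENNReal.ofReal (-drift α Fp Fm m z z')) ω ≤
    edistα α z z' +
      ∑' m, (soleHits (rate p Fp Fm) X a b z z' m).indicator
        (fun _ => ENNReal.ofReal (drift α Fp Fm m z z')) ω +
      8 * M * ∑' m, ∑' m', if m = m' then 0 else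
        (hits X m (box a b (rate p Fp Fm m z + rate p Fp Fm m z')) ∩
          hits X m' (box a b (rate p Fp Fm m' z + rate p Fp Fm m' z'))).indicator 1 ω := by
  set R := rate p Fp Fm with hR
  have hRnn : ∀ m z, 0 ≤ R m z := rate_nonneg hp hF
  set S := hitMarks R (fun m => X m ω) a b z with hS
  set S' := hitMarks R (fun m => X m ω) a b z' with hS'
  have hG : ∀ m, ω ∈ soleHits R X a b z z' m ↔ (m ∈ S ∧ m ∉ S') ∨ (m ∈ S' ∧ m ∉ S) := fun m => Iff.rfl
  have hpos : ∀ {m v}, m ∈ hitMarks R (fun m => X m ω) a b v → 0 < R m v := by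
    rintro m v ⟨q, -, -, hq1, hq2⟩
    exact hq1.trans hq2
  have hlt : ∀ {m v v'}, m ∈ hitMarks R (fun m => X m ω) a b v →
      m ∉ hitMarks R (fun m => X m ω) a b v' → R m v' < R m v := by
    intro m v v' h1 h2
    by_contra h3
    exact h2 (h1.mono (Set.inter_subset_inter_right _ (box_mono (not_lt.1 h3))))
  -- With at most one relevant mark, `cellMap` performs the true transition and the change is read
  -- off from `drift`.
  by_cases hsub : (S ∪ S').Subsingleton
  · rcases (S ∪ S').eq_empty_or_nonempty with he | ⟨m, hm⟩
    · obtain ⟨h1, h2⟩ := Set.union_empty_iff.1 he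
      have h3 : ∀ m, ω ∉ soleHits R X a b z z' m := by
        intro m
        rw [hG, h1, h2]
        simp
      rw [cellMap_of_ne_singleton fun m h => (Set.singleton_ne_empty m) (h.symm.trans h1),
        cellMap_of_ne_singleton fun m h => (Set.singleton_ne_empty m) (h.symm.trans h2)]
      simp only [h3, not_false_eq_true, Set.indicator_of_notMem, tsum_zero, add_zero]
      exact le_self_add
    · have hU : S ∪ S' = {m} := hsub.eq_singleton_of_mem hm
      have hm' : ∀ m', m' ≠ m → ω ∉ soleHits R X a b z z' m' := by
        intro m' hne hmem
        rw [hG] at hmem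
        have : m' ∈ S ∪ S' := by
          rcases hmem with h | h
          · exact .inl h.1
          · exact .inr h.1
        rw [hU] at this
        exact hne this
      rw [tsum_eq_single m fun m' hne => Set.indicator_of_notMem (hm' m' hne) _,
        tsum_eq_single m fun m' hne => Set.indicator_of_notMem (hm' m' hne) _]
      refine le_trans ?_ le_self_add
      have hone : ∀ T : Set (Mark V), T ⊆ S ∪ S' → m ∈ T → T = {m} := fun T hT hmT =>
        Set.Subset.antisymm (hT.trans hU.le) (Set.singleton_subset_iff.2 hmT)
      have hnone : ∀ T : Set (Mark V), T ⊆ S ∪ S' → m ∉ T → ∀ m', T ≠ {m'} := by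
        intro T hT hmT m' h
        have : m' ∈ S ∪ S' := hT (h ▸ rfl)
        rw [hU] at this
        cases this
        exact hmT (h ▸ rfl)
      by_cases c1 : m ∈ S <;> by_cases c2 : m ∈ S'
      · have h1 : ω ∉ soleHits R X a b z z' m := by rw [hG]; tauto
        rw [Set.indicator_of_notMem h1, Set.indicator_of_notMem h1,
          cellMap_of_eq_singleton (hone S Set.subset_union_left c1),
          cellMap_of_eq_singleton (hone S' Set.subset_union_right c2),
          edistα_transition_transition hF (hpos c1) (hpos c2)]
      · have h1 : ω ∈ soleHits R X a b z z' m := by rw [hG]; tauto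
        rw [Set.indicator_of_mem h1, Set.indicator_of_mem h1,
          cellMap_of_eq_singleton (hone S Set.subset_union_left c1),
          cellMap_of_ne_singleton (hnone S' Set.subset_union_right c2)]
        exact edistα_transition_of_rate_lt hp hF hα (hlt c1 c2)
      · have h1 : ω ∈ soleHits R X a b z z' m := by rw [hG]; tauto
        rw [Set.indicator_of_mem h1, Set.indicator_of_mem h1,
          cellMap_of_ne_singleton (hnone S Set.subset_union_left c1),
          cellMap_of_eq_singleton (hone S' Set.subset_union_right c2),
          edistα_comm α z, edistα_comm α z, ← drift_comm (hlt c2 c1)]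
        exact edistα_transition_of_rate_lt hp hF hα (hlt c2 c1)
      · rcases hm with h | h
        · exact absurd h c1
        · exact absurd h c2
  -- With two or more relevant marks, every mark that hits has a partner. Hence the number `Q` of
  -- ordered pairs is at least `1` and at least the number of hitting marks, so it pays for the
  -- crude change `4 * M` of the distance and for the whole sum of negative drifts.
  · rw [Set.not_subsingleton_iff] at hsub
    obtain ⟨m1, hm1, m2, hm2, hne⟩ := hsub
    set H : Mark V → Set Ω := fun m => hits X m (box a b (R m z + R m z')) with hH
    have hSH : ∀ m, m ∈ S ∪ S' → ω ∈ H m := by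
      rintro m (h | h)
      · exact h.mono (Set.inter_subset_inter_right _ (box_mono (le_add_of_nonneg_right (hRnn m z'))))
      · exact h.mono (Set.inter_subset_inter_right _ (box_mono (le_add_of_nonneg_left (hRnn m z))))
    set Q : ℝ≥0∞ := ∑' m, ∑' m', if m = m' then 0 else (H m ∩ H m').indicator 1 ω with hQ
    have hpart : ∀ m, ω ∈ H m → (1 : ℝ≥0∞) ≤ ∑' m', if m = m' then 0 else
        (H m ∩ H m').indicator (1 : Ω → ℝ≥0∞) ω := by
      intro m hm
      have : ∃ m', m ≠ m' ∧ ω ∈ H m' := by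
        by_cases h : m = m1
        · exact ⟨m2, fun h' => hne (h.symm.trans h'), hSH m2 hm2⟩
        · exact ⟨m1, h, hSH m1 hm1⟩
      obtain ⟨m', h1, h2⟩ := this
      refine le_trans ?_ (ENNReal.le_tsum m')
      rw [if_neg h1, Set.indicator_of_mem (s := H m ∩ H m') ⟨hm, h2⟩]
      rfl
    have h1Q : 1 ≤ Q := (hpart m1 (hSH m1 hm1)).trans (ENNReal.le_tsum (f := fun m => ∑' m', if m = m' then 0 else
        (H m ∩ H m').indicator (1 : Ω → ℝ≥0∞) ω) m1)
    have hsum : ∑' m, (soleHits R X a b z z' m).indicator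
        (fun _ => ENNReal.ofReal (-drift α Fp Fm m z z')) ω ≤ M * Q := by
      rw [hQ, ← ENNReal.tsum_mul_left]
      refine ENNReal.tsum_le_tsum fun m => ?_
      by_cases hm : ω ∈ soleHits R X a b z z' m
      · rw [Set.indicator_of_mem hm]
        have : ω ∈ H m := by
          rw [hG] at hm
          rcases hm with h | h
          · exact hSH m (.inl h.1)
          · exact hSH m (.inr h.1)
        calc _ ≤ (M : ℝ≥0∞) * 1 := by rw [mul_one]; exact (abs_drift_le hα hM m z z').2
          _ ≤ _ := by gcongr; exact hpart m this
      · rw [Set.indicator_of_notMem hm]; exact zero_le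
    calc _ ≤ edistα α z z' + 4 * M * 1 + M * Q := by
          rw [mul_one]
          exact add_le_add (edistα_cellMap_le hα hM a b z z') hsum
      _ ≤ edistα α z z' + 4 * M * Q + 4 * M * Q := by
          gcongr
          calc (M : ℝ≥0∞) = 1 * M := (one_mul _).symm
            _ ≤ 4 * M := by gcongr; norm_num
      _ = edistα α z z' + 0 + 8 * M * Q := by ring
      _ ≤ _ := by gcongr; exact zero_le

variable [MeasurableSpace Ω] {P : Measure Ω}

lemma measurableSet_soleHits (hX : IsPoissonClocks X P) {R : Mark V → (V → ℕ) → ℝ} (a b : ℝ)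
    (z z' : V → ℕ) (m : Mark V) : MeasurableSet (soleHits R X a b z z' m) :=
  (measurableSet_hits' hX m (measurableSet_box _ _ _)).symmDiff
    (measurableSet_hits' hX m (measurableSet_box _ _ _))

variable [IsProbabilityMeasure P]

lemma exp_neg_sub_exp_neg_le {x y : ℝ} (hx : 0 ≤ x) (hxy : x ≤ y) :
    Real.exp (-x) - Real.exp (-y) ≤ y - x := by
  have h1 : Real.exp (-y) = Real.exp (-x) * Real.exp (-(y - x)) := by
    rw [← Real.exp_add]; congr 1; ring
  have h2 := Real.add_one_le_exp (-(y - x))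
  have h3 : Real.exp (-x) ≤ 1 := Real.exp_le_one_iff.2 (by linarith)
  have h4 := Real.exp_pos (-x)
  rw [h1]
  nlinarith

lemma sub_sq_le_exp_neg_sub_exp_neg {x y : ℝ} (hy : 0 ≤ y) :
    y - x - y ^ 2 ≤ Real.exp (-x) - Real.exp (-y) := by
  have h1 := Real.add_one_le_exp (-x)
  have h2 := Real.add_one_le_exp y
  have h3 : Real.exp (-y) ≤ 1 - y + y ^ 2 := by
    rw [Real.exp_neg]
    refine inv_le_of_inv_le₀ (by nlinarith [sq_nonneg (y - 1)]) ?_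
    refine le_trans ?_ h2
    rw [inv_le_iff_one_le_mul₀ (by nlinarith [sq_nonneg (y - 1)])]
    nlinarith [pow_nonneg hy 3]
  linarith

/-- The boxes are nested, so the event is a difference of two hitting events, of probability `e^{-x}
- e^{-y}`, where `x ≤ y` are the cell length times the two rates. To first order this is `y - x`,
with an error of at most `y²`. -/
lemma measure_soleHits (hX : IsPoissonClocks X P) {R : Mark V → (V → ℕ) → ℝ}
    (hR : ∀ m z, 0 ≤ R m z) {a b : ℝ} (ha : 0 ≤ a) (hab : a ≤ b) (z z' : V → ℕ) (m : Mark V) :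
    P (soleHits R X a b z z' m) ≤ ENNReal.ofReal (b - a) * ENNReal.ofReal |R m z - R m z'| ∧
    ENNReal.ofReal (b - a) * ENNReal.ofReal |R m z - R m z'| ≤ P (soleHits R X a b z z' m) +
      (ENNReal.ofReal (b - a) * ENNReal.ofReal (R m z + R m z')) ^ 2 := by
  have hba : 0 ≤ b - a := sub_nonneg.2 hab
  wlog hle : R m z ≤ R m z' generalizing z z'
  · have h := this z' z (not_le.1 hle).le
    have he : soleHits R X a b z z' m = soleHits R X a b z' z m := symmDiff_comm _ _
    rwa [he, abs_sub_comm, add_comm (R m z)]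
  have hsub : hits X m (box a b (R m z)) ⊆ hits X m (box a b (R m z')) := fun ω hω =>
    hω.mono (Set.inter_subset_inter_right _ (box_mono hle))
  have hx : 0 ≤ (b - a) * R m z := mul_nonneg hba (hR m z)
  have hxy : (b - a) * R m z ≤ (b - a) * R m z' := mul_le_mul_of_nonneg_left hle hba
  have hP : P (soleHits R X a b z z' m) =
      ENNReal.ofReal (Real.exp (-((b - a) * R m z)) - Real.exp (-((b - a) * R m z'))) := by
    rw [soleHits, symmDiff_of_le hsub, measure_sdiff hsub
      (measurableSet_hits' hX m (measurableSet_box _ _ _)).nullMeasurableSet (measure_ne_top _ _),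
      measure_hits hX m ha hab (hR m z'), measure_hits hX m ha hab (hR m z),
      ← ENNReal.ofReal_sub]
    · congr 1; ring
    · rw [sub_nonneg]; exact Real.exp_le_one_iff.2 (by linarith)
  rw [hP, abs_of_nonpos (by linarith), ← ENNReal.ofReal_mul hba, ← ENNReal.ofReal_mul hba,
    ← ENNReal.ofReal_pow (mul_nonneg hba (add_nonneg (hR m z) (hR m z'))), ← ENNReal.ofReal_add]
  · constructor
    · exact ENNReal.ofReal_le_ofReal ((exp_neg_sub_exp_neg_le hx hxy).trans (by linarith))
    · refine ENNReal.ofReal_le_ofReal ?_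
      have h1 := sub_sq_le_exp_neg_sub_exp_neg (x := (b - a) * R m z) (hx.trans hxy)
      have h2 : ((b - a) * R m z') ^ 2 ≤ ((b - a) * (R m z + R m z')) ^ 2 := by
        refine pow_le_pow_left₀ (hx.trans hxy) ?_ 2
        rw [mul_add]; linarith
      nlinarith
  · rw [sub_nonneg]; exact Real.exp_le_exp.2 (by linarith)
  · positivity

/-- The expected distance after a short time interval. -/
lemma lintegral_edistα_cellMap_le [Countable V] (hp : IsTransitionKernel p) (hF : IsReactionPair Fp Fm)
    (hX : IsPoissonClocks X P) {M : ℝ≥0} (hα : ∀ x, 0 ≤ α x) (hM : ∀ x, α x ≤ M) {C : ℝ}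
    (hker : ∀ x, ∑' y, ENNReal.ofReal (p x y) * ENNReal.ofReal (α y) ≤
      ENNReal.ofReal C * ENNReal.ofReal (α x)) {a b : ℝ} (ha : 0 ≤ a) (hab : a ≤ b)
    {z z' : V → ℕ} {L : ℝ≥0}
    (hL : totalRate (rate p Fp Fm) z + totalRate (rate p Fp Fm) z' ≤ L) :
    ∫⁻ ω, edistα α (cellMap (rate p Fp Fm) (fun m => X m ω) a b z)
        (cellMap (rate p Fp Fm) (fun m => X m ω) a b z') ∂P ≤
      (1 + ENNReal.ofReal (b - a) * ENNReal.ofReal C) * edistα α z z' +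
        9 * M * L ^ 2 * ENNReal.ofReal (b - a) ^ 2 := by
  classical
  set R := rate p Fp Fm with hR
  have hRnn : ∀ m z, 0 ≤ R m z := rate_nonneg hp hF
  set h := ENNReal.ofReal (b - a) with hh
  have hba : 0 ≤ b - a := sub_nonneg.2 hab
  set c : Mark V → ℝ≥0∞ := fun m => ENNReal.ofReal (R m z + R m z') with hc
  have hcL : ∑' m, c m ≤ L := by
    simp only [hc, ENNReal.ofReal_add (hRnn _ z) (hRnn _ z')]
    rw [ENNReal.tsum_add]
    exact hL
  have hcsq : ∑' m, c m ^ 2 ≤ L ^ 2 := by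
    calc ∑' m, c m ^ 2 ≤ ∑' m, c m * L := ENNReal.tsum_le_tsum fun m => by
          rw [sq]; gcongr; exact (ENNReal.le_tsum m).trans hcL
      _ ≤ L * L := by rw [ENNReal.tsum_mul_right]; gcongr
      _ = L ^ 2 := (sq _).symm
  set G := soleHits R X a b z z' with hG
  have hGm : ∀ m, MeasurableSet (G m) := measurableSet_soleHits hX a b z z'
  set H : Mark V → Set Ω := fun m => hits X m (box a b (R m z + R m z')) with hH
  have hHm : ∀ m, MeasurableSet (H m) := fun m => measurableSet_hits' hX m (measurableSet_box _ _ _)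
  have hint : ∀ f : Mark V → ℝ≥0∞, ∫⁻ ω, ∑' m, (G m).indicator (fun _ => f m) ω ∂P =
      ∑' m, f m * P (G m) := by
    intro f
    rw [lintegral_tsum fun m => (measurable_const.indicator (hGm m)).aemeasurable]
    exact tsum_congr fun m => lintegral_indicator_const (hGm m) _
  have hintH : ∫⁻ ω, ∑' m, ∑' m', (if m = m' then 0 else
      (H m ∩ H m').indicator (1 : Ω → ℝ≥0∞) ω) ∂P ≤ h ^ 2 * L ^ 2 := by
    have hmm : ∀ m m', Measurable fun ω => if m = m' then 0 else
        (H m ∩ H m').indicator (1 : Ω → ℝ≥0∞) ω := by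
      intro m m'
      split_ifs
      · exact measurable_const
      · exact measurable_one.indicator ((hHm m).inter (hHm m'))
    rw [lintegral_tsum fun m => (Measurable.tsum (hmm m)).aemeasurable]
    calc _ ≤ ∑' m, ∑' m', (h * c m) * (h * c m') := by
          refine ENNReal.tsum_le_tsum fun m => ?_
          rw [lintegral_tsum fun m' => (hmm m m').aemeasurable]
          refine ENNReal.tsum_le_tsum fun m' => ?_
          by_cases hne : m = m'
          · simp [hne]
          · simp only [hne, if_false]
            rw [lintegral_indicator_one ((hHm m).inter (hHm m')),
              measure_hits_inter hX hne (measurableSet_box _ _ _) (measurableSet_box _ _ _)]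
            simp only [hh, hc, ← ENNReal.ofReal_mul hba]
            exact mul_le_mul' (measure_hits_le hX m ha hab (add_nonneg (hRnn _ _) (hRnn _ _)))
              (measure_hits_le hX m' ha hab (add_nonneg (hRnn _ _) (hRnn _ _)))
      _ = h ^ 2 * ((∑' m, c m) * ∑' m, c m) := by
          simp only [ENNReal.tsum_mul_left, ENNReal.tsum_mul_right]
          ring
      _ ≤ h ^ 2 * L ^ 2 := by rw [sq (L : ℝ≥0∞)]; gcongr
  set w : Mark V → ℝ≥0∞ := fun m => ENNReal.ofReal |R m z - R m z'| with hw
  set δp : Mark V → ℝ≥0∞ := fun m => ENNReal.ofReal (drift α Fp Fm m z z') with hδp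
  set δn : Mark V → ℝ≥0∞ := fun m => ENNReal.ofReal (-drift α Fp Fm m z z') with hδn
  have hPG : ∀ m, P (G m) ≤ h * w m ∧ h * w m ≤ P (G m) + (h * c m) ^ 2 :=
    measure_soleHits hX hRnn ha hab z z'
  have hwc : ∀ m, w m ≤ c m := fun m => ENNReal.ofReal_le_ofReal (by
    rw [abs_le]; constructor <;> linarith [hRnn m z, hRnn m z'])
  have e1 := lintegral_mono (μ := P) fun ω => edistα_cellMap_add_le (X := X) hp hF hα hM a b z z' ω
  rw [lintegral_add_right _ (Measurable.tsum fun m => measurable_const.indicator (hGm m)),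
    hint] at e1
  have hmeasH : Measurable fun ω => ∑' m, ∑' m', (if m = m' then 0 else
      (H m ∩ H m').indicator (1 : Ω → ℝ≥0∞) ω) := by
    refine Measurable.tsum fun m => Measurable.tsum fun m' => ?_
    split_ifs
    · exact measurable_const
    · exact measurable_one.indicator ((hHm m).inter (hHm m'))
  rw [lintegral_add_right _ (hmeasH.const_mul _), lintegral_const_mul _ hmeasH,
    lintegral_add_left measurable_const, hint, lintegral_const, measure_univ, mul_one] at e1
  -- Finiteness of the negative drift permits its cancellation from both sides.
  have hfin : ∑' m, δn m * P (G m) ≠ ∞ := by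
    refine ne_top_of_le_ne_top (b := M * (h * L)) ?_ ?_
    · exact ENNReal.mul_ne_top ENNReal.coe_ne_top
        (ENNReal.mul_ne_top ENNReal.ofReal_ne_top ENNReal.coe_ne_top)
    · calc ∑' m, δn m * P (G m) ≤ ∑' m, M * (h * c m) := ENNReal.tsum_le_tsum fun m =>
            mul_le_mul' (abs_drift_le hα hM m z z').2 ((hPG m).1.trans (by gcongr; exact hwc m))
        _ ≤ M * (h * L) := by
            rw [ENNReal.tsum_mul_left, ENNReal.tsum_mul_left]; gcongr
  refine (ENNReal.add_le_add_iff_right hfin).1 (e1.trans ?_)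
  -- Probabilities are replaced by their first-order terms, the generator inequality is applied, and
  -- the negative part is converted back. The conversion costs one second-order term, which joins
  -- the `8` from multiple rings to give the constant `9`.
  have e2 : ∑' m, δp m * P (G m) ≤ ∑' m, δn m * P (G m) + M * (h ^ 2 * L ^ 2) +
      h * (ENNReal.ofReal C * edistα α z z') := by
    calc ∑' m, δp m * P (G m) ≤ ∑' m, h * (δp m * w m) := ENNReal.tsum_le_tsum fun m => by
          calc δp m * P (G m) ≤ δp m * (h * w m) := by gcongr; exact (hPG m).1
            _ = _ := by ring
      _ ≤ h * (∑' m, δn m * w m + ENNReal.ofReal C * edistα α z z') := by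
          rw [ENNReal.tsum_mul_left]
          gcongr
          exact tsum_drift_le hp hF hα hker z z'
      _ = ∑' m, δn m * (h * w m) + h * (ENNReal.ofReal C * edistα α z z') := by
          rw [mul_add, ← ENNReal.tsum_mul_left]
          congr 1
          exact tsum_congr fun m => by ring
      _ ≤ ∑' m, (δn m * P (G m) + M * (h ^ 2 * c m ^ 2)) +
          h * (ENNReal.ofReal C * edistα α z z') := by
          gcongr with m
          calc δn m * (h * w m) ≤ δn m * (P (G m) + (h * c m) ^ 2) := by gcongr; exact (hPG m).2
            _ = δn m * P (G m) + δn m * (h ^ 2 * c m ^ 2) := by ring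
            _ ≤ _ := by gcongr; exact (abs_drift_le hα hM m z z').2
      _ ≤ _ := by
          rw [ENNReal.tsum_add, ENNReal.tsum_mul_left, ENNReal.tsum_mul_left]
          gcongr
  calc _ ≤ edistα α z z' + (∑' m, δn m * P (G m) + M * (h ^ 2 * L ^ 2) +
        h * (ENNReal.ofReal C * edistα α z z')) + 8 * M * (h ^ 2 * L ^ 2) := by
        gcongr
    _ = _ := by ring

end OneStep

/-! ### Random elements with countably many values -/

section CountableValued

lemma measurable_comp_of_countable {Ω β γ : Type*} [MeasurableSpace Ω] [MeasurableSpace γ]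
    {D : Set β} (hD : D.Countable) {f : Ω → β} (hfD : ∀ ω, f ω ∈ D)
    (hf : ∀ q ∈ D, MeasurableSet {ω | f ω = q}) (φ : β → γ) : Measurable fun ω => φ (f ω) := by
  intro B _
  have : (fun ω => φ (f ω)) ⁻¹' B = ⋃ q ∈ D ∩ φ ⁻¹' B, {ω | f ω = q} := by
    ext ω
    simp [hfD]
  rw [this]
  exact MeasurableSet.biUnion (hD.mono Set.inter_subset_left) fun q hq => hf q hq.1

/-- An event that depends on a random element `f` and an independent randomness. -/
lemma measure_freeze_le {Ω β : Type*} {m₁ m₂ : MeasurableSpace Ω} [mΩ : MeasurableSpace Ω]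
    {P : Measure Ω} [IsProbabilityMeasure P] (h1 : m₁ ≤ mΩ) (hind : Indep m₁ m₂ P)
    {D : Set β} (hD : D.Countable) {f : Ω → β} (hfD : ∀ ω, f ω ∈ D)
    (hf : ∀ q ∈ D, MeasurableSet[m₁] {ω | f ω = q}) {E : β → Set Ω}
    (hE : ∀ q ∈ D, MeasurableSet[m₂] (E q)) {B : ℝ≥0∞} (hB : ∀ q ∈ D, P (E q) ≤ B) :
    P {ω | ω ∈ E (f ω)} ≤ B := by
  have := hD.to_subtype
  have hd : Pairwise (Function.onFun Disjoint fun q : D => {ω | f ω = q}) := by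
    intro q q' hqq
    refine Set.disjoint_left.2 fun ω h h' => hqq (Subtype.ext ?_)
    exact Eq.trans (Eq.symm h) h'
  calc P {ω | ω ∈ E (f ω)} ≤ P (⋃ q : D, {ω | f ω = q} ∩ E q) := measure_mono fun ω hω =>
        Set.mem_iUnion.2 ⟨⟨f ω, hfD ω⟩, rfl, hω⟩
    _ ≤ ∑' q : D, P ({ω | f ω = q} ∩ E q) := measure_iUnion_le _
    _ ≤ ∑' q : D, P {ω | f ω = q} * B := ENNReal.tsum_le_tsum fun q => by
        rw [(Indep_iff _ _ _).1 hind _ _ (hf q q.2) (hE q q.2)]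
        gcongr
        exact hB q q.2
    _ = P (⋃ q : D, {ω | f ω = q}) * B := by
        rw [ENNReal.tsum_mul_right, measure_iUnion hd fun q => h1 _ (hf q q.2)]
    _ ≤ 1 * B := by gcongr; exact prob_le_one
    _ = B := one_mul B

end CountableValued

/-! ### Weights for the distance estimates -/

/-- A bounded weight which is a supersolution of the equation `∑_y p(x,y) α(y) = C α(x)`. -/
structure IsBoundedWeight {V : Type*} (p : V → V → ℝ) (α : V → ℝ) (C : ℝ) (M : ℝ≥0) : Prop where
  nonneg : ∀ x, 0 ≤ α x
  le : ∀ x, α x ≤ M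
  const_nonneg : 0 ≤ C
  kernel_le : ∀ x, ∑' y, ENNReal.ofReal (p x y) * ENNReal.ofReal (α y) ≤
    ENNReal.ofReal C * ENNReal.ofReal (α x)

lemma isBoundedWeight_one {V : Type*} {p : V → V → ℝ} (hp : IsTransitionKernel p) :
    IsBoundedWeight p (fun _ => 1) 1 1 where
  nonneg _ := zero_le_one
  le _ := le_rfl
  const_nonneg := zero_le_one
  kernel_le x := by simp [tsum_ofReal_kernel hp]

lemma IsLocalization.exists_isBoundedWeight {V : Type*} {p : V → V → ℝ} {α : V → ℝ} {C : ℝ}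
    (hp : IsTransitionKernel p) (hα : IsLocalization p α C) : ∃ M, IsBoundedWeight p α C M := by
  refine ⟨(∑' x, α x).toNNReal, fun x => (hα.pos x).le, fun x => ?_, hα.const_pos.le, fun x => ?_⟩
  · rw [Real.coe_toNNReal _ (tsum_nonneg fun x => (hα.pos x).le)]
    exact hα.summable.le_tsum x fun y _ => (hα.pos y).le
  · have hs : Summable fun y => p x y * α y := by
      refine hα.summable.of_nonneg_of_le (fun y => mul_nonneg (hp.mem_unit x y).1 (hα.pos y).le)
        fun y => ?_
      exact mul_le_of_le_one_left (hα.pos y).le (hp.mem_unit x y).2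
    simp only [← ENNReal.ofReal_mul (hp.mem_unit x _).1]
    rw [← ENNReal.ofReal_tsum_of_nonneg
      (fun y => mul_nonneg (hp.mem_unit x y).1 (hα.pos y).le) hs,
      ← ENNReal.ofReal_mul hα.const_pos.le]
    exact ENNReal.ofReal_le_ofReal (hα.kernel_le x)

/-! ### The discretized flow as a Markov chain -/

section Chain

variable {V Ω : Type*} {R : Mark V → (V → ℕ) → ℝ} {X : Mark V → Ω → Set (ℝ × ℝ)}
  {S : Set ((V → ℕ) × (V → ℕ))} {t : ℕ → ℝ≥0} {q₀ : (V → ℕ) × (V → ℕ)}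

lemma cellMap_mem_E0 {X : Mark V → Set (ℝ × ℝ)} (a b : ℝ) {z : V → ℕ} (hz : z ∈ E0 V) :
    cellMap R X a b z ∈ E0 V :=
  cellMap_mem hz (transition_mem_E0 hz) a b

lemma chain_mem_E0 {X : Mark V → Set (ℝ × ℝ)} (hq : q₀ ∈ E0 V ×ˢ E0 V) (n : ℕ) :
    chain R X S t q₀ n ∈ E0 V ×ˢ E0 V := by
  induction n with
  | zero => exact hq
  | succ n ih =>
    rw [chain]
    split_ifs
    · exact ⟨cellMap_mem_E0 _ _ ih.1, cellMap_mem_E0 _ _ ih.2⟩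
    · exact ih

variable [Countable V]

lemma measurableSet_cellMap_pair_eq (a b : ℝ) (q v : (V → ℕ) × (V → ℕ)) :
    MeasurableSet[regionSigma X (strip a b)] {ω | (cellMap R (fun m => X m ω) a b q.1,
      cellMap R (fun m => X m ω) a b q.2) = v} := by
  have : {ω | (cellMap R (fun m => X m ω) a b q.1, cellMap R (fun m => X m ω) a b q.2) = v} =
      {ω | cellMap R (fun m => X m ω) a b q.1 = v.1} ∩
        {ω | cellMap R (fun m => X m ω) a b q.2 = v.2} := by
    ext ω
    simp [Prod.ext_iff]
  rw [this]
  exact (measurableSet_cellMap_eq a b _ _).inter (measurableSet_cellMap_eq a b _ _)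

lemma E0_prod_countable : (E0 V ×ˢ E0 V).Countable := E0_countable.prod E0_countable

lemma measurable_cellMap_pair_comp (a b : ℝ) {q : (V → ℕ) × (V → ℕ)} (hq : q ∈ E0 V ×ˢ E0 V)
    (f : (V → ℕ) × (V → ℕ) → ℝ≥0∞) :
    Measurable[regionSigma X (strip a b)] fun ω => f (cellMap R (fun m => X m ω) a b q.1,
      cellMap R (fun m => X m ω) a b q.2) := by
  let _ := regionSigma X (strip a b)
  have h1 : ∀ ω, (fun ω => (cellMap R (fun m => X m ω) a b q.1,
      cellMap R (fun m => X m ω) a b q.2)) ω ∈ E0 V ×ˢ E0 V :=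
    fun ω => ⟨cellMap_mem_E0 _ _ hq.1, cellMap_mem_E0 _ _ hq.2⟩
  exact measurable_comp_of_countable E0_prod_countable h1
    (fun v _ => measurableSet_cellMap_pair_eq _ _ _ _) f

/-- By induction: the next state is determined by the present one, which depends on the past strip,
and by the clocks in the new cell. The countable state space allows a union over the present state.
-/
lemma measurableSet_chain_eq (ht : Monotone t) (hq : q₀ ∈ E0 V ×ˢ E0 V) (n : ℕ)
    (q : (V → ℕ) × (V → ℕ)) :
    MeasurableSet[regionSigma X (strip (t 0) (t n))]
      {ω | chain R (fun m => X m ω) S t q₀ n = q} := by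
  classical
  induction n generalizing q with
  | zero => exact MeasurableSet.const (q₀ = q)
  | succ n ih =>
    have hle := regionSigma_mono X (strip_mono (le_refl (t 0 : ℝ))
      (NNReal.coe_le_coe.2 (ht n.le_succ)))
    have hle' := regionSigma_mono X (strip_mono (NNReal.coe_le_coe.2 (ht n.zero_le))
      (le_refl (t (n + 1) : ℝ)))
    have : {ω | chain R (fun m => X m ω) S t q₀ (n + 1) = q} = ⋃ v ∈ E0 V ×ˢ E0 V,
        {ω | chain R (fun m => X m ω) S t q₀ n = v} ∩
        {ω | (if v ∈ S then (cellMap R (fun m => X m ω) (t n) (t (n + 1)) v.1,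
          cellMap R (fun m => X m ω) (t n) (t (n + 1)) v.2) else v) = q} := by
      ext ω
      simp only [Set.mem_iUnion, Set.mem_inter_iff, Set.mem_ofPred_eq, exists_prop]
      constructor
      · intro h
        refine ⟨_, chain_mem_E0 hq n, rfl, ?_⟩
        rw [chain] at h
        convert h
      · rintro ⟨v, -, rfl, h⟩
        rw [chain]
        convert h
    rw [this]
    refine MeasurableSet.biUnion E0_prod_countable fun v _ => (hle _ (ih v)).inter ?_
    by_cases hv : v ∈ S
    · simp only [hv, if_true]
      exact hle' _ (measurableSet_cellMap_pair_eq _ _ _ _)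
    · simp only [hv, if_false]
      exact MeasurableSet.const _

variable [MeasurableSpace Ω] {P : Measure Ω}

lemma measurable_chain_comp (hX : IsPoissonClocks X P) (ht : Monotone t) (hq : q₀ ∈ E0 V ×ˢ E0 V)
    (n : ℕ) {γ : Type*} [MeasurableSpace γ] (f : (V → ℕ) × (V → ℕ) → γ) :
    Measurable fun ω => f (chain R (fun m => X m ω) S t q₀ n) :=
  measurable_comp_of_countable E0_prod_countable (fun _ => chain_mem_E0 hq n)
    (fun q _ => regionSigma_le hX _ _ (measurableSet_chain_eq ht hq n q)) f

variable [IsProbabilityMeasure P]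

/-- A one-step bound for a function of the pair gives a bound for the discretized flow. -/
lemma lintegral_chain_le (hX : IsPoissonClocks X P) (ht : Monotone t) (hq : q₀ ∈ E0 V ×ˢ E0 V)
    {f : (V → ℕ) × (V → ℕ) → ℝ≥0∞} {A B : ℝ≥0∞} (hA : 1 ≤ A)
    (hf : ∀ i, ∀ q ∈ E0 V ×ˢ E0 V, q ∈ S → ∫⁻ ω, f (cellMap R (fun m => X m ω) (t i) (t (i + 1)) q.1,
      cellMap R (fun m => X m ω) (t i) (t (i + 1)) q.2) ∂P ≤ A * f q + B) (n : ℕ) :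
    ∫⁻ ω, f (chain R (fun m => X m ω) S t q₀ n) ∂P ≤ A ^ n * (f q₀ + n * B) := by
  classical
  induction n with
  | zero => simp [chain]
  | succ n ih =>
    let step : (V → ℕ) × (V → ℕ) → Ω → (V → ℕ) × (V → ℕ) := fun q ω =>
      if q ∈ S then (cellMap R (fun m => X m ω) (t n) (t (n + 1)) q.1,
        cellMap R (fun m => X m ω) (t n) (t (n + 1)) q.2) else q
    have hg : ∀ q ∈ E0 V ×ˢ E0 V,
        Measurable[regionSigma X (strip (t n) (t (n + 1)))] fun ω => f (step q ω) := by
      intro q hqE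
      by_cases hv : q ∈ S
      · simp only [step, hv, if_true]
        exact measurable_cellMap_pair_comp _ _ hqE f
      · simp only [step, hv, if_false]
        exact @measurable_const _ _ _ (regionSigma X (strip (t n) (t (n + 1)))) _
    have hφ : ∀ q ∈ E0 V ×ˢ E0 V, ∫⁻ ω, f (step q ω) ∂P ≤ A * f q + B := by
      intro q hqE
      by_cases hv : q ∈ S
      · simp only [step, hv, if_true]
        exact hf n q hqE hv
      · simp only [step, hv, if_false, lintegral_const, measure_univ, mul_one]
        calc f q = 1 * f q := (one_mul _).symm
          _ ≤ A * f q := by gcongr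
          _ ≤ _ := le_self_add
    have hY : ∀ q ∈ E0 V ×ˢ E0 V, MeasurableSet[regionSigma X (strip (t 0) (t n))]
        {ω | chain R (fun m => X m ω) S t q₀ n = q} := fun q _ => measurableSet_chain_eq ht hq n q
    have h1 : ∫⁻ ω, f (chain R (fun m => X m ω) S t q₀ (n + 1)) ∂P ≤
        ∫⁻ ω, (A * f (chain R (fun m => X m ω) S t q₀ n) + B) ∂P := by
      have h2 := setLIntegral_freeze_le (P := P) (regionSigma_le hX _) (regionSigma_le hX _)
        (indep_regionSigma hX disjoint_strip) E0_prod_countable (fun _ => chain_mem_E0 hq n) hY hg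
        hφ (@MeasurableSet.univ _ (regionSigma X (strip (t 0) (t n))))
      rw [setLIntegral_univ, setLIntegral_univ] at h2
      exact h2
    refine h1.trans ?_
    rw [lintegral_add_right _ measurable_const, lintegral_const_mul _
      (measurable_chain_comp hX ht hq n f), lintegral_const, measure_univ, mul_one]
    calc _ ≤ A * (A ^ n * (f q₀ + n * B)) + 1 * B := by rw [one_mul]; gcongr
      _ ≤ A * (A ^ n * (f q₀ + n * B)) + A ^ (n + 1) * B := by
          gcongr
          exact one_le_pow₀ hA
      _ = _ := by push_cast; ring

/-- The state at the left end of a cell is independent of the clocks in the cell, so the bound for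
fixed configurations applies to it; the rest is a union bound. -/
lemma measure_exists_bad_le (hX : IsPoissonClocks X P) (ht : Monotone t) (hq : q₀ ∈ E0 V ×ˢ E0 V)
    {B : ℝ≥0∞} (hB : ∀ i, ∀ q ∈ E0 V ×ˢ E0 V, q ∈ S →
      P {ω | Bad R (fun m => X m ω) (t i) (t (i + 1)) q.1 q.2} ≤ B) (n : ℕ) :
    P {ω | ∃ i < n, chain R (fun m => X m ω) S t q₀ i ∈ S ∧
      Bad R (fun m => X m ω) (t i) (t (i + 1)) (chain R (fun m => X m ω) S t q₀ i).1
        (chain R (fun m => X m ω) S t q₀ i).2} ≤ n * B := by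
  classical
  have h1 : ∀ i, P {ω | chain R (fun m => X m ω) S t q₀ i ∈ S ∧
      Bad R (fun m => X m ω) (t i) (t (i + 1)) (chain R (fun m => X m ω) S t q₀ i).1
        (chain R (fun m => X m ω) S t q₀ i).2} ≤ B := by
    intro i
    refine measure_freeze_le (m₂ := regionSigma X (strip (t i) (t (i + 1))))
      (regionSigma_le hX (strip (t 0) (t i))) (indep_regionSigma hX disjoint_strip)
      E0_prod_countable (f := fun ω => chain R (fun m => X m ω) S t q₀ i)
      (fun _ => chain_mem_E0 hq i) (fun q _ => measurableSet_chain_eq ht hq i q)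
      (E := fun q => {ω | q ∈ S ∧ Bad R (fun m => X m ω) (t i) (t (i + 1)) q.1 q.2}) ?_ ?_
    · intro q _
      exact (MeasurableSet.const _).inter (measurableSet_bad _ _ _ _)
    · intro q hqE
      by_cases hv : q ∈ S
      · simp only [hv, true_and]
        exact hB i q hqE hv
      · simp [hv]
  calc _ ≤ P (⋃ i ∈ Finset.range n, {ω | chain R (fun m => X m ω) S t q₀ i ∈ S ∧
      Bad R (fun m => X m ω) (t i) (t (i + 1)) (chain R (fun m => X m ω) S t q₀ i).1
        (chain R (fun m => X m ω) S t q₀ i).2}) := measure_mono fun ω => by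
        rintro ⟨i, hi, h⟩
        exact Set.mem_biUnion (Finset.mem_coe.2 (Finset.mem_range.2 hi)) h
    _ ≤ ∑ i ∈ Finset.range n, B := (measure_biUnion_finset_le _ _).trans
        (Finset.sum_le_sum fun i _ => h1 i)
    _ = n * B := by simp

end Chain

/-! ### Approximation of the finite flow by the discretized flow -/

section Approximation

variable {V Ω : Type*} {p : V → V → ℝ} {Fp Fm : ℕ → ℝ}
  {X : Mark V → Ω → Set (ℝ × ℝ)} 

/-- All rates vanish in the empty configuration. With `0` as second component, the distance estimate
becomes an estimate of the number of particles. -/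
lemma cellMap_zero (hF : IsReactionPair Fp Fm) {X : Mark V → Set (ℝ × ℝ)} (a b : ℝ) :
    cellMap (rate p Fp Fm) X a b 0 = 0 := by
  refine cellMap_of_ne_singleton fun m hm => ?_
  have h : m ∈ hitMarks (rate p Fp Fm) X a b 0 := hm ▸ rfl
  obtain ⟨q, -, -, h1, h2⟩ := h
  have : rate p Fp Fm m 0 = 0 := by cases m <;> simp [rate, hF.birth_zero, hF.death_zero]
  rw [this] at h2
  exact absurd h1 h2.not_gt

lemma totalRate_zero (hF : IsReactionPair Fp Fm) : totalRate (rate p Fp Fm) 0 = 0 := by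
  unfold totalRate
  rw [ENNReal.tsum_eq_zero]
  intro m
  cases m <;> simp [rate, hF.birth_zero, hF.death_zero]

/-- Pairs of configurations with at most `K` particles each. -/
def smallPairs (V : Type*) (K : ℕ) : Set ((V → ℕ) × (V → ℕ)) := {q | mass q.1 ≤ K ∧ mass q.2 ≤ K}

/-- The equidistant grid on `[s,t]` with `n` cells. -/
noncomputable def grid (s t : ℝ≥0) (n : ℕ) (i : ℕ) : ℝ≥0 := s + i * ((t - s) / n)

lemma grid_monotone (s t : ℝ≥0) (n : ℕ) : Monotone (grid s t n) := fun i j h => by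
  unfold grid; gcongr

lemma grid_zero (s t : ℝ≥0) (n : ℕ) : grid s t n 0 = s := by simp [grid]

lemma grid_self {s t : ℝ≥0} (hst : s ≤ t) {n : ℕ} (hn : n ≠ 0) : grid s t n n = t := by
  have : (n : ℝ≥0) ≠ 0 := by exact_mod_cast hn
  rw [grid, mul_div_cancel₀ _ this, add_tsub_cancel_of_le hst]

lemma ofReal_grid_sub {s t : ℝ≥0} (n i : ℕ) :
    ENNReal.ofReal ((grid s t n (i + 1) : ℝ) - grid s t n i) = (((t - s) / n : ℝ≥0) : ℝ≥0∞) := by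
  have : (grid s t n (i + 1) : ℝ) - grid s t n i = ((t - s) / n : ℝ≥0) := by
    simp only [grid]
    push_cast
    ring
  rw [this, ENNReal.ofReal_coe_nnreal]

lemma one_add_pow_le_exp {C : ℝ} (hC : 0 ≤ C) {s t : ℝ≥0} (hst : s ≤ t) {n : ℕ} (hn : n ≠ 0) :
    (1 + (((t - s) / n : ℝ≥0) : ℝ≥0∞) * ENNReal.ofReal C) ^ n ≤
      ENNReal.ofReal (Real.exp (C * (t - s))) := by
  have hn' : (n : ℝ) ≠ 0 := by exact_mod_cast hn
  rw [← ENNReal.ofReal_coe_nnreal, ← ENNReal.ofReal_mul (NNReal.coe_nonneg _),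
    ← ENNReal.ofReal_one, ← ENNReal.ofReal_add zero_le_one (by positivity),
    ← ENNReal.ofReal_pow (by positivity)]
  refine ENNReal.ofReal_le_ofReal ?_
  have h1 : C * ((t : ℝ) - s) = n * (((t - s) / n : ℝ≥0) * C) := by
    rw [NNReal.coe_div, NNReal.coe_sub hst, NNReal.coe_natCast]
    field_simp
  rw [h1, Real.exp_nat_mul]
  refine pow_le_pow_left₀ (by positivity) ?_ n
  rw [add_comm]
  exact Real.add_one_le_exp _

lemma natCast_mul_div_sq (T : ℝ≥0) {n : ℕ} (hn : n ≠ 0) (B : ℝ≥0∞) :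
    (n : ℝ≥0∞) * (B * (((T / n : ℝ≥0) : ℝ≥0∞)) ^ 2) = B * (T : ℝ≥0∞) ^ 2 / n := by
  have hn0 : (n : ℝ≥0) ≠ 0 := by exact_mod_cast hn
  have h1 : (n : ℝ≥0∞) ≠ 0 := by exact_mod_cast hn
  have h2 : (n : ℝ≥0∞) ≠ ∞ := ENNReal.natCast_ne_top n
  rw [ENNReal.coe_div hn0, ENNReal.coe_natCast, div_eq_mul_inv, div_eq_mul_inv, mul_pow]
  calc (n : ℝ≥0∞) * (B * ((T : ℝ≥0∞) ^ 2 * ((n : ℝ≥0∞)⁻¹) ^ 2))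
      = B * (T : ℝ≥0∞) ^ 2 * ((n : ℝ≥0∞) * (n : ℝ≥0∞)⁻¹) * (n : ℝ≥0∞)⁻¹ := by ring
    _ = _ := by rw [ENNReal.mul_inv_cancel h1 h2, mul_one]

variable [Countable V] [MeasurableSpace Ω] {P : Measure Ω} [IsProbabilityMeasure P]

lemma lintegral_mass_cellMap_le (hp : IsTransitionKernel p) (hF : IsReactionPair Fp Fm)
    (hX : IsPoissonClocks X P) {a b : ℝ} (ha : 0 ≤ a) (hab : a ≤ b)
    {z : V → ℕ} {L : ℝ≥0} (hL : totalRate (rate p Fp Fm) z ≤ L) :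
    ∫⁻ ω, mass (cellMap (rate p Fp Fm) (fun m => X m ω) a b z) ∂P ≤
      (1 + ENNReal.ofReal (b - a)) * mass z + 9 * L ^ 2 * ENNReal.ofReal (b - a) ^ 2 := by
  have hw := isBoundedWeight_one (p := p) hp
  have h := lintegral_edistα_cellMap_le hp hF hX hw.nonneg hw.le hw.kernel_le ha hab (z := z)
    (z' := 0) (L := L) (by rwa [totalRate_zero hF, add_zero])
  simpa only [cellMap_zero hF, edistα_one_zero, ENNReal.ofReal_one, mul_one, ENNReal.coe_one] using h

/-- The discretized flow approximates the flow, with controlled expected distance. -/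
lemma exists_discretization (hp : IsTransitionKernel p) (hF : IsReactionPair Fp Fm)
    (hX : IsPoissonClocks X P) {α : V → ℝ} {C : ℝ} {M : ℝ≥0} (hα : IsBoundedWeight p α C M)
    {s t : ℝ≥0} (hst : s ≤ t) {z z' : V → ℕ} (hz : z ∈ E0 V) (hz' : z' ∈ E0 V) {ε : ℝ≥0∞}
    (hε : ε ≠ 0) :
    ∃ W : Ω → (V → ℕ) × (V → ℕ), (∀ ω, W ω ∈ E0 V ×ˢ E0 V) ∧
      (∀ q, MeasurableSet[regionSigma X (strip s t)] {ω | W ω = q}) ∧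
      P {ω | ¬ PairPath (rate p Fp Fm) (fun m => X m ω) s t z z' (W ω).1 (W ω).2} ≤ ε ∧
      ∫⁻ ω, edistα α (W ω).1 (W ω).2 ∂P ≤
        ENNReal.ofReal (Real.exp (C * (t - s))) * edistα α z z' + ε := by
  set R := rate p Fp Fm with hR
  have hRnn : ∀ m z, 0 ≤ R m z := rate_nonneg hp hF
  set T : ℝ≥0 := t - s with hT
  -- The minimum with `1` keeps `ε₀` finite for the divisions and bounds the error in the expected
  -- number of particles by `1`.
  set ε₀ : ℝ≥0∞ := min 1 (ε / 2) with hε₀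
  have hε2 : ε / 2 ≠ 0 := (ENNReal.half_pos hε).ne'
  have hε₀0 : ε₀ ≠ 0 := by
    rw [hε₀]; exact (lt_min one_pos (pos_iff_ne_zero.2 hε2)).ne'
  set e1 := ENNReal.ofReal (Real.exp (1 * (t - s))) with he1
  set eC := ENNReal.ofReal (Real.exp (C * (t - s))) with heC
  have hm0 : e1 * (mass z + mass z' + 1) ≠ ∞ := ENNReal.mul_ne_top ENNReal.ofReal_ne_top
    (ENNReal.add_ne_top.2 ⟨ENNReal.add_ne_top.2 ⟨mass_ne_top hz, mass_ne_top hz'⟩, ENNReal.one_ne_top⟩)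
  -- By Markov's inequality more than `K` particles have probability at most `ε₀`. The rate bound
  -- `L` has to cover `K + 1` particles, since the caps involve configurations after one more
  -- transition.
  obtain ⟨K, hK⟩ := ENNReal.exists_nat_gt (ENNReal.div_ne_top hm0 hε₀0)
  obtain ⟨L, hL⟩ := exists_totalRate_le hp hF (K + 1)
  have hK0 : (K : ℝ≥0∞) ≠ 0 := (lt_of_le_of_lt zero_le hK).ne'
  -- The second-order constants per cell are `36 * M * L ^ 2 = 9 * M * (2 * L) ^ 2` for the
  -- distance, `24 * L ^ 2 = 3 * (2 * L) * (4 * L)` for bad cells, and `18 * L ^ 2` for the mass,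
  -- which `72` covers generously. Over `n` cells of length `T / n` each error is at most `Q / n`.
  set Q : ℝ≥0∞ := 72 * L ^ 2 * T ^ 2 + 24 * L ^ 2 * T ^ 2 + eC * (36 * M * L ^ 2 * T ^ 2) with hQ
  have hQtop : Q ≠ ∞ := by
    have h1 : eC ≠ ∞ := ENNReal.ofReal_ne_top
    rw [hQ]
    finiteness
  obtain ⟨n, hn⟩ := ENNReal.exists_nat_gt (ENNReal.div_ne_top hQtop hε₀0)
  have hn0 : n ≠ 0 := by rintro rfl; simp at hn
  have hnE : (n : ℝ≥0∞) ≠ 0 := by exact_mod_cast hn0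
  have hQn : Q / n ≤ ε₀ := by
    rw [ENNReal.div_le_iff hnE (ENNReal.natCast_ne_top n), mul_comm]
    exact ENNReal.div_le_iff_le_mul (.inl hε₀0) (.inl (ne_top_of_le_ne_top ENNReal.one_ne_top
      (min_le_left _ _))) |>.1 hn.le
  set S := smallPairs V K with hS
  set g := grid s t n with hg
  have hgm : Monotone g := grid_monotone s t n
  have hg0 : g 0 = s := grid_zero s t n
  have hgn : g n = t := grid_self hst hn0
  set h : ℝ≥0∞ := ((T / n : ℝ≥0) : ℝ≥0∞) with hh
  have hgh : ∀ i, ENNReal.ofReal ((g (i + 1) : ℝ) - g i) = h := fun i => ofReal_grid_sub n i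
  have hnn : ∀ i, (0 : ℝ) ≤ g i := fun i => NNReal.coe_nonneg _
  have hmono : ∀ i, (g i : ℝ) ≤ g (i + 1) := fun i => NNReal.coe_le_coe.2 (hgm i.le_succ)
  have hrate : ∀ {z : V → ℕ}, mass z ≤ K → totalRate R z ≤ L := fun hz =>
    hL _ (hz.trans (by push_cast; exact le_self_add))
  have hrate' : ∀ {z : V → ℕ}, mass z ≤ K → ∀ m, totalRate R (transition m z) ≤ L := fun hz m =>
    hL _ ((mass_transition_le m _).trans (by push_cast; gcongr))
  have hq : (z, z') ∈ E0 V ×ˢ E0 V := ⟨hz, hz'⟩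
  have hn36 : ∀ B : ℝ≥0∞, (n : ℝ≥0∞) * (B * h ^ 2) = B * (T : ℝ≥0∞) ^ 2 / n :=
    natCast_mul_div_sq T hn0
  have hdist : ∫⁻ ω, edistα α (chain R (fun m => X m ω) S g (z, z') n).1
      (chain R (fun m => X m ω) S g (z, z') n).2 ∂P ≤ eC * edistα α z z' + ε := by
    refine (lintegral_chain_le hX hgm hq (f := fun q => edistα α q.1 q.2)
      (A := 1 + h * ENNReal.ofReal C) (B := 36 * M * L ^ 2 * h ^ 2) le_self_add ?_ n).trans ?_
    · rintro i q - ⟨h1, h2⟩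
      refine (lintegral_edistα_cellMap_le hp hF hX hα.nonneg hα.le hα.kernel_le (hnn i) (hmono i)
        (L := 2 * L) ?_).trans (le_of_eq ?_)
      · push_cast; rw [two_mul]; exact add_le_add (hrate h1) (hrate h2)
      · rw [hgh]; push_cast; ring
    · refine (mul_le_mul' (one_add_pow_le_exp hα.const_nonneg hst hn0) le_rfl).trans ?_
      rw [mul_add, hn36]
      gcongr
      rw [← mul_div_assoc]
      refine le_trans (ENNReal.div_le_div_right ?_ _) (hQn.trans ((min_le_right _ _).trans
        ENNReal.half_le_self))
      exact le_add_self
  have hmass : ∫⁻ ω, (mass (chain R (fun m => X m ω) S g (z, z') n).1 +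
      mass (chain R (fun m => X m ω) S g (z, z') n).2) ∂P ≤ e1 * (mass z + mass z' + 1) := by
    refine (lintegral_chain_le hX hgm hq (f := fun q => mass q.1 + mass q.2)
      (A := 1 + h * ENNReal.ofReal 1) (B := 18 * L ^ 2 * h ^ 2) le_self_add ?_ n).trans ?_
    · rintro i q hqE ⟨h1, h2⟩
      rw [lintegral_add_left]
      · refine (add_le_add (lintegral_mass_cellMap_le hp hF hX (hnn i) (hmono i) (hrate h1))
          (lintegral_mass_cellMap_le hp hF hX (hnn i) (hmono i) (hrate h2))).trans (le_of_eq ?_)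
        rw [hgh, ENNReal.ofReal_one]; ring
      · exact (measurable_cellMap_pair_comp _ _ hqE fun q => mass q.1).mono
          (regionSigma_le hX _) le_rfl
    · refine (mul_le_mul' (one_add_pow_le_exp zero_le_one hst hn0) le_rfl).trans ?_
      rw [hn36]
      gcongr
      refine le_trans (ENNReal.div_le_div_right ?_ _) (hQn.trans (min_le_left _ _))
      refine le_trans ?_ (le_self_add.trans le_self_add)
      gcongr
      norm_num
  -- Since the chain is held outside `S`, its final state alone detects every exit.
  have hout : P {ω | chain R (fun m => X m ω) S g (z, z') n ∉ S} ≤ ε / 2 := by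
    calc _ ≤ P {ω | (K : ℝ≥0∞) ≤ mass (chain R (fun m => X m ω) S g (z, z') n).1 +
          mass (chain R (fun m => X m ω) S g (z, z') n).2} := measure_mono fun ω hω => by
          simp only [Set.mem_ofPred_eq]
          by_contra hlt
          rw [not_le] at hlt
          exact hω ⟨le_self_add.trans hlt.le, le_add_self.trans hlt.le⟩
      _ ≤ e1 * (mass z + mass z' + 1) / K := by
          refine (meas_ge_le_lintegral_div ?_ hK0 (ENNReal.natCast_ne_top K)).trans
            (ENNReal.div_le_div_right hmass _)
          exact (measurable_chain_comp hX hgm hq n fun q => mass q.1 + mass q.2).aemeasurable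
      _ ≤ ε₀ := by
          rw [ENNReal.div_le_iff hK0 (ENNReal.natCast_ne_top K), mul_comm ε₀]
          exact ENNReal.div_le_iff_le_mul (.inl hε₀0) (.inl (ne_top_of_le_ne_top ENNReal.one_ne_top
            (min_le_left _ _))) |>.1 hK.le
      _ ≤ ε / 2 := min_le_right _ _
  have hbad : P {ω | ∃ i < n, chain R (fun m => X m ω) S g (z, z') i ∈ S ∧
      Bad R (fun m => X m ω) (g i) (g (i + 1)) (chain R (fun m => X m ω) S g (z, z') i).1
        (chain R (fun m => X m ω) S g (z, z') i).2} ≤ ε / 2 := by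
    refine (measure_exists_bad_le hX hgm hq (B := 24 * L ^ 2 * h ^ 2) ?_ n).trans ?_
    · rintro i q - ⟨h1, h2⟩
      refine (measure_bad_le hX hRnn (hnn i) (hmono i) (L := 4 * L) fun m₀ => ?_).trans ?_
      · simp only [cap, ENNReal.ofReal_add (add_nonneg (hRnn _ _) (hRnn _ _))
          (add_nonneg (hRnn _ _) (hRnn _ _)), ENNReal.ofReal_add (hRnn _ _) (hRnn _ _)]
        rw [ENNReal.tsum_add, ENNReal.tsum_add, ENNReal.tsum_add]
        calc _ ≤ (L : ℝ≥0∞) + L + (L + L) := add_le_add (add_le_add (hrate h1) (hrate h2))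
              (add_le_add (hrate' h1 m₀) (hrate' h2 m₀))
          _ = 4 * L := by ring
      · rw [hgh]
        calc _ ≤ 3 * ((L : ℝ≥0∞) + L) * (4 * L) * h ^ 2 := by
              gcongr
              · exact hrate h1
              · exact hrate h2
          _ = _ := by ring
    · rw [hn36]
      refine le_trans (ENNReal.div_le_div_right ?_ _) (hQn.trans (min_le_right _ _))
      exact le_add_self.trans le_self_add
  refine ⟨fun ω => chain R (fun m => X m ω) S g (z, z') n, fun ω => chain_mem_E0 hq n, fun q => ?_,
    ?_, hdist⟩
  · have := measurableSet_chain_eq (R := R) (X := X) (S := S) hgm hq n q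
    rwa [hg0, hgn] at this
  · rw [← ENNReal.add_halves ε]
    refine le_trans (measure_mono ?_) ((measure_union_le _ _).trans (add_le_add hout hbad))
    intro ω hω
    by_contra hcon
    simp only [Set.mem_union, Set.mem_ofPred_eq, not_or, not_not, not_exists, not_and] at hcon
    refine hω ?_
    have := pairPath_chain hRnn hgm hcon.1 fun i hi hb =>
      hcon.2 i hi (chain_mem_of_le hi.le hcon.1) hb
    rwa [hg0, hgn] at this

end Approximation

/-! ### A discrete maximal inequality -/

section MaximalInequality

/-- The maximal inequality for nonnegative processes that grow at most by the factor `a` per step in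
conditional expectation. -/
lemma mul_measure_exists_lt_le {Ω : Type*} [mΩ : MeasurableSpace Ω] {P : Measure Ω}
    {𝒢 : ℕ → MeasurableSpace Ω} (hmono : Monotone 𝒢) (hle : ∀ i, 𝒢 i ≤ mΩ) {Y : ℕ → Ω → ℝ≥0∞}
    (hY : ∀ i, Measurable[𝒢 i] (Y i)) {a : ℝ≥0∞} (ha : 1 ≤ a)
    (hstep : ∀ i, ∀ G, MeasurableSet[𝒢 i] G →
      ∫⁻ ω in G, Y (i + 1) ω ∂P ≤ a * ∫⁻ ω in G, Y i ω ∂P) (A : ℝ≥0∞) (n : ℕ) :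
    A * P {ω | ∃ i ≤ n, A < Y i ω} ≤ a ^ n * ∫⁻ ω, Y 0 ω ∂P := by
  let E : ℕ → Set Ω := fun n => {ω | ∃ i ≤ n, A < Y i ω}
  have hlt : ∀ i, MeasurableSet[𝒢 i] {ω | A < Y i ω} := fun i =>
    measurableSet_lt (mδ := 𝒢 i) (@measurable_const _ _ _ (𝒢 i) A) (hY i)
  have hE : ∀ n, E n = ⋃ i ∈ Finset.range (n + 1), {ω | A < Y i ω} := by
    intro n; ext ω; simp [E]
  have hEm : ∀ n, MeasurableSet[𝒢 n] (E n) := by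
    intro n
    rw [hE]
    exact Finset.measurableSet_biUnion _ fun i hi =>
      hmono (Nat.lt_succ_iff.1 (Finset.mem_range.1 hi)) _ (hlt i)
  have hsucc : ∀ n, E (n + 1) = E n ∪ ((E n)ᶜ ∩ {ω | A < Y (n + 1) ω}) := by
    intro n
    ext ω
    by_cases h : ω ∈ E n
    · simp only [h, Set.mem_union, true_or, iff_true]
      obtain ⟨i, hi, h⟩ := h
      exact ⟨i, hi.trans n.le_succ, h⟩
    · simp only [Set.mem_union, h, false_or, Set.mem_inter_iff, Set.mem_compl_iff, not_false_eq_true,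
        true_and]
      constructor
      · rintro ⟨i, hi, h'⟩
        rcases Nat.lt_succ_iff_lt_or_eq.1 (Nat.lt_succ_of_le hi) with hlt | rfl
        · exact absurd ⟨i, Nat.lt_succ_iff.1 hlt, h'⟩ h
        · exact h'
      · intro h'
        exact ⟨n + 1, le_rfl, h'⟩
  -- The induction keeps two parts: paths that have exceeded `A` are charged `A` once and for all,
  -- the others retain their present value. A new crossing moves from the second part to the first,
  -- and `1 ≤ a` lets the first part carry the common factor.
  have key : ∀ n, A * P (E n) + ∫⁻ ω in (E n)ᶜ, Y n ω ∂P ≤ a ^ n * ∫⁻ ω, Y 0 ω ∂P := by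
    intro n
    induction n with
    | zero =>
      have h0 : MeasurableSet (E 0) := hle 0 _ (hEm 0)
      rw [pow_zero, one_mul, ← lintegral_add_compl (μ := P) (Y 0) h0]
      refine add_le_add ?_ (le_refl (∫⁻ ω in (E 0)ᶜ, Y 0 ω ∂P))
      rw [← setLIntegral_const]
      refine setLIntegral_mono_ae' h0 (ae_of_all _ fun ω hω => ?_)
      obtain ⟨i, hi, h⟩ := hω
      obtain rfl := Nat.le_zero.1 hi
      exact h.le
    | succ n ih =>
      have hEn : MeasurableSet (E n) := hle n _ (hEm n)
      have hB : MeasurableSet ((E n)ᶜ ∩ {ω | A < Y (n + 1) ω}) :=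
        hEn.compl.inter (hle _ _ (hlt (n + 1)))
      have h1 : (E n)ᶜ = ((E n)ᶜ ∩ {ω | A < Y (n + 1) ω}) ∪ (E (n + 1))ᶜ := by
        rw [hsucc]
        ext ω
        simp only [Set.mem_union, Set.mem_inter_iff, Set.mem_compl_iff]
        tauto
      have h2 : Disjoint ((E n)ᶜ ∩ {ω | A < Y (n + 1) ω}) (E (n + 1))ᶜ := by
        rw [Set.disjoint_compl_right_iff_subset, hsucc]
        exact Set.subset_union_right
      calc A * P (E (n + 1)) + ∫⁻ ω in (E (n + 1))ᶜ, Y (n + 1) ω ∂P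
          ≤ A * P (E n) + (A * P ((E n)ᶜ ∩ {ω | A < Y (n + 1) ω}) +
            ∫⁻ ω in (E (n + 1))ᶜ, Y (n + 1) ω ∂P) := by
            rw [← add_assoc, ← mul_add]
            gcongr
            rw [hsucc]
            exact measure_union_le _ _
        _ ≤ A * P (E n) + (∫⁻ ω in (E n)ᶜ ∩ {ω | A < Y (n + 1) ω}, Y (n + 1) ω ∂P +
            ∫⁻ ω in (E (n + 1))ᶜ, Y (n + 1) ω ∂P) := by
            refine add_le_add le_rfl (add_le_add ?_ le_rfl)
            rw [← setLIntegral_const]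
            exact setLIntegral_mono_ae' hB (ae_of_all _ fun ω hω => hω.2.le)
        _ = A * P (E n) + ∫⁻ ω in (E n)ᶜ, Y (n + 1) ω ∂P := by
            rw [← lintegral_union (hle _ _ (hEm (n + 1))).compl h2, ← h1]
        _ ≤ a * (A * P (E n)) + a * ∫⁻ ω in (E n)ᶜ, Y n ω ∂P := by
            refine add_le_add ?_ (hstep n _ (hEm n).compl)
            calc A * P (E n) = 1 * (A * P (E n)) := (one_mul _).symm
              _ ≤ _ := by gcongr
        _ ≤ a * (a ^ n * ∫⁻ ω, Y 0 ω ∂P) := by rw [← mul_add]; gcongr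
        _ = _ := by ring
  exact le_self_add.trans (key n)

end MaximalInequality

/-! ### Realizations with well-defined trajectories -/

section Regular

variable {V : Type*} {p : V → V → ℝ} {Fp Fm : ℕ → ℝ}

/-- A realization of the clocks for which all trajectories of the finite flow are well defined. -/
def Regular (R : Mark V → (V → ℕ) → ℝ) (X : Mark V → Set (ℝ × ℝ)) : Prop :=
  ∀ z ∈ E0 V, ∀ z' ∈ E0 V, ∀ t : ℝ≥0, ∃ w w', PairPath R X 0 t z z' w w'

lemma Regular.finiteFlow_mem {R : Mark V → (V → ℕ) → ℝ} {X : Mark V → Set (ℝ × ℝ)}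
    (h : Regular R X) (t : ℝ≥0) {z : V → ℕ} (hz : z ∈ E0 V) : finiteFlow R X 0 t z ∈ E0 V := by
  obtain ⟨w, w', hw⟩ := h z hz z hz t
  rw [hw.finiteFlow_left]
  exact (hw.mem (fun z hz => transition_mem_E0 hz) hz hz).1

lemma Regular.finiteFlow_mono {X : Mark V → Set (ℝ × ℝ)} (hp : IsTransitionKernel p)
    (h : Regular (rate p Fp Fm) X) (t : ℝ≥0) {z z' : V → ℕ} (hz : z ∈ E0 V) (hz' : z' ∈ E0 V)
    (hle : z ≤ z') :
    finiteFlow (rate p Fp Fm) X 0 t z ≤ finiteFlow (rate p Fp Fm) X 0 t z' := by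
  obtain ⟨w, w', hw⟩ := h z hz z' hz' t
  rw [hw.finiteFlow_left, hw.finiteFlow_right]
  exact hw.mono hp hle

lemma Regular.right_constant {R : Mark V → (V → ℕ) → ℝ} {X : Mark V → Set (ℝ × ℝ)}
    (h : Regular R X) (t : ℝ≥0) {z z' : V → ℕ} (hz : z ∈ E0 V) (hz' : z' ∈ E0 V) :
    ∃ r > t, ∀ q, t ≤ q → q < r → finiteFlow R X 0 q z = finiteFlow R X 0 t z ∧
      finiteFlow R X 0 q z' = finiteFlow R X 0 t z' := by
  obtain ⟨w, w', hw⟩ := h z hz z' hz' (t + 1)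
  obtain ⟨r, h1, -, h2⟩ := hw.right_constant zero_le (lt_add_one t)
  exact ⟨r, h1, h2⟩

lemma Regular.finiteFlow_zero {R : Mark V → (V → ℕ) → ℝ} {X : Mark V → Set (ℝ × ℝ)}
    (z : V → ℕ) : finiteFlow R X 0 0 z = z :=
  (PairPath.refl 0 z z).finiteFlow_left

end Regular

/-! ### The finite flow: expected distance, Markov property, maximal inequality -/

section FiniteFlow

variable {V Ω : Type*} [Countable V] {p : V → V → ℝ} {Fp Fm : ℕ → ℝ} {α : V → ℝ} {C : ℝ} {M : ℝ≥0}
  {X : Mark V → Ω → Set (ℝ × ℝ)} [MeasurableSpace Ω] {P : Measure Ω} [IsProbabilityMeasure P]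

/-- A sequence of approximations by countably-valued random elements that is eventually exact. -/
lemma exists_seq_pairPath (hp : IsTransitionKernel p) (hF : IsReactionPair Fp Fm)
    (hX : IsPoissonClocks X P) (hα : IsBoundedWeight p α C M)
    {s t : ℝ≥0} (hst : s ≤ t) {z z' : V → ℕ} (hz : z ∈ E0 V) (hz' : z' ∈ E0 V) :
    ∃ W : ℕ → Ω → (V → ℕ) × (V → ℕ), (∀ k ω, W k ω ∈ E0 V ×ˢ E0 V) ∧
      (∀ k q, MeasurableSet[regionSigma X (strip s t)] {ω | W k ω = q}) ∧
      (∀ᵐ ω ∂P, ∀ᶠ k in atTop,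
        PairPath (rate p Fp Fm) (fun m => X m ω) s t z z' (W k ω).1 (W k ω).2) ∧
      ∀ k, ∫⁻ ω, edistα α (W k ω).1 (W k ω).2 ∂P ≤
        ENNReal.ofReal (Real.exp (C * (t - s))) * edistα α z z' + 2⁻¹ ^ k := by
  choose W h1 h2 h3 h4 using fun k : ℕ => exists_discretization hp hF hX hα hst hz hz'
    (ε := 2⁻¹ ^ k) (pow_ne_zero k (by simp))
  refine ⟨W, h1, h2, ?_, h4⟩
  -- The error probabilities `2⁻¹ ^ k` are summable, so by Borel-Cantelli only finitely many
  -- approximations fail.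
  have hsum : ∑' k, P {ω | ¬ PairPath (rate p Fp Fm) (fun m => X m ω) s t z z'
      (W k ω).1 (W k ω).2} ≠ ∞ := by
    refine ne_top_of_le_ne_top ?_ (ENNReal.tsum_le_tsum h3)
    rw [ENNReal.tsum_geometric, ENNReal.one_sub_inv_two, inv_inv]
    exact ENNReal.ofNat_ne_top
  filter_upwards [ae_eventually_notMem hsum] with ω hω
  filter_upwards [hω] with k hk
  simpa using hk

lemma ae_exists_pairPath (hp : IsTransitionKernel p) (hF : IsReactionPair Fp Fm)
    (hX : IsPoissonClocks X P) {s t : ℝ≥0} (hst : s ≤ t) {z z' : V → ℕ} (hz : z ∈ E0 V)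
    (hz' : z' ∈ E0 V) :
    ∀ᵐ ω ∂P, ∃ w w', PairPath (rate p Fp Fm) (fun m => X m ω) s t z z' w w' := by
  obtain ⟨W, -, -, h, -⟩ := exists_seq_pairPath hp hF hX (isBoundedWeight_one hp) hst hz hz'
  filter_upwards [h] with ω hω
  obtain ⟨k, hk⟩ := hω.exists
  exact ⟨_, _, hk⟩

/-- The flow over `[s,t]` is determined by the clocks in `(s,t]`, up to null sets. -/
lemma exists_finiteFlow_version (hp : IsTransitionKernel p) (hF : IsReactionPair Fp Fm)
    (hX : IsPoissonClocks X P) {s t : ℝ≥0} (hst : s ≤ t) {z : V → ℕ} (hz : z ∈ E0 V) :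
    ∃ g : Ω → V → ℕ, (∀ ω, g ω ∈ E0 V) ∧
      (∀ q, MeasurableSet[regionSigma X (strip s t)] {ω | g ω = q}) ∧
      ∀ᵐ ω ∂P, finiteFlow (rate p Fp Fm) (fun m => X m ω) s t z = g ω := by
  classical
  obtain ⟨W, hW, hWm, hWp, -⟩ := exists_seq_pairPath hp hF hX (isBoundedWeight_one hp) hst hz hz
  have huniq : ∀ {ω q q'}, (∀ᶠ k in atTop, (W k ω).1 = q) → (∀ᶠ k in atTop, (W k ω).1 = q') →
      q = q' := fun h h' => by
    obtain ⟨k, h1, h2⟩ := (h.and h').exists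
    exact h1.symm.trans h2
  -- The eventual value of the approximations, hence measurable for the clocks in the strip; `z`
  -- serves as default where they do not stabilize.
  let g : Ω → V → ℕ := fun ω =>
    if h : ∃ q ∈ E0 V, ∀ᶠ k in atTop, (W k ω).1 = q then h.choose else z
  have hg : ∀ {ω q}, q ∈ E0 V → (∀ᶠ k in atTop, (W k ω).1 = q) → g ω = q := by
    intro ω q hq h
    have h' : ∃ q ∈ E0 V, ∀ᶠ k in atTop, (W k ω).1 = q := ⟨q, hq, h⟩
    simp only [g, dif_pos h']
    exact huniq h'.choose_spec.2 h
  have hgn : ∀ {ω}, (¬ ∃ q ∈ E0 V, ∀ᶠ k in atTop, (W k ω).1 = q) → g ω = z := fun h => dif_neg h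
  have hgE : ∀ ω, g ω ∈ E0 V := by
    intro ω
    by_cases h : ∃ q ∈ E0 V, ∀ᶠ k in atTop, (W k ω).1 = q
    · obtain ⟨q, hq, h⟩ := h
      rwa [hg hq h]
    · rwa [hgn h]
  refine ⟨g, hgE, fun q => ?_, ?_⟩
  · have hWm1 : ∀ k q, MeasurableSet[regionSigma X (strip s t)] {ω | (W k ω).1 = q} := by
      intro k q
      have : {ω | (W k ω).1 = q} = ⋃ v ∈ E0 V, {ω | W k ω = (q, v)} := by
        ext ω
        simp only [Set.mem_ofPred_eq, Set.mem_iUnion, exists_prop]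
        constructor
        · rintro rfl
          exact ⟨(W k ω).2, (hW k ω).2, rfl⟩
        · rintro ⟨v, -, h⟩
          rw [h]
      rw [this]
      exact MeasurableSet.biUnion E0_countable fun v _ => hWm k _
    have hev : ∀ q, MeasurableSet[regionSigma X (strip s t)] {ω | ∀ᶠ k in atTop, (W k ω).1 = q} := by
      intro q
      have : {ω | ∀ᶠ k in atTop, (W k ω).1 = q} = ⋃ N : ℕ, ⋂ k : ℕ, ⋂ _ : N ≤ k,
          {ω | (W k ω).1 = q} := by
        ext ω
        simp [eventually_atTop]
      rw [this]
      exact MeasurableSet.iUnion fun N => MeasurableSet.iInter fun k => MeasurableSet.iInter fun _ =>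
        hWm1 k q
    by_cases hq : q ∈ E0 V
    · have : {ω | g ω = q} = {ω | ∀ᶠ k in atTop, (W k ω).1 = q} ∪
          ({_ω | z = q} ∩ (⋃ v ∈ E0 V, {ω | ∀ᶠ k in atTop, (W k ω).1 = v})ᶜ) := by
        ext ω
        simp only [Set.mem_ofPred_eq, Set.mem_union, Set.mem_inter_iff, Set.mem_compl_iff,
          Set.mem_iUnion, exists_prop]
        constructor
        · intro h
          by_cases h' : ∃ q ∈ E0 V, ∀ᶠ k in atTop, (W k ω).1 = q
          · obtain ⟨v, hv, h'⟩ := h'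
            rw [hg hv h'] at h
            exact .inl (h ▸ h')
          · exact .inr ⟨(hgn h').symm.trans h, h'⟩
        · rintro (h | ⟨h1, h2⟩)
          · exact hg hq h
          · exact (hgn h2).trans h1
      rw [this]
      exact (hev q).union ((MeasurableSet.const _).inter
        (MeasurableSet.biUnion E0_countable fun v _ => hev v).compl)
    · have : {ω | g ω = q} = ∅ := by
        ext ω
        simp only [Set.mem_ofPred_eq, Set.mem_empty_iff_false, iff_false]
        exact fun h => hq (h ▸ hgE ω)
      rw [this]
      exact @MeasurableSet.empty _ (regionSigma X (strip s t))
  · filter_upwards [hWp] with ω hω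
    have h1 : ∀ᶠ k in atTop, (W k ω).1 = finiteFlow (rate p Fp Fm) (fun m => X m ω) s t z :=
      hω.mono fun k hk => hk.finiteFlow_left.symm
    obtain ⟨k, hk⟩ := h1.exists
    exact (hg (hk ▸ (hW k ω).1) h1).symm

/-- Fatou's lemma along approximations that are eventually exact and whose additive errors tend to
zero. -/
lemma lintegral_edistα_finiteFlow_le (hp : IsTransitionKernel p) (hF : IsReactionPair Fp Fm)
    (hX : IsPoissonClocks X P) (hα : IsBoundedWeight p α C M)
    {s t : ℝ≥0} (hst : s ≤ t) {z z' : V → ℕ} (hz : z ∈ E0 V) (hz' : z' ∈ E0 V) :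
    ∫⁻ ω, edistα α (finiteFlow (rate p Fp Fm) (fun m => X m ω) s t z)
        (finiteFlow (rate p Fp Fm) (fun m => X m ω) s t z') ∂P ≤
      ENNReal.ofReal (Real.exp (C * (t - s))) * edistα α z z' := by
  obtain ⟨W, hW, hWm, hWp, hWi⟩ := exists_seq_pairPath hp hF hX hα hst hz hz'
  calc _ = ∫⁻ ω, liminf (fun k => edistα α (W k ω).1 (W k ω).2) atTop ∂P := by
        refine lintegral_congr_ae ?_
        filter_upwards [hWp] with ω hω
        refine (Tendsto.liminf_eq (tendsto_const_nhds.congr' ?_)).symm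
        filter_upwards [hω] with k hk
        rw [hk.finiteFlow_left, hk.finiteFlow_right]
    _ ≤ liminf (fun k => ∫⁻ ω, edistα α (W k ω).1 (W k ω).2 ∂P) atTop :=
        lintegral_liminf_le fun k => measurable_comp_of_countable E0_prod_countable (hW k)
          (fun q _ => regionSigma_le hX _ _ (hWm k q)) fun q => edistα α q.1 q.2
    _ ≤ liminf (fun k : ℕ => ENNReal.ofReal (Real.exp (C * (t - s))) * edistα α z z' + 2⁻¹ ^ k)
          atTop := liminf_le_liminf (Eventually.of_forall hWi)
    _ = ENNReal.ofReal (Real.exp (C * (t - s))) * edistα α z z' := by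
        refine Tendsto.liminf_eq ?_
        have h := ENNReal.tendsto_pow_atTop_nhds_zero_of_lt_one (r := 2⁻¹)
          (ENNReal.inv_lt_one.2 ENNReal.one_lt_two)
        simpa using (tendsto_const_nhds (x := ENNReal.ofReal (Real.exp (C * (t - s))) *
          edistα α z z')).add h

/-- The Markov property, for the expected distance. -/
lemma setLIntegral_edistα_finiteFlow_le (hp : IsTransitionKernel p) (hF : IsReactionPair Fp Fm)
    (hX : IsPoissonClocks X P) (hα : IsBoundedWeight p α C M)
    {s t : ℝ≥0} (hst : s ≤ t) {z z' : V → ℕ} (hz : z ∈ E0 V) (hz' : z' ∈ E0 V) {G : Set Ω}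
    (hG : MeasurableSet[regionSigma X (strip 0 s)] G) :
    ∫⁻ ω in G, edistα α (finiteFlow (rate p Fp Fm) (fun m => X m ω) 0 t z)
        (finiteFlow (rate p Fp Fm) (fun m => X m ω) 0 t z') ∂P ≤
      ENNReal.ofReal (Real.exp (C * (t - s))) *
        ∫⁻ ω in G, edistα α (finiteFlow (rate p Fp Fm) (fun m => X m ω) 0 s z)
          (finiteFlow (rate p Fp Fm) (fun m => X m ω) 0 s z') ∂P := by
  have hv : ∀ v, v ∈ E0 V → ∃ g : Ω → V → ℕ, (∀ ω, g ω ∈ E0 V) ∧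
      (∀ q, MeasurableSet[regionSigma X (strip s t)] {ω | g ω = q}) ∧
      ∀ᵐ ω ∂P, finiteFlow (rate p Fp Fm) (fun m => X m ω) s t v = g ω := fun v hv =>
    exists_finiteFlow_version hp hF hX hst hv
  -- The flow over `[s,t]` and, below, the flow up to time `s` are replaced by versions measurable
  -- for their own strips. After the cocycle property the integrand is a function of the past and of
  -- independent clocks.
  choose! γ hγE hγm hγ using hv
  obtain ⟨g, hgE, hgm, hg⟩ := exists_finiteFlow_version hp hF hX (zero_le (a := s)) hz
  obtain ⟨g', hgE', hgm', hg'⟩ := exists_finiteFlow_version hp hF hX (zero_le (a := s)) hz'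
  rw [NNReal.coe_zero] at hgm hgm'
  have hγall : ∀ᵐ ω ∂P, ∀ v ∈ E0 V,
      finiteFlow (rate p Fp Fm) (fun m => X m ω) s t v = γ v ω :=
    (ae_ball_iff E0_countable).2 fun v hv => hγ v hv
  have hfm : ∀ q ∈ E0 V ×ˢ E0 V, MeasurableSet[regionSigma X (strip 0 s)]
      {ω | (g ω, g' ω) = q} := by
    intro q _
    have : {ω | (g ω, g' ω) = q} = {ω | g ω = q.1} ∩ {ω | g' ω = q.2} := by
      ext ω; simp [Prod.ext_iff]
    rw [this]
    exact (hgm _).inter (hgm' _)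
  have hgm2 : ∀ q ∈ E0 V ×ˢ E0 V,
      Measurable[regionSigma X (strip s t)] fun ω => edistα α (γ q.1 ω) (γ q.2 ω) := by
    intro q hq
    let _ := regionSigma X (strip s t)
    have h1 : ∀ ω, (fun ω => (γ q.1 ω, γ q.2 ω)) ω ∈ E0 V ×ˢ E0 V := fun ω =>
      ⟨hγE _ hq.1 ω, hγE _ hq.2 ω⟩
    refine measurable_comp_of_countable E0_prod_countable h1 (fun v _ => ?_)
      (fun q => edistα α q.1 q.2)
    have : {ω | (γ q.1 ω, γ q.2 ω) = v} = {ω | γ q.1 ω = v.1} ∩ {ω | γ q.2 ω = v.2} := by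
      ext ω; simp [Prod.ext_iff]
    rw [this]
    exact (hγm _ hq.1 _).inter (hγm _ hq.2 _)
  have hφ : ∀ q ∈ E0 V ×ˢ E0 V, ∫⁻ ω, edistα α (γ q.1 ω) (γ q.2 ω) ∂P ≤
      ENNReal.ofReal (Real.exp (C * (t - s))) * edistα α q.1 q.2 := by
    intro q hq
    refine le_trans (le_of_eq (lintegral_congr_ae ?_))
      (lintegral_edistα_finiteFlow_le hp hF hX hα hst hq.1 hq.2)
    filter_upwards [hγall] with ω hω
    rw [hω _ hq.1, hω _ hq.2]
  have hind := indep_regionSigma hX (disjoint_strip (a := 0) (b := (s : ℝ)) (c := (t : ℝ)))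
  have key : ∫⁻ ω in G, edistα α (γ (g ω) ω) (γ (g' ω) ω) ∂P ≤
      ∫⁻ ω in G, ENNReal.ofReal (Real.exp (C * (t - s))) * edistα α (g ω) (g' ω) ∂P :=
    setLIntegral_freeze_le (P := P) (m₁ := regionSigma X (strip 0 s))
      (m₂ := regionSigma X (strip s t)) (regionSigma_le hX _) (regionSigma_le hX _) hind
      E0_prod_countable (f := fun ω => (g ω, g' ω)) (fun ω => ⟨hgE ω, hgE' ω⟩) hfm
      (g := fun q ω => edistα α (γ q.1 ω) (γ q.2 ω)) hgm2
      (φ := fun q => ENNReal.ofReal (Real.exp (C * (t - s))) * edistα α q.1 q.2) hφ hG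
  rw [← lintegral_const_mul' _ _ ENNReal.ofReal_ne_top]
  refine le_trans (le_of_eq ?_) (key.trans (le_of_eq ?_))
  · refine lintegral_congr_ae (ae_restrict_of_ae ?_)
    filter_upwards [hg, hg', hγall, ae_exists_pairPath hp hF hX (zero_le (a := t)) hz hz']
      with ω h1 h2 h3 ⟨w, w', h4⟩
    rw [h4.finiteFlow_cocycle (zero_le (a := s)) hst, h4.swap.finiteFlow_cocycle (zero_le (a := s)) hst, h1, h2,
      h3 _ (hgE ω), h3 _ (hgE' ω)]
  · refine lintegral_congr_ae (ae_restrict_of_ae ?_)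
    filter_upwards [hg, hg'] with ω h1 h2
    rw [h1, h2]

/-- Countably many pairs and integer horizons yield one null set; restricting a path to a shorter
interval covers all other times. -/
lemma ae_regular (hp : IsTransitionKernel p) (hF : IsReactionPair Fp Fm)
    (hX : IsPoissonClocks X P) : ∀ᵐ ω ∂P, Regular (rate p Fp Fm) fun m => X m ω := by
  have h : ∀ᵐ ω ∂P, ∀ z ∈ E0 V, ∀ z' ∈ E0 V, ∀ N : ℕ, ∃ w w',
      PairPath (rate p Fp Fm) (fun m => X m ω) 0 N z z' w w' :=
    (ae_ball_iff E0_countable).2 fun z hz => (ae_ball_iff E0_countable).2 fun z' hz' =>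
      ae_all_iff.2 fun N => ae_exists_pairPath hp hF hX zero_le hz hz'
  filter_upwards [h] with ω hω z hz z' hz' t
  obtain ⟨N, hN⟩ := exists_nat_ge t
  obtain ⟨w, w', hw⟩ := hω z hz z' hz' N
  obtain ⟨v, v', h1, -⟩ := hw.split zero_le hN
  exact ⟨v, v', h1⟩

/-- The maximal inequality for the finite flow. -/
lemma measure_exists_lt_edistα_finiteFlow_le (hp : IsTransitionKernel p)
    (hF : IsReactionPair Fp Fm) (hX : IsPoissonClocks X P) (hα : IsBoundedWeight p α C M)
    {z z' : V → ℕ} (hz : z ∈ E0 V) (hz' : z' ∈ E0 V) (T : ℝ≥0) {A : ℝ≥0∞} (hA : A ≠ 0)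
    (hA' : A ≠ ∞) :
    P {ω | ∃ t ≤ T, A < edistα α (finiteFlow (rate p Fp Fm) (fun m => X m ω) 0 t z)
        (finiteFlow (rate p Fp Fm) (fun m => X m ω) 0 t z')} ≤
      ENNReal.ofReal (Real.exp (C * T)) * edistα α z z' / A := by
  set D : ℝ≥0 → Ω → ℝ≥0∞ := fun t ω =>
    edistα α (finiteFlow (rate p Fp Fm) (fun m => X m ω) 0 t z)
        (finiteFlow (rate p Fp Fm) (fun m => X m ω) 0 t z') with hD
  let E : ℕ → Set Ω := fun n => {ω | ∃ i : ℕ, i ≤ 2 ^ n ∧ A < D (i * (T / 2 ^ n)) ω}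
  have hpow : ∀ n : ℕ, (2 : ℝ≥0) ^ n ≠ 0 := fun n => pow_ne_zero n two_ne_zero
  have hEn : ∀ n, P (E n) ≤ ENNReal.ofReal (Real.exp (C * T)) * edistα α z z' / A := by
    intro n
    set δ : ℝ≥0 := T / 2 ^ n with hδ
    have hτ : ∀ i : ℕ, (i : ℝ≥0) * δ ≤ ((i + 1 : ℕ) : ℝ≥0) * δ := fun i => by
      gcongr; exact i.le_succ
    choose g hgE hgm hg using fun i : ℕ =>
      exists_finiteFlow_version hp hF hX (zero_le (a := i * δ)) hz
    choose g' hgE' hgm' hg' using fun i : ℕ =>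
      exists_finiteFlow_version hp hF hX (zero_le (a := i * δ)) hz'
    have hall : ∀ᵐ ω ∂P, ∀ i : ℕ, D (i * δ) ω = edistα α (g i ω) (g' i ω) :=
      ae_all_iff.2 fun i => by
        filter_upwards [hg i, hg' i] with ω h1 h2
        simp only [hD]
        rw [h1, h2]
    let 𝒢 : ℕ → MeasurableSpace Ω := fun i =>
      regionSigma X (strip ((0 : ℝ≥0) : ℝ) ((i * δ : ℝ≥0) : ℝ))
    have hmeas : ∀ i, Measurable[𝒢 i] fun ω => edistα α (g i ω) (g' i ω) := by
      intro i
      let _ := 𝒢 i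
      have h1 : ∀ ω, (fun ω => (g i ω, g' i ω)) ω ∈ E0 V ×ˢ E0 V := fun ω => ⟨hgE i ω, hgE' i ω⟩
      refine measurable_comp_of_countable E0_prod_countable h1 (fun v _ => ?_)
        (fun q => edistα α q.1 q.2)
      have : {ω | (g i ω, g' i ω) = v} = {ω | g i ω = v.1} ∩ {ω | g' i ω = v.2} := by
        ext ω; simp [Prod.ext_iff]
      rw [this]
      exact (hgm i _).inter (hgm' i _)
    have hstep : ∀ i, ∀ G, MeasurableSet[𝒢 i] G →
        ∫⁻ ω in G, edistα α (g (i + 1) ω) (g' (i + 1) ω) ∂P ≤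
          ENNReal.ofReal (Real.exp (C * δ)) * ∫⁻ ω in G, edistα α (g i ω) (g' i ω) ∂P := by
      intro i G hG
      have h1 := setLIntegral_edistα_finiteFlow_le hp hF hX hα (hτ i) hz hz' (G := G) hG
      have h2 : ((((i + 1 : ℕ) : ℝ≥0) * δ : ℝ≥0) : ℝ) - ((i : ℝ≥0) * δ : ℝ≥0) = δ := by
        push_cast; ring
      rw [h2] at h1
      refine le_trans (le_of_eq ?_) (h1.trans (le_of_eq ?_))
      · refine lintegral_congr_ae (ae_restrict_of_ae ?_)
        filter_upwards [hall] with ω hω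
        exact (hω (i + 1)).symm
      · congr 1
        refine lintegral_congr_ae (ae_restrict_of_ae ?_)
        filter_upwards [hall] with ω hω
        exact hω i
    have hmax := mul_measure_exists_lt_le (P := P) (𝒢 := 𝒢)
      (fun i j hij => regionSigma_mono X (strip_mono le_rfl (NNReal.coe_le_coe.2 (by gcongr))))
      (fun i => regionSigma_le hX _) hmeas (a := ENNReal.ofReal (Real.exp (C * δ)))
      (by rw [← ENNReal.ofReal_one]
          exact ENNReal.ofReal_le_ofReal (Real.one_le_exp
            (mul_nonneg hα.const_nonneg (NNReal.coe_nonneg _))))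
      hstep A (2 ^ n)
    have h0 : ∫⁻ ω, edistα α (g 0 ω) (g' 0 ω) ∂P = edistα α z z' := by
      calc _ = ∫⁻ _ω, edistα α z z' ∂P := by
            refine lintegral_congr_ae ?_
            filter_upwards [hall] with ω hω
            rw [← hω 0]
            simp only [hD, Nat.cast_zero, zero_mul, Regular.finiteFlow_zero]
        _ = _ := by simp
    have hexp : ENNReal.ofReal (Real.exp (C * δ)) ^ (2 ^ n) = ENNReal.ofReal (Real.exp (C * T)) := by
      rw [← ENNReal.ofReal_pow (Real.exp_pos _).le, ← Real.exp_nat_mul]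
      congr 2
      rw [hδ]
      push_cast
      field_simp
    rw [h0, hexp] at hmax
    rw [ENNReal.le_div_iff_mul_le (.inl hA) (.inl hA'), mul_comm]
    refine le_trans (le_of_eq ?_) hmax
    congr 1
    refine measure_congr ?_
    filter_upwards [hall] with ω hω
    refine propext ?_
    change (∃ i : ℕ, i ≤ 2 ^ n ∧ A < D (i * δ) ω) ↔
      ∃ i : ℕ, i ≤ 2 ^ n ∧ A < edistα α (g i ω) (g' i ω)
    exact exists_congr fun i => and_congr_right fun _ => by rw [hω i]
  have hmonoE : Monotone E := by
    refine monotone_nat_of_le_succ fun n => ?_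
    rintro ω ⟨i, hi, h⟩
    refine ⟨2 * i, by rw [pow_succ, mul_comm]; gcongr, ?_⟩
    have : ((2 * i : ℕ) : ℝ≥0) * (T / 2 ^ (n + 1)) = i * (T / 2 ^ n) := by
      push_cast
      rw [pow_succ]
      have := hpow n
      field_simp
    rwa [this]
  -- Trajectories are constant for a while to the right of `t`, so an exceedance at `t < T` persists
  -- until the next point of a fine enough dyadic grid. The endpoint `T` is a grid point already for
  -- `n = 0`.
  have hsub : ∀ᵐ ω ∂P, ω ∈ {ω | ∃ t ≤ T, A < D t ω} → ω ∈ ⋃ n, E n := by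
    filter_upwards [ae_regular hp hF hX] with ω hω
    rintro ⟨t, htT, hA⟩
    rcases htT.lt_or_eq with hlt | rfl
    · obtain ⟨r, htr, hr⟩ := hω.right_constant t hz hz'
      have hpos : 0 < T := (zero_le (a := t)).trans_lt hlt
      set r' := min r T
      have hr' : t < r' := lt_min htr hlt
      have hlim : Tendsto (fun n : ℕ => T / 2 ^ n) atTop (𝓝 0) := by
        have h := (NNReal.tendsto_pow_atTop_nhds_zero_of_lt_one (r := 2⁻¹)
          (by rw [inv_lt_one₀ two_pos]; exact one_lt_two)).const_mul T
        rw [mul_zero] at h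
        refine h.congr fun n => ?_
        rw [inv_pow, div_eq_mul_inv]
      obtain ⟨n, hn⟩ := (hlim.eventually_lt_const (tsub_pos_of_lt hr')).exists
      set δ := T / 2 ^ n with hδ
      have hδ0 : 0 < δ := div_pos hpos (pow_pos two_pos n)
      set i := ⌈t / δ⌉₊ with hi
      have h1 : t ≤ i * δ := by
        have := Nat.le_ceil (t / δ)
        rwa [div_le_iff₀ hδ0] at this
      have h2 : (i : ℝ≥0) * δ < r' := by
        have h3 : (i : ℝ≥0) < t / δ + 1 := Nat.ceil_lt_add_one zero_le
        calc (i : ℝ≥0) * δ < (t / δ + 1) * δ := by gcongr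
          _ = t + δ := by rw [add_mul, one_mul, div_mul_cancel₀ _ hδ0.ne']
          _ < t + (r' - t) := by gcongr
          _ = r' := add_tsub_cancel_of_le hr'.le
      refine Set.mem_iUnion.2 ⟨n, i, ?_, ?_⟩
      · have h3 : (i : ℝ≥0) * δ ≤ 2 ^ n * δ := by
          rw [hδ, mul_div_cancel₀ _ (hpow n)]
          exact (h2.trans_le (min_le_right _ _)).le
        exact_mod_cast le_of_mul_le_mul_right h3 hδ0
      · obtain ⟨e1, e2⟩ := hr _ h1 (h2.trans_le (min_le_left _ _))
        simp only [hD] at hA ⊢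
        rwa [e1, e2]
    · refine Set.mem_iUnion.2 ⟨0, 1, by simp, ?_⟩
      simpa using hA
  calc P {ω | ∃ t ≤ T, A < D t ω} ≤ P (⋃ n, E n) := measure_mono_ae hsub
    _ ≤ _ := by
      rw [hmonoE.measure_iUnion]
      exact iSup_le hEn

/-- The past of the flow is determined by the past of the clocks, up to null sets. -/
lemma flowSigma_le (hp : IsTransitionKernel p) (hF : IsReactionPair Fp Fm)
    (hX : IsPoissonClocks X P) (s : ℝ≥0) :
    flowSigma P (rate p Fp Fm) X s ≤ eventuallyMeasurableSpace (regionSigma X (strip 0 s)) (ae P) := by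
  refine sup_le ?_ (MeasurableSpace.generateFrom_le fun N hN => ?_)
  · refine iSup₂_le fun r hr => iSup₂_le fun z hz => ?_
    rintro _ ⟨B, hB, rfl⟩
    obtain ⟨g, hgE, hgm, hg⟩ := exists_finiteFlow_version hp hF hX (zero_le (a := r)) hz
    refine ⟨g ⁻¹' B, ?_, ?_⟩
    · have h1 : Measurable[regionSigma X (strip 0 s)] g := by
        refine @measurable_comp_of_countable _ _ _ (regionSigma X (strip 0 s)) _ _ E0_countable g hgE
          (fun q _ => ?_) id
        exact regionSigma_mono X (strip_mono NNReal.coe_zero.ge (NNReal.coe_le_coe.2 hr)) _ (hgm q)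
      exact h1 hB
    · filter_upwards [hg] with ω hω
      refine propext ?_
      change finiteFlow (rate p Fp Fm) (fun m => X m ω) 0 r z ∈ B ↔ g ω ∈ B
      rw [hω]
  · refine ⟨∅, @MeasurableSet.empty _ (regionSigma X (strip 0 s)), ?_⟩
    exact ae_eq_empty.2 hN

end FiniteFlow

/-! ### Convergence in the weighted distance -/

section Distance

variable {V : Type*} {α : V → ℝ}

/-- No summability is required: both a divergent real series and the real part of `∞` have the
default value `0`. -/
lemma distα_eq_toReal (hα : ∀ x, 0 ≤ α x) (z z' : V → ℕ) :
    distα α z z' = (edistα α z z').toReal := by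
  rw [edistα, ENNReal.tsum_toReal_eq fun _ => ENNReal.ofReal_ne_top]
  exact tsum_congr fun x => (ENNReal.toReal_ofReal (mul_nonneg (hα x) (abs_nonneg _))).symm

lemma mem_Eα_iff (hα : ∀ x, 0 ≤ α x) {z : V → ℕ} : z ∈ Eα α ↔ edistα α z 0 ≠ ∞ := by
  have h : ∀ x, α x * |(z x : ℝ) - ((0 : V → ℕ) x : ℝ)| = α x * z x := fun x => by simp
  simp only [edistα, h]
  constructor
  · exact fun hz => Summable.tsum_ofReal_ne_top hz
  · intro hz
    refine (ENNReal.summable_toReal hz).congr fun x => ?_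
    exact ENNReal.toReal_ofReal (mul_nonneg (hα x) (Nat.cast_nonneg _))

lemma edistα_ne_top_of_mem_Eα (hα : ∀ x, 0 ≤ α x) {z z' : V → ℕ} (hz : z ∈ Eα α) (hz' : z' ∈ Eα α) :
    edistα α z z' ≠ ∞ := by
  refine ne_top_of_le_ne_top (ENNReal.add_ne_top.2 ⟨(mem_Eα_iff hα).1 hz, ?_⟩)
    (edistα_triangle hα z 0 z')
  rw [edistα_comm]
  exact (mem_Eα_iff hα).1 hz'

lemma E0_subset_Eα (hα : ∀ x, 0 ≤ α x) : E0 V ⊆ Eα α := fun _ hz =>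
  (mem_Eα_iff hα).2 (edistα_ne_top hz zero_mem_E0)

lemma tendsto_distα_iff (hα : ∀ x, 0 ≤ α x) {u : ℕ → V → ℕ} {z : V → ℕ} (hu : ∀ n, u n ∈ Eα α)
    (hz : z ∈ Eα α) : Tendsto (fun n => distα α (u n) z) atTop (𝓝 0) ↔
      Tendsto (fun n => edistα α (u n) z) atTop (𝓝 0) := by
  simp only [distα_eq_toReal hα]
  exact ENNReal.tendsto_toReal_zero_iff fun n => edistα_ne_top_of_mem_Eα hα (hu n) hz

lemma edistα_le_edistα_of_le (hα : ∀ x, 0 ≤ α x) {z v w : V → ℕ} (h : z ≤ v) (h' : v ≤ w) :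
    edistα α z v ≤ edistα α z w := by
  refine ENNReal.tsum_le_tsum fun x => ENNReal.ofReal_le_ofReal
    (mul_le_mul_of_nonneg_left ?_ (hα x))
  have h1 : (z x : ℝ) ≤ v x := Nat.cast_le.2 (h x)
  have h2 : (v x : ℝ) ≤ w x := Nat.cast_le.2 (h' x)
  rw [abs_sub_comm, abs_of_nonneg (sub_nonneg.2 h1), abs_sub_comm,
    abs_of_nonneg (sub_nonneg.2 (h1.trans h2))]
  linarith

lemma tendsto_edistα_edistα (hα : ∀ x, 0 ≤ α x) {u u' : ℕ → V → ℕ} {z z' : V → ℕ}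
    (hz : z ∈ Eα α) (hz' : z' ∈ Eα α)
    (h : Tendsto (fun n => edistα α (u n) z) atTop (𝓝 0))
    (h' : Tendsto (fun n => edistα α (u' n) z') atTop (𝓝 0)) :
    Tendsto (fun n => edistα α (u n) (u' n)) atTop (𝓝 (edistα α z z')) := by
  rw [ENNReal.tendsto_nhds (edistα_ne_top_of_mem_Eα hα hz hz')]
  intro ε hε
  have hsum := h.add h'
  rw [add_zero] at hsum
  filter_upwards [hsum.eventually_le_const hε] with n hn
  constructor
  · rw [tsub_le_iff_right]
    calc edistα α z z' ≤ edistα α z (u n) + (edistα α (u n) (u' n) + edistα α (u' n) z') :=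
          (edistα_triangle hα _ (u n) _).trans (by gcongr; exact edistα_triangle hα _ _ _)
      _ = edistα α (u n) (u' n) + (edistα α (u n) z + edistα α (u' n) z') := by
          rw [edistα_comm α z]; ring
      _ ≤ _ := by gcongr
  · calc edistα α (u n) (u' n) ≤ edistα α (u n) z + (edistα α z z' + edistα α z' (u' n)) :=
          (edistα_triangle hα _ z _).trans (by gcongr; exact edistα_triangle hα _ _ _)
      _ = edistα α z z' + (edistα α (u n) z + edistα α (u' n) z') := by
          rw [edistα_comm α z']; ring
      _ ≤ _ := by gcongr

lemma tendsto_edistα_right (hα : ∀ x, 0 ≤ α x) {u : ℕ → V → ℕ} {v z : V → ℕ} (hv : v ∈ Eα α)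
    (hz : z ∈ Eα α) (h : Tendsto (fun n => edistα α (u n) z) atTop (𝓝 0)) :
    Tendsto (fun n => edistα α v (u n)) atTop (𝓝 (edistα α v z)) :=
  tendsto_edistα_edistα hα hv hz (by simp only [edistα_self]; exact tendsto_const_nhds) h

/-- Convergence in `‖·‖_α` implies that the occupation numbers are eventually constant. -/
lemma eventually_eq_of_tendsto_edistα (hα : ∀ x, 0 < α x) {u : ℕ → V → ℕ} {z : V → ℕ}
    (h : Tendsto (fun n => edistα α (u n) z) atTop (𝓝 0)) (x : V) : ∀ᶠ n in atTop, u n x = z x := by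
  filter_upwards [h.eventually_lt_const (ENNReal.ofReal_pos.2 (hα x))] with n hn
  have h1 : ENNReal.ofReal (α x * |(u n x : ℝ) - z x|) < ENNReal.ofReal (α x) :=
    (ENNReal.le_tsum x).trans_lt hn
  rw [ENNReal.ofReal_lt_ofReal_iff (hα x)] at h1
  have h2 : |(u n x : ℝ) - z x| < 1 := by
    rwa [mul_lt_iff_lt_one_right (hα x)] at h1
  have h3 : |(u n x : ℤ) - z x| < 1 := by exact_mod_cast h2
  have := Int.abs_lt_one_iff.1 h3
  omega

/-- Dominated convergence, with the summable bound `α x * z x`. -/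
lemma tendsto_edistα_of_le (hα : ∀ x, 0 ≤ α x) {u : ℕ → V → ℕ} {z : V → ℕ} (hz : z ∈ Eα α)
    (hle : ∀ n, u n ≤ z) (h : ∀ x, ∀ᶠ n in atTop, u n x = z x) :
    Tendsto (fun n => edistα α (u n) z) atTop (𝓝 0) := by
  have hb : ∀ n x, α x * |(u n x : ℝ) - z x| ≤ α x * z x := fun n x => by
    refine mul_le_mul_of_nonneg_left ?_ (hα x)
    have h1 : (u n x : ℝ) ≤ z x := Nat.cast_le.2 (hle n x)
    rw [abs_sub_comm, abs_of_nonneg (sub_nonneg.2 h1)]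
    linarith [Nat.cast_nonneg (α := ℝ) (u n x)]
  have hnn : ∀ n x, 0 ≤ α x * |(u n x : ℝ) - z x| := fun n x => mul_nonneg (hα x) (abs_nonneg _)
  have hlim : Tendsto (fun n => ∑' x, α x * |(u n x : ℝ) - z x|) atTop (𝓝 (∑' _ : V, (0 : ℝ))) := by
    refine tendsto_tsum_of_dominated_convergence (bound := fun x => α x * z x) hz (fun x => ?_)
      (Eventually.of_forall fun n x => ?_)
    · refine tendsto_const_nhds.congr' ?_
      filter_upwards [h x] with n hn
      simp [hn]
    · rw [Real.norm_of_nonneg (hnn n x)]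
      exact hb n x
  rw [tsum_zero] at hlim
  have h1 := ENNReal.tendsto_ofReal hlim
  rw [ENNReal.ofReal_zero] at h1
  refine h1.congr fun n => ?_
  rw [ENNReal.ofReal_tsum_of_nonneg (hnn n)
    (Summable.of_nonneg_of_le (hnn n) (hb n) hz)]
  rfl

/-- An increasing sequence that is bounded in `‖·‖_α` has a pointwise limit in `E_α`. -/
lemma exists_limit_of_monotone (hα : ∀ x, 0 < α x) {u : ℕ → V → ℕ} (hu : Monotone u) {K : ℝ≥0∞}
    (hK : K ≠ ∞) (hb : ∀ n, edistα α (u n) 0 ≤ K) :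
    ∃ z ∈ Eα α, ∀ x, ∀ᶠ n in atTop, u n x = z x := by
  have hbdd : ∀ x, BddAbove (Set.range fun n => u n x) := by
    intro x
    obtain ⟨k, hk⟩ := exists_nat_gt (K.toReal / α x)
    refine ⟨k, ?_⟩
    rintro _ ⟨n, rfl⟩
    have h1 : ENNReal.ofReal (α x * u n x) ≤ K := by
      refine le_trans (le_of_eq ?_) ((ENNReal.le_tsum x).trans (hb n))
      simp
    have h2 : α x * u n x ≤ K.toReal := (ENNReal.ofReal_le_iff_le_toReal hK).1 h1
    rw [div_lt_iff₀ (hα x)] at hk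
    have h3 : (u n x : ℝ) < k := by
      by_contra! h
      nlinarith [hα x]
    exact (Nat.cast_lt.1 h3).le
  have hev : ∀ x, ∀ᶠ n in atTop, u n x = ⨆ n, u n x := by
    intro x
    have h := tendsto_atTop_ciSup (fun i j hij => hu hij x : Monotone fun n => u n x) (hbdd x)
    rw [nhds_discrete, tendsto_pure] at h
    exact h
  refine ⟨fun x => ⨆ n, u n x, (mem_Eα_iff fun x => (hα x).le).2 (ne_top_of_le_ne_top hK ?_), hev⟩
  -- On a finite set of sites the limit coincides with some `u n`, so its partial sums inherit the
  -- bound `K`.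
  rw [edistα, ENNReal.tsum_eq_iSup_sum]
  refine iSup_le fun s => ?_
  obtain ⟨n, hn⟩ := ((eventually_all_finset s).2 fun x _ => hev x).exists
  refine le_trans ?_ (hb n)
  rw [Finset.sum_congr rfl fun x hx => by rw [← hn x hx]]
  exact ENNReal.sum_le_tsum s

/-- An injection of the sites into `ℕ` provides finite windows that increase to `V`; the sequence
cuts `z` off outside them. -/
lemma exists_monotone_seq_tendsto [Countable V] (hα : ∀ x, 0 ≤ α x) {z : V → ℕ} (hz : z ∈ Eα α) :
    ∃ e : ℕ → V → ℕ, (∀ n, e n ∈ E0 V) ∧ Monotone e ∧ (∀ n, e n ≤ z) ∧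
      Tendsto (fun n => edistα α (e n) z) atTop (𝓝 0) := by
  obtain ⟨f, hf⟩ := exists_injective_nat V
  have hle : ∀ n, (fun x => if f x < n then z x else 0) ≤ z := fun n x => by
    by_cases h : f x < n <;> simp [h]
  refine ⟨fun n x => if f x < n then z x else 0, fun n => ?_, fun i j hij x => ?_, hle,
    tendsto_edistα_of_le hα hz hle fun x => ?_⟩
  · rw [mem_E0_iff]
    refine ((Set.finite_Iio n).preimage hf.injOn).subset fun x hx => ?_
    by_contra h
    exact hx (if_neg h)
  · by_cases h : f x < i
    · simp [h, h.trans_le hij]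
    · simp [h]
  · filter_upwards [eventually_gt_atTop (f x)] with n hn
    simp [hn]

end Distance

/-! ### Existence and uniqueness of the limit that defines the flow -/

section FlowLimit

variable {V : Type*} {p : V → V → ℝ} {Fp Fm : ℕ → ℝ} {α : V → ℝ} {X : Mark V → Set (ℝ × ℝ)}

lemma le_of_monotone_of_eventually_eq {u : ℕ → V → ℕ} {z : V → ℕ} (hu : Monotone u)
    (h : ∀ x, ∀ᶠ n in atTop, u n x = z x) (n : ℕ) : u n ≤ z := fun x => by
  obtain ⟨k, h1, h2⟩ := ((h x).and (eventually_ge_atTop n)).exists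
  exact (hu h2 x).trans h1.le

/-- The flow of an increasing sequence of finite configurations that is bounded in `‖·‖_α` has a limit
that does not depend on the sequence. -/
lemma Regular.exists_isFlowLimit (h : Regular (rate p Fp Fm) X) (hp : IsTransitionKernel p)
    (hα : ∀ x, 0 < α x) {z : V → ℕ} (hz : z ∈ Eα α) {e : ℕ → V → ℕ} (he : ∀ n, e n ∈ E0 V)
    (hmono : Monotone e) (hlim : Tendsto (fun n => edistα α (e n) z) atTop (𝓝 0)) {t : ℝ≥0}
    {K : ℝ≥0∞} (hK : K ≠ ∞)
    (hb : ∀ n, edistα α (finiteFlow (rate p Fp Fm) X 0 t (e n)) 0 ≤ K) :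
    ∃ ξ, IsFlowLimit α (rate p Fp Fm) X t z ξ := by
  have hα' : ∀ x, 0 ≤ α x := fun x => (hα x).le
  have hflow : ∀ {e : ℕ → V → ℕ}, (∀ n, e n ∈ E0 V) → Monotone e →
      Monotone fun n => finiteFlow (rate p Fp Fm) X 0 t (e n) := fun he hmono i j hij =>
    h.finiteFlow_mono hp t (he i) (he j) (hmono hij)
  -- Two increasing sequences with the same limit interlace: `e n` has finite support, on which `e'`
  -- eventually equals `z`. By attractiveness their flows interlace as well and have the same limit.
  have hinter : ∀ {e e' : ℕ → V → ℕ}, (∀ n, e n ∈ E0 V) → Monotone e → Monotone e' →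
      (∀ x, ∀ᶠ n in atTop, e n x = z x) → (∀ x, ∀ᶠ n in atTop, e' n x = z x) →
      ∀ n, ∃ m, e n ≤ e' m := by
    intro e e' he hmono hmono' hlim hlim' n
    have hfin := mem_E0_iff.1 (he n)
    obtain ⟨m, hm⟩ := ((eventually_all_finset hfin.toFinset).2 fun x _ => hlim' x).exists
    refine ⟨m, fun x => ?_⟩
    by_cases hx : e n x = 0
    · rw [hx]; exact Nat.zero_le _
    · rw [hm x (hfin.mem_toFinset.2 hx)]
      exact le_of_monotone_of_eventually_eq hmono hlim n x
  obtain ⟨ξ, hξ, hξe⟩ := exists_limit_of_monotone hα (hflow he hmono) hK hb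
  have hle := le_of_monotone_of_eventually_eq (hflow he hmono) hξe
  have hpt := eventually_eq_of_tendsto_edistα hα hlim
  refine ⟨ξ, hξ, fun e' he' hmono' hlim' => ?_⟩
  rw [tendsto_distα_iff hα' (fun n => E0_subset_Eα hα' (he' n)) hz] at hlim'
  have hpt' := eventually_eq_of_tendsto_edistα hα hlim'
  have hle' : ∀ n, finiteFlow (rate p Fp Fm) X 0 t (e' n) ≤ ξ := by
    intro n
    obtain ⟨m, hm⟩ := hinter he' hmono' hmono hpt' hpt n
    exact (h.finiteFlow_mono hp t (he' n) (he m) hm).trans (hle m)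
  rw [tendsto_distα_iff hα' (fun n => E0_subset_Eα hα' (h.finiteFlow_mem t (he' n))) hξ]
  refine tendsto_edistα_of_le hα' hξ hle' fun x => ?_
  obtain ⟨n, hn⟩ := (hξe x).exists
  obtain ⟨m, hm⟩ := hinter he hmono hmono' hpt hpt' n
  filter_upwards [eventually_ge_atTop m] with k hk
  refine le_antisymm (hle' k x) ?_
  rw [← hn]
  exact (h.finiteFlow_mono hp t (he n) (he' m) hm x).trans (hflow he' hmono' hk x)

end FlowLimit

/-! ### Passage to the completed space -/

section Completion

lemma measurable_of_ae_eq {Ω β : Type*} {m mΩ : MeasurableSpace Ω} [MeasurableSpace β]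
    {P : Measure[mΩ] Ω} (hm : ∀ N, P N = 0 → MeasurableSet[m] N) {f g : Ω → β}
    (hg : Measurable[m] g) (h : f =ᵐ[P] g) : Measurable[m] f := by
  intro B hB
  have h0 : P {ω | f ω ≠ g ω} = 0 := h
  have : f ⁻¹' B = (g ⁻¹' B ∩ {ω | f ω ≠ g ω}ᶜ) ∪ (f ⁻¹' B ∩ {ω | f ω ≠ g ω}) := by
    ext ω
    by_cases hω : f ω = g ω <;> simp [hω]
  rw [this]
  exact ((hg hB).inter (hm _ h0).compl).union (hm _ (measure_mono_null Set.inter_subset_right h0))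

/-- The restriction of `Q` to the smaller σ-algebra is `P`, so integrals agree for a measurable
version of `f`. -/
lemma lintegral_eq_of_extension {Ω : Type*} {m₀ m : MeasurableSpace Ω} (hle : m₀ ≤ m)
    {P : Measure[m₀] Ω} {Q : Measure[m] Ω} (hQ : ∀ s, MeasurableSet[m₀] s → Q s = P s)
    {f : Ω → ℝ≥0∞} (hf : AEMeasurable[m₀] f P) : ∫⁻ ω, f ω ∂Q = @lintegral _ m₀ P f := by
  have htrim : Q.trim hle = P := by
    refine @Measure.ext _ m₀ _ _ fun s hs => ?_
    rw [trim_measurableSet_eq hle hs, hQ s hs]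
  subst htrim
  obtain ⟨g, hg, hfg⟩ := hf
  rw [lintegral_congr_ae hfg, lintegral_congr_ae (ae_eq_of_ae_eq_trim hfg), lintegral_trim hle hg]

end Completion

/-! ### From growth of set integrals to a supermartingale -/

section Supermartingale

/-- A nonnegative process whose set integrals grow at most at the exponential rate `C` becomes a
supermartingale after discounting at any larger rate. -/
lemma supermartingale_of_setLIntegral_le {Ω : Type*} {m : MeasurableSpace Ω} {Q : Measure Ω}
    [IsFiniteMeasure Q] {ℱ : Filtration ℝ≥0 m} {D : ℝ≥0 → Ω → ℝ≥0∞} {C C' : ℝ} (hC : C ≤ C')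
    (hD : ∀ t, Measurable[ℱ t] (D t)) (h0 : ∫⁻ ω, D 0 ω ∂Q ≠ ∞)
    (hstep : ∀ s t, s ≤ t → ∀ G, MeasurableSet[ℱ s] G →
      ∫⁻ ω in G, D t ω ∂Q ≤ ENNReal.ofReal (Real.exp (C * (t - s))) * ∫⁻ ω in G, D s ω ∂Q) :
    Supermartingale (fun (t : ℝ≥0) ω => Real.exp (-C' * t) * (D t ω).toReal) ℱ Q := by
  have hDm : ∀ t, Measurable (D t) := fun t => (hD t).mono (ℱ.le t) le_rfl
  have hfin : ∀ t, ∫⁻ ω, D t ω ∂Q ≠ ∞ := by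
    intro t
    have h := hstep 0 t zero_le Set.univ (@MeasurableSet.univ _ (ℱ 0))
    rw [setLIntegral_univ, setLIntegral_univ] at h
    exact ne_top_of_le_ne_top (ENNReal.mul_ne_top ENNReal.ofReal_ne_top h0) h
  have hint : ∀ t : ℝ≥0, Integrable (fun ω => Real.exp (-C' * t) * (D t ω).toReal) Q := fun t =>
    (integrable_toReal_of_lintegral_ne_top (hDm t).aemeasurable (hfin t)).const_mul _
  have hset : ∀ (t : ℝ≥0) (G : Set Ω), ∫ ω in G, Real.exp (-C' * t) * (D t ω).toReal ∂Q =
      Real.exp (-C' * t) * (∫⁻ ω in G, D t ω ∂Q).toReal := by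
    intro t G
    rw [integral_const_mul, integral_toReal (hDm t).aemeasurable.restrict
      (ae_restrict_of_ae (ae_lt_top (hDm t) (hfin t)))]
  -- The set-integral criterion is applied to the negated process, for which the inequality is that
  -- of a submartingale.
  have hneg : Submartingale (-fun (t : ℝ≥0) ω => Real.exp (-C' * t) * (D t ω).toReal) ℱ Q := by
    refine submartingale_of_setIntegral_le (fun t => ?_) (fun t => (hint t).neg) ?_
    · exact (((hD t).ennreal_toReal.const_mul (Real.exp (-C' * t))).neg).stronglyMeasurable
    · intro s t hst G hG
      simp only [Pi.neg_apply, integral_neg, neg_le_neg_iff]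
      rw [hset, hset]
      have hGs : ∫⁻ ω in G, D s ω ∂Q ≠ ∞ :=
        ne_top_of_le_ne_top (hfin s) (setLIntegral_le_lintegral _ _)
      have h1 := ENNReal.toReal_mono (ENNReal.mul_ne_top ENNReal.ofReal_ne_top hGs)
        (hstep s t hst G hG)
      rw [ENNReal.toReal_mul, ENNReal.toReal_ofReal (Real.exp_pos _).le] at h1
      calc Real.exp (-C' * t) * (∫⁻ ω in G, D t ω ∂Q).toReal
          ≤ Real.exp (-C' * t) * (Real.exp (C * (t - s)) * (∫⁻ ω in G, D s ω ∂Q).toReal) := by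
            gcongr
        _ = Real.exp (-C' * t + C * (t - s)) * (∫⁻ ω in G, D s ω ∂Q).toReal := by
            rw [Real.exp_add, mul_assoc]
        _ ≤ Real.exp (-C' * s) * (∫⁻ ω in G, D s ω ∂Q).toReal := by
            have hst' : (s : ℝ) ≤ t := NNReal.coe_le_coe.2 hst
            gcongr
            -- The exponents differ by `(C' - C) * (t - s) ≥ 0`.
            nlinarith
  have := hneg.neg
  rwa [neg_neg] at this

end Supermartingale

/-! ### Distances along convergent flows, and the flow at time zero -/

section FlowLimit

variable {V Ω : Type*} {p : V → V → ℝ} {Fp Fm : ℕ → ℝ} {α : V → ℝ} {C : ℝ}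
  {X : Mark V → Ω → Set (ℝ × ℝ)} [MeasurableSpace Ω] {P : Measure Ω}

lemma ae_tendsto_edistα_flow (hα : ∀ x, 0 ≤ α x) {e e' : ℕ → V → ℕ} {z z' : V → ℕ}
    (h : ∀ᵐ ω ∂P, ∀ t, flow α (rate p Fp Fm) (fun m => X m ω) t z ∈ Eα α ∧
        Tendsto (fun n => edistα α (finiteFlow (rate p Fp Fm) (fun m => X m ω) 0 t (e n))
          (flow α (rate p Fp Fm) (fun m => X m ω) t z)) atTop (𝓝 0))
    (h' : ∀ᵐ ω ∂P, ∀ t, flow α (rate p Fp Fm) (fun m => X m ω) t z' ∈ Eα α ∧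
        Tendsto (fun n => edistα α (finiteFlow (rate p Fp Fm) (fun m => X m ω) 0 t (e' n))
          (flow α (rate p Fp Fm) (fun m => X m ω) t z')) atTop (𝓝 0)) :
    ∀ᵐ ω ∂P, ∀ t, Tendsto (fun n => edistα α (finiteFlow (rate p Fp Fm) (fun m => X m ω) 0 t (e n))
        (finiteFlow (rate p Fp Fm) (fun m => X m ω) 0 t (e' n))) atTop
      (𝓝 (edistα α (flow α (rate p Fp Fm) (fun m => X m ω) t z)
        (flow α (rate p Fp Fm) (fun m => X m ω) t z'))) := by
  filter_upwards [h, h'] with ω h1 h2 t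
  exact tendsto_edistα_edistα hα (h1 t).1 (h2 t).1 (h1 t).2 (h2 t).2

/-- The finite flow at time `0` is the identity, so the flow and `z` are limits of the same
sequence, and convergence fixes every coordinate. -/
lemma flow_zero_eq [Countable V] {z : V → ℕ} (hα : IsLocalization p α C) (hz : z ∈ Eα α) {X : Mark V → Set (ℝ × ℝ)}
    (h : IsFlowLimit α (rate p Fp Fm) X 0 z (flow α (rate p Fp Fm) X 0 z)) :
    flow α (rate p Fp Fm) X 0 z = z := by
  have hα' : ∀ x, 0 ≤ α x := fun x => (hα.pos x).le
  obtain ⟨e, he, hmono, -, hlim⟩ := exists_monotone_seq_tendsto hα' hz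
  have he' : ∀ n, e n ∈ Eα α := fun n => E0_subset_Eα hα' (he n)
  have h1 := h.2 e he hmono ((tendsto_distα_iff hα' he' hz).2 hlim)
  simp only [Regular.finiteFlow_zero] at h1
  rw [tendsto_distα_iff hα' he' h.1] at h1
  ext x
  obtain ⟨n, h2, h3⟩ := ((eventually_eq_of_tendsto_edistα hα.pos h1 x).and
    (eventually_eq_of_tendsto_edistα hα.pos hlim x)).exists
  exact h2.symm.trans h3

end FlowLimit

/-! ### The flow on `E_α`: existence, Markov property, maximal inequality -/

section Limit

variable {V Ω : Type*} [Countable V] {p : V → V → ℝ} {Fp Fm : ℕ → ℝ} {α : V → ℝ} {C : ℝ} {M : ℝ≥0}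
  {X : Mark V → Ω → Set (ℝ × ℝ)} [MeasurableSpace Ω] {P : Measure Ω} [IsProbabilityMeasure P]

lemma aemeasurable_edistα_finiteFlow (hp : IsTransitionKernel p) (hF : IsReactionPair Fp Fm)
    (hX : IsPoissonClocks X P) (t : ℝ≥0) {z z' : V → ℕ} (hz : z ∈ E0 V) (hz' : z' ∈ E0 V) :
    AEMeasurable (fun ω => edistα α (finiteFlow (rate p Fp Fm) (fun m => X m ω) 0 t z)
      (finiteFlow (rate p Fp Fm) (fun m => X m ω) 0 t z')) P := by
  obtain ⟨g, hgE, hgm, hg⟩ := exists_finiteFlow_version hp hF hX (zero_le (a := t)) hz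
  obtain ⟨g', hgE', hgm', hg'⟩ := exists_finiteFlow_version hp hF hX (zero_le (a := t)) hz'
  refine ⟨fun ω => edistα α (g ω) (g' ω), ?_, ?_⟩
  · have h1 : ∀ ω, (fun ω => (g ω, g' ω)) ω ∈ E0 V ×ˢ E0 V := fun ω => ⟨hgE ω, hgE' ω⟩
    refine measurable_comp_of_countable E0_prod_countable h1 (fun v _ => ?_)
      (fun q => edistα α q.1 q.2)
    have : {ω | (g ω, g' ω) = v} = {ω | g ω = v.1} ∩ {ω | g' ω = v.2} := by
      ext ω; simp [Prod.ext_iff]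
    rw [this]
    exact (regionSigma_le hX _ _ (hgm _)).inter (regionSigma_le hX _ _ (hgm' _))
  · filter_upwards [hg, hg'] with ω h1 h2
    rw [h1, h2]

/-- Almost surely, the flow of an increasing sequence of finite configurations below an element of
`E_α` is bounded in `‖·‖_α`, at all times. -/
lemma ae_exists_edistα_finiteFlow_le (hp : IsTransitionKernel p) (hF : IsReactionPair Fp Fm)
    (hX : IsPoissonClocks X P) (hα : IsBoundedWeight p α C M) {z : V → ℕ} (hz : z ∈ Eα α)
    {e : ℕ → V → ℕ} (he : ∀ n, e n ∈ E0 V) (hmono : Monotone e) (hle : ∀ n, e n ≤ z) :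
    ∀ᵐ ω ∂P, ∀ t : ℝ≥0, ∃ K : ℝ≥0∞, K ≠ ∞ ∧ ∀ n,
      edistα α (finiteFlow (rate p Fp Fm) (fun m => X m ω) 0 t (e n)) 0 ≤ K := by
  -- Distances are taken to the trajectory from `0`, so they increase with `n` on regular
  -- realizations and one application of continuity from below treats all `n`. The threshold `A + 1`
  -- is never zero, as the maximal inequality requires.
  let B : ℕ → ℕ → ℕ → Set Ω := fun N A n => {ω | Regular (rate p Fp Fm) (fun m => X m ω) ∧
    ∃ t : ℝ≥0, t ≤ N ∧ (A + 1 : ℝ≥0∞) < edistα α (finiteFlow (rate p Fp Fm) (fun m => X m ω) 0 t (e n))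
      (finiteFlow (rate p Fp Fm) (fun m => X m ω) 0 t 0)}
  have hBmono : ∀ N A, Monotone (B N A) := by
    rintro N A i j hij ω ⟨hω, t, ht, h⟩
    refine ⟨hω, t, ht, h.trans_le ?_⟩
    rw [edistα_comm α _ (finiteFlow _ _ _ _ 0), edistα_comm α _ (finiteFlow _ _ _ _ 0)]
    exact edistα_le_edistα_of_le hα.nonneg
      (hω.finiteFlow_mono hp t zero_mem_E0 (he i) fun _ => Nat.zero_le _)
      (hω.finiteFlow_mono hp t (he i) (he j) (hmono hij))
  have hB : ∀ N A, P (⋃ n, B N A n) ≤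
      ENNReal.ofReal (Real.exp (C * N)) * edistα α z 0 / (A + 1) := by
    intro N A
    rw [(hBmono N A).measure_iUnion]
    refine iSup_le fun n => ?_
    refine (measure_mono fun ω hω => hω.2).trans
      ((measure_exists_lt_edistα_finiteFlow_le hp hF hX hα (he n) zero_mem_E0 N (by simp)
        (by finiteness)).trans ?_)
    rw [edistα_comm, edistα_comm α z, NNReal.coe_natCast]
    gcongr
    exact edistα_le_edistα_of_le hα.nonneg (fun _ => Nat.zero_le _) (hle n)
  have hzero : ∀ N, P (⋂ A, ⋃ n, B N A n) = 0 := by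
    intro N
    set c := ENNReal.ofReal (Real.exp (C * N)) * edistα α z 0
    have hc : c ≠ ∞ := ENNReal.mul_ne_top ENNReal.ofReal_ne_top ((mem_Eα_iff hα.nonneg).1 hz)
    have hlim : Tendsto (fun A : ℕ => c / (A + 1 : ℝ≥0∞)) atTop (𝓝 0) := by
      have h := ENNReal.Tendsto.const_div (a := c)
        ((tendsto_add_atTop_iff_nat 1).2 ENNReal.tendsto_nat_nhds_top) (.inr hc)
      rw [ENNReal.div_top] at h
      simpa using h
    exact le_antisymm (ge_of_tendsto' hlim fun A =>
      (measure_mono (Set.iInter_subset _ A)).trans (hB N A)) zero_le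
  filter_upwards [ae_regular hp hF hX, ae_all_iff.2 fun N => measure_eq_zero_iff_ae_notMem.1 (hzero N)]
    with ω hω hω' t
  obtain ⟨N, hN⟩ := exists_nat_ge t
  have h := hω' N
  simp only [Set.mem_iInter, not_forall] at h
  obtain ⟨A, hA⟩ := h
  refine ⟨(A + 1) + edistα α (finiteFlow (rate p Fp Fm) (fun m => X m ω) 0 t 0) 0, ?_, fun n => ?_⟩
  · exact ENNReal.add_ne_top.2 ⟨by finiteness,
      edistα_ne_top (hω.finiteFlow_mem t zero_mem_E0) zero_mem_E0⟩
  · refine (edistα_triangle hα.nonneg _ (finiteFlow (rate p Fp Fm) (fun m => X m ω) 0 t 0) _).trans ?_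
    gcongr
    by_contra! hlt
    exact hA (Set.mem_iUnion.2 ⟨n, hω, t, hN, hlt⟩)

/-- Almost surely, the flow from a configuration in `E_α` is well defined at all times. -/
lemma ae_isFlowLimit_flow (hp : IsTransitionKernel p) (hα : IsLocalization p α C)
    (hF : IsReactionPair Fp Fm) (hX : IsPoissonClocks X P) {z : V → ℕ} (hz : z ∈ Eα α) :
    ∀ᵐ ω ∂P, ∀ t, IsFlowLimit α (rate p Fp Fm) (fun m => X m ω) t z
      (flow α (rate p Fp Fm) (fun m => X m ω) t z) := by
  obtain ⟨M, hM⟩ := hα.exists_isBoundedWeight hp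
  obtain ⟨e, he, hmono, hle, hlim⟩ := exists_monotone_seq_tendsto hM.nonneg hz
  filter_upwards [ae_regular hp hF hX, ae_exists_edistα_finiteFlow_le hp hF hX hM hz he hmono hle]
    with ω hω hω' t
  obtain ⟨K, hK, hb⟩ := hω' t
  have h := hω.exists_isFlowLimit hp hα.pos hz he hmono hlim hK hb
  rw [flow, dif_pos h]
  exact h.choose_spec

/-- An increasing sequence of finite configurations along which the flow converges at all times,
almost surely. -/
lemma exists_seq_tendsto_flow (hp : IsTransitionKernel p) (hα : IsLocalization p α C)
    (hF : IsReactionPair Fp Fm) (hX : IsPoissonClocks X P) {z : V → ℕ} (hz : z ∈ Eα α) :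
    ∃ e : ℕ → V → ℕ, (∀ n, e n ∈ E0 V) ∧ Tendsto (fun n => edistα α (e n) z) atTop (𝓝 0) ∧
      ∀ᵐ ω ∂P, ∀ t, flow α (rate p Fp Fm) (fun m => X m ω) t z ∈ Eα α ∧
        Tendsto (fun n => edistα α (finiteFlow (rate p Fp Fm) (fun m => X m ω) 0 t (e n))
          (flow α (rate p Fp Fm) (fun m => X m ω) t z)) atTop (𝓝 0) := by
  have hα' : ∀ x, 0 ≤ α x := fun x => (hα.pos x).le
  obtain ⟨e, he, hmono, hle, hlim⟩ := exists_monotone_seq_tendsto hα' hz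
  refine ⟨e, he, hlim, ?_⟩
  filter_upwards [ae_regular hp hF hX, ae_isFlowLimit_flow hp hα hF hX hz] with ω hω hω' t
  have h := (hω' t).2 e he hmono
    ((tendsto_distα_iff hα' (fun n => E0_subset_Eα hα' (he n)) hz).2 hlim)
  exact ⟨(hω' t).1, (tendsto_distα_iff hα' (fun n => E0_subset_Eα hα'
    (hω.finiteFlow_mem t (he n))) (hω' t).1).1 h⟩

variable {e e' : ℕ → V → ℕ} {z z' : V → ℕ}

/-- Fatou's lemma as the second finite configuration runs through the sequence. This quantifies, in
mean, the convergence of the flow. -/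
lemma lintegral_edistα_finiteFlow_flow_le (hp : IsTransitionKernel p) (hF : IsReactionPair Fp Fm)
    (hX : IsPoissonClocks X P) (hα : IsBoundedWeight p α C M) (hz : z ∈ Eα α)
    (he : ∀ n, e n ∈ E0 V) (hlim : Tendsto (fun n => edistα α (e n) z) atTop (𝓝 0))
    (h : ∀ᵐ ω ∂P, ∀ t, flow α (rate p Fp Fm) (fun m => X m ω) t z ∈ Eα α ∧
        Tendsto (fun n => edistα α (finiteFlow (rate p Fp Fm) (fun m => X m ω) 0 t (e n))
          (flow α (rate p Fp Fm) (fun m => X m ω) t z)) atTop (𝓝 0)) (t : ℝ≥0) (n : ℕ) :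
    ∫⁻ ω, edistα α (finiteFlow (rate p Fp Fm) (fun m => X m ω) 0 t (e n))
        (flow α (rate p Fp Fm) (fun m => X m ω) t z) ∂P ≤
      ENNReal.ofReal (Real.exp (C * t)) * edistα α (e n) z := by
  calc _ = ∫⁻ ω, liminf (fun k => edistα α (finiteFlow (rate p Fp Fm) (fun m => X m ω) 0 t (e n))
        (finiteFlow (rate p Fp Fm) (fun m => X m ω) 0 t (e k))) atTop ∂P := by
        refine lintegral_congr_ae ?_
        filter_upwards [ae_regular hp hF hX, h] with ω hω h1
        exact (tendsto_edistα_right hα.nonneg (E0_subset_Eα hα.nonneg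
          (hω.finiteFlow_mem t (he n))) (h1 t).1 (h1 t).2).liminf_eq.symm
    _ ≤ liminf (fun k => ∫⁻ ω, edistα α (finiteFlow (rate p Fp Fm) (fun m => X m ω) 0 t (e n))
        (finiteFlow (rate p Fp Fm) (fun m => X m ω) 0 t (e k)) ∂P) atTop :=
        lintegral_liminf_le' fun k => aemeasurable_edistα_finiteFlow hp hF hX t (he n) (he k)
    _ ≤ liminf (fun k => ENNReal.ofReal (Real.exp (C * t)) * edistα α (e n) (e k)) atTop := by
        refine liminf_le_liminf (Eventually.of_forall fun k => ?_)
        have := lintegral_edistα_finiteFlow_le hp hF hX hα (zero_le (a := t)) (he n) (he k)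
        rwa [NNReal.coe_zero, sub_zero] at this
    _ = _ := (ENNReal.Tendsto.const_mul (tendsto_edistα_right hα.nonneg
        (E0_subset_Eα hα.nonneg (he n)) hz hlim) (.inr ENNReal.ofReal_ne_top)).liminf_eq

/-- The Markov property for the expected distance, for the flow on `E_α`. -/
lemma setLIntegral_edistα_flow_le (hp : IsTransitionKernel p) (hα : IsLocalization p α C)
    (hF : IsReactionPair Fp Fm) (hX : IsPoissonClocks X P) (hz : z ∈ Eα α) (hz' : z' ∈ Eα α)
    {s t : ℝ≥0} (hst : s ≤ t) {G : Set Ω} (hG : MeasurableSet[regionSigma X (strip 0 s)] G) :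
    ∫⁻ ω in G, edistα α (flow α (rate p Fp Fm) (fun m => X m ω) t z)
        (flow α (rate p Fp Fm) (fun m => X m ω) t z') ∂P ≤
      ENNReal.ofReal (Real.exp (C * (t - s))) *
        ∫⁻ ω in G, edistα α (flow α (rate p Fp Fm) (fun m => X m ω) s z)
          (flow α (rate p Fp Fm) (fun m => X m ω) s z') ∂P := by
  obtain ⟨M, hM⟩ := hα.exists_isBoundedWeight hp
  obtain ⟨e, he, hlim, h⟩ := exists_seq_tendsto_flow hp hα hF hX hz
  obtain ⟨e', he', hlim', h'⟩ := exists_seq_tendsto_flow hp hα hF hX hz'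
  have htend := ae_tendsto_edistα_flow hM.nonneg h h'
  have hmeas : ∀ t n, AEMeasurable (fun ω =>
      edistα α (finiteFlow (rate p Fp Fm) (fun m => X m ω) 0 t (e n))
        (finiteFlow (rate p Fp Fm) (fun m => X m ω) 0 t (e' n))) P := fun t n =>
    aemeasurable_edistα_finiteFlow hp hF hX t (he n) (he' n)
  have hmeasD : AEMeasurable (fun ω => edistα α (flow α (rate p Fp Fm) (fun m => X m ω) s z)
      (flow α (rate p Fp Fm) (fun m => X m ω) s z')) P :=
    aemeasurable_of_tendsto_metrizable_ae atTop (hmeas s) (htend.mono fun ω hω => hω s)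
  -- Fatou's lemma suffices at time `t`, but at time `s` the opposite inequality is needed. It comes
  -- from the triangle inequality, with errors that vanish in mean.
  have hupper : ∀ n, ∫⁻ ω in G, edistα α (finiteFlow (rate p Fp Fm) (fun m => X m ω) 0 s (e n))
        (finiteFlow (rate p Fp Fm) (fun m => X m ω) 0 s (e' n)) ∂P ≤
      ∫⁻ ω in G, edistα α (flow α (rate p Fp Fm) (fun m => X m ω) s z)
          (flow α (rate p Fp Fm) (fun m => X m ω) s z') ∂P +
        (ENNReal.ofReal (Real.exp (C * s)) * edistα α (e n) z +
          ENNReal.ofReal (Real.exp (C * s)) * edistα α (e' n) z') := by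
    intro n
    have hm1 : ∀ {e : ℕ → V → ℕ} {z : V → ℕ}, (∀ n, e n ∈ E0 V) →
        (∀ᵐ ω ∂P, ∀ t, flow α (rate p Fp Fm) (fun m => X m ω) t z ∈ Eα α ∧
        Tendsto (fun n => edistα α (finiteFlow (rate p Fp Fm) (fun m => X m ω) 0 t (e n))
          (flow α (rate p Fp Fm) (fun m => X m ω) t z)) atTop (𝓝 0)) →
        AEMeasurable (fun ω => edistα α (finiteFlow (rate p Fp Fm) (fun m => X m ω) 0 s (e n))
          (flow α (rate p Fp Fm) (fun m => X m ω) s z)) P := by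
      intro e z he h
      refine aemeasurable_of_tendsto_metrizable_ae atTop
        (fun k => aemeasurable_edistα_finiteFlow (α := α) hp hF hX s (he n) (he k)) ?_
      filter_upwards [ae_regular hp hF hX, h] with ω hω h1
      exact tendsto_edistα_right hM.nonneg (E0_subset_Eα hM.nonneg
          (hω.finiteFlow_mem s (he n))) (h1 s).1 (h1 s).2
    calc _ ≤ ∫⁻ ω in G, (edistα α (flow α (rate p Fp Fm) (fun m => X m ω) s z)
          (flow α (rate p Fp Fm) (fun m => X m ω) s z') +
          (edistα α (finiteFlow (rate p Fp Fm) (fun m => X m ω) 0 s (e n))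
            (flow α (rate p Fp Fm) (fun m => X m ω) s z) +
          edistα α (finiteFlow (rate p Fp Fm) (fun m => X m ω) 0 s (e' n))
            (flow α (rate p Fp Fm) (fun m => X m ω) s z'))) ∂P := by
          refine lintegral_mono fun ω => ?_
          set a := finiteFlow (rate p Fp Fm) (fun m => X m ω) 0 s (e n)
          set b := finiteFlow (rate p Fp Fm) (fun m => X m ω) 0 s (e' n)
          set a' := flow α (rate p Fp Fm) (fun m => X m ω) s z
          set b' := flow α (rate p Fp Fm) (fun m => X m ω) s z'
          calc edistα α a b ≤ edistα α a a' + (edistα α a' b' + edistα α b' b) :=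
                (edistα_triangle hM.nonneg _ a' _).trans
                  (by gcongr; exact edistα_triangle hM.nonneg _ _ _)
            _ = _ := by rw [edistα_comm α b']; ring
      _ = ∫⁻ ω in G, edistα α (flow α (rate p Fp Fm) (fun m => X m ω) s z)
          (flow α (rate p Fp Fm) (fun m => X m ω) s z') ∂P +
          (∫⁻ ω in G, edistα α (finiteFlow (rate p Fp Fm) (fun m => X m ω) 0 s (e n))
            (flow α (rate p Fp Fm) (fun m => X m ω) s z) ∂P +
          ∫⁻ ω in G, edistα α (finiteFlow (rate p Fp Fm) (fun m => X m ω) 0 s (e' n))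
            (flow α (rate p Fp Fm) (fun m => X m ω) s z') ∂P) := by
          rw [lintegral_add_left' hmeasD.restrict, lintegral_add_left' (hm1 he h).restrict]
      _ ≤ _ := by
          refine add_le_add le_rfl (add_le_add ?_ ?_)
          · exact (setLIntegral_le_lintegral _ _).trans
              (lintegral_edistα_finiteFlow_flow_le hp hF hX hM hz he hlim h s n)
          · exact (setLIntegral_le_lintegral _ _).trans
              (lintegral_edistα_finiteFlow_flow_le hp hF hX hM hz' he' hlim' h' s n)
  have hlim0 : Tendsto (fun n => ENNReal.ofReal (Real.exp (C * s)) * edistα α (e n) z +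
          ENNReal.ofReal (Real.exp (C * s)) * edistα α (e' n) z') atTop (𝓝 0) := by
    have h1 := (ENNReal.Tendsto.const_mul hlim (.inr (ENNReal.ofReal_ne_top (r := Real.exp (C * s))))).add
      (ENNReal.Tendsto.const_mul hlim' (.inr (ENNReal.ofReal_ne_top (r := Real.exp (C * s)))))
    simpa using h1
  calc _ = ∫⁻ ω in G, liminf (fun n => edistα α
        (finiteFlow (rate p Fp Fm) (fun m => X m ω) 0 t (e n))
        (finiteFlow (rate p Fp Fm) (fun m => X m ω) 0 t (e' n))) atTop ∂P := by
        refine lintegral_congr_ae (ae_restrict_of_ae ?_)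
        filter_upwards [htend] with ω hω
        exact (hω t).liminf_eq.symm
    _ ≤ liminf (fun n => ∫⁻ ω in G, edistα α
        (finiteFlow (rate p Fp Fm) (fun m => X m ω) 0 t (e n))
        (finiteFlow (rate p Fp Fm) (fun m => X m ω) 0 t (e' n)) ∂P) atTop :=
        lintegral_liminf_le' fun n => (hmeas t n).restrict
    _ ≤ liminf (fun n => ENNReal.ofReal (Real.exp (C * (t - s))) *
        (∫⁻ ω in G, edistα α (flow α (rate p Fp Fm) (fun m => X m ω) s z)
          (flow α (rate p Fp Fm) (fun m => X m ω) s z') ∂P +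
        (ENNReal.ofReal (Real.exp (C * s)) * edistα α (e n) z +
          ENNReal.ofReal (Real.exp (C * s)) * edistα α (e' n) z'))) atTop := by
        refine liminf_le_liminf (Eventually.of_forall fun n => ?_)
        refine (setLIntegral_edistα_finiteFlow_le hp hF hX hM hst (he n) (he' n) hG).trans ?_
        gcongr
        exact hupper n
    _ = _ := by
        refine Tendsto.liminf_eq (ENNReal.Tendsto.const_mul ?_ (.inr ENNReal.ofReal_ne_top))
        simpa using tendsto_const_nhds.add hlim0

/-- The distance process is adapted. -/
lemma measurable_edistα_flow (hp : IsTransitionKernel p) (hα : IsLocalization p α C)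
    (hF : IsReactionPair Fp Fm) (hX : IsPoissonClocks X P) (hz : z ∈ Eα α) (hz' : z' ∈ Eα α)
    (t : ℝ≥0) :
    Measurable[flowSigma P (rate p Fp Fm) X t] fun ω =>
      edistα α (flow α (rate p Fp Fm) (fun m => X m ω) t z)
        (flow α (rate p Fp Fm) (fun m => X m ω) t z') := by
  obtain ⟨e, he, -, h⟩ := exists_seq_tendsto_flow hp hα hF hX hz
  obtain ⟨e', he', -, h'⟩ := exists_seq_tendsto_flow hp hα hF hX hz'
  have htend := ae_tendsto_edistα_flow (fun x => (hα.pos x).le) h h'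
  have hfin : ∀ v ∈ E0 V, Measurable[flowSigma P (rate p Fp Fm) X t] fun ω =>
      finiteFlow (rate p Fp Fm) (fun m => X m ω) 0 t v := by
    intro v hv
    refine Measurable.mono (comap_measurable _) (le_trans ?_ le_sup_left) le_rfl
    exact le_iSup₂_of_le t le_rfl (le_iSup₂_of_le v hv le_rfl)
  have hmeas : ∀ n, Measurable[flowSigma P (rate p Fp Fm) X t] fun ω =>
      edistα α (finiteFlow (rate p Fp Fm) (fun m => X m ω) 0 t (e n))
        (finiteFlow (rate p Fp Fm) (fun m => X m ω) 0 t (e' n)) := by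
    intro n
    let _ := flowSigma P (rate p Fp Fm) X t
    refine Measurable.tsum fun x => Measurable.ennreal_ofReal (Measurable.const_mul ?_ _)
    have h1 : ∀ v ∈ E0 V, Measurable fun ω =>
        ((finiteFlow (rate p Fp Fm) (fun m => X m ω) 0 t v x : ℕ) : ℝ) := fun v hv =>
      measurable_from_top.comp ((measurable_pi_apply x).comp (hfin v hv))
    exact continuous_abs.measurable.comp ((h1 _ (he n)).sub (h1 _ (he' n)))
  -- The distance equals a liminf of adapted ones almost surely, and the exceptional set is null,
  -- hence in the completed σ-algebra.
  refine measurable_of_ae_eq (P := P) (fun N hN => ?_)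
    (Measurable.liminf (mδ := flowSigma P (rate p Fp Fm) X t) hmeas) ?_
  · exact (le_sup_right (a := ⨆ (s : ℝ≥0) (_ : s ≤ t) (η : V → ℕ) (_ : η ∈ E0 V),
      MeasurableSpace.comap (fun ω => finiteFlow (rate p Fp Fm) (fun m => X m ω) 0 s η)
        MeasurableSpace.pi)) _ (MeasurableSpace.measurableSet_generateFrom hN)
  · filter_upwards [htend] with ω hω
    exact (hω t).liminf_eq.symm

/-- The maximal inequality for the flow on `E_α`. -/
lemma measure_exists_lt_edistα_flow_le (hp : IsTransitionKernel p) (hα : IsLocalization p α C)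
    (hF : IsReactionPair Fp Fm) (hX : IsPoissonClocks X P) (hz : z ∈ Eα α) (hz' : z' ∈ Eα α)
    (T : ℝ≥0) {A : ℝ≥0∞} (hA : A ≠ 0) (hA' : A ≠ ∞) :
    P {ω | ∃ t ≤ T, A < edistα α (flow α (rate p Fp Fm) (fun m => X m ω) t z)
        (flow α (rate p Fp Fm) (fun m => X m ω) t z')} ≤
      ENNReal.ofReal (Real.exp (C * T)) * edistα α z z' / A := by
  obtain ⟨M, hM⟩ := hα.exists_isBoundedWeight hp
  obtain ⟨e, he, hlim, h⟩ := exists_seq_tendsto_flow hp hα hF hX hz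
  obtain ⟨e', he', hlim', h'⟩ := exists_seq_tendsto_flow hp hα hF hX hz'
  have htend := ae_tendsto_edistα_flow hM.nonneg h h'
  let E : ℕ → Set Ω := fun n => {ω | ∃ t ≤ T, A < edistα α
    (finiteFlow (rate p Fp Fm) (fun m => X m ω) 0 t (e n))
    (finiteFlow (rate p Fp Fm) (fun m => X m ω) 0 t (e' n))}
  have hE : ∀ n, P (E n) ≤ ENNReal.ofReal (Real.exp (C * T)) * edistα α (e n) (e' n) / A := fun n =>
    measure_exists_lt_edistα_finiteFlow_le hp hF hX hM (he n) (he' n) T hA hA'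
  -- A strict inequality at a time `t` passes to all large `n` at that same `t`. So the exceedance
  -- lies in the liminf of the events `E n`, and neither regularity in time nor measurability of the
  -- supremum enters.
  have hsub : ∀ᵐ ω ∂P, ω ∈ {ω | ∃ t ≤ T, A < edistα α
      (flow α (rate p Fp Fm) (fun m => X m ω) t z)
      (flow α (rate p Fp Fm) (fun m => X m ω) t z')} → ω ∈ ⋃ n, ⋂ k, ⋂ (_ : n ≤ k), E k := by
    filter_upwards [htend] with ω hω
    rintro ⟨t, ht, hlt⟩
    obtain ⟨n, hn⟩ := eventually_atTop.1 ((hω t).eventually_const_lt hlt)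
    exact Set.mem_iUnion.2 ⟨n, Set.mem_iInter₂.2 fun k hk => ⟨t, ht, hn k hk⟩⟩
  have hmono : Monotone fun n => ⋂ k, ⋂ (_ : n ≤ k), E k := fun i j hij =>
    Set.iInter_mono fun k => Set.iInter_mono' fun hk => ⟨hij.trans hk, le_rfl⟩
  have hbound : Tendsto (fun n => ENNReal.ofReal (Real.exp (C * T)) * edistα α (e n) (e' n) / A) atTop
      (𝓝 (ENNReal.ofReal (Real.exp (C * T)) * edistα α z z' / A)) :=
    ENNReal.Tendsto.div_const (ENNReal.Tendsto.const_mul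
      (tendsto_edistα_edistα hM.nonneg hz hz' hlim hlim') (.inr ENNReal.ofReal_ne_top)) (.inr hA)
  calc _ ≤ P (⋃ n, ⋂ k, ⋂ (_ : n ≤ k), E k) := measure_mono_ae hsub
    _ ≤ _ := by
      rw [hmono.measure_iUnion]
      refine iSup_le fun n => ge_of_tendsto hbound ?_
      filter_upwards [eventually_ge_atTop n] with k hk
      exact (measure_mono (Set.iInter₂_subset k hk)).trans (hE k)

end Limit

/-! ### The supermartingale for the completed filtration -/

section Filtration

variable {V Ω : Type*} {p : V → V → ℝ} {Fp Fm : ℕ → ℝ} {α : V → ℝ} {C : ℝ}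
  {X : Mark V → Ω → Set (ℝ × ℝ)}

lemma flowSigma_mono [MeasurableSpace Ω] (P : Measure Ω) (R : Mark V → (V → ℕ) → ℝ)
    (X : Mark V → Ω → Set (ℝ × ℝ)) : Monotone (flowSigma P R X) := fun _ _ hst =>
  sup_le ((iSup₂_le fun r hr => le_iSup₂_of_le (f := fun (s : ℝ≥0) (_ : s ≤ _) =>
    ⨆ (η : V → ℕ) (_ : η ∈ E0 V), MeasurableSpace.comap
      (fun ω => finiteFlow R (fun m => X m ω) 0 s η) MeasurableSpace.pi)
    r (hr.trans hst) le_rfl).trans le_sup_left) le_sup_right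

/-- The discounted distance process is a supermartingale on any extension of the probability
space for which the filtration consists of measurable sets. -/
lemma supermartingale_edistα_flow [Countable V] {m : MeasurableSpace Ω} [m₀ : MeasurableSpace Ω]
    (hle : m₀ ≤ m) {P : Measure Ω} [IsProbabilityMeasure P] {Q : Measure[m] Ω} (hfin : IsFiniteMeasure Q)
    (hQ : ∀ s, MeasurableSet s → Q s = P s) (hae : ae Q = ae P)
    (hp : IsTransitionKernel p) (hα : IsLocalization p α C)
    (hF : IsReactionPair Fp Fm) (hX : IsPoissonClocks X P) {z z' : V → ℕ} (hz : z ∈ Eα α)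
    (hz' : z' ∈ Eα α) {ℱ : Filtration ℝ≥0 m} (hℱ : ∀ t, ℱ t = flowSigma P (rate p Fp Fm) X t) :
    Supermartingale (fun (t : ℝ≥0) ω => Real.exp (-(C + 1) * t) *
      (edistα α (flow α (rate p Fp Fm) (fun m => X m ω) t z)
        (flow α (rate p Fp Fm) (fun m => X m ω) t z')).toReal) ℱ Q := by
  have hα' : ∀ x, 0 ≤ α x := fun x => (hα.pos x).le
  set D : ℝ≥0 → Ω → ℝ≥0∞ := fun t ω => edistα α (flow α (rate p Fp Fm) (fun m => X m ω) t z)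
    (flow α (rate p Fp Fm) (fun m => X m ω) t z') with hD
  have hsigma := fun s => flowSigma_le hp hF hX s
  have hDm : ∀ t, Measurable[flowSigma P (rate p Fp Fm) X t] (D t) := fun t =>
    measurable_edistα_flow hp hα hF hX hz hz' t
  have hDae : ∀ t, AEMeasurable[m₀] (D t) P := fun t =>
    NullMeasurable.aemeasurable fun B hB => by
      obtain ⟨G, hG, h⟩ := hsigma t _ (hDm t hB)
      exact ⟨G, regionSigma_le hX _ _ hG, h⟩
  refine supermartingale_of_setLIntegral_le (m := m) (C := C) (by linarith) (fun t => hℱ t ▸ hDm t) ?_ ?_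
  · have h0 : D 0 =ᵐ[Q] fun _ => edistα α z z' := by
      rw [EventuallyEq, hae]
      filter_upwards [ae_isFlowLimit_flow hp hα hF hX hz, ae_isFlowLimit_flow hp hα hF hX hz']
        with ω h h'
      simp only [hD]
      rw [flow_zero_eq hα hz (h 0), flow_zero_eq hα hz' (h' 0)]
    rw [lintegral_congr_ae h0, lintegral_const]
    exact ENNReal.mul_ne_top (edistα_ne_top_of_mem_Eα hα' hz hz') (measure_ne_top _ _)
  · intro s t hst G hG
    rw [hℱ s] at hG
    -- The event `G` is exchanged for an almost surely equal event of the clocks up to time `s`, for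
    -- which the Markov estimate is available under `P`.
    obtain ⟨G', hG', hGG'⟩ := hsigma s _ hG
    have hGm : MeasurableSet[m₀] G' := regionSigma_le hX _ _ hG'
    have hGQ : G =ᵐ[Q] G' := hae ▸ hGG'
    have hset : ∀ r, ∫⁻ ω in G, D r ω ∂Q = @lintegral _ m₀ (P.restrict G') (D r) := by
      intro r
      rw [setLIntegral_congr hGQ, ← lintegral_indicator (hle _ hGm), ← lintegral_indicator hGm]
      exact lintegral_eq_of_extension hle hQ ((hDae r).indicator hGm)
    rw [hset, hset]
    exact setLIntegral_edistα_flow_le hp hα hF hX hz hz' hst hG'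

lemma exists_filtration_supermartingale [Countable V] [MeasurableSpace Ω] {P : Measure Ω}
    [IsProbabilityMeasure P] (hp : IsTransitionKernel p) (hα : IsLocalization p α C)
    (hF : IsReactionPair Fp Fm) (hX : IsPoissonClocks X P) {z z' : V → ℕ} (hz : z ∈ Eα α)
    (hz' : z' ∈ Eα α) :
    ∃ ℱ : Filtration ℝ≥0 (inferInstance : MeasurableSpace (NullMeasurableSpace Ω P)),
      (∀ t, ℱ t = flowSigma P (rate p Fp Fm) X t) ∧
      Supermartingale (fun (t : ℝ≥0) (ω : NullMeasurableSpace Ω P) => Real.exp (-(C + 1) * t) *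
        distα α (flow α (rate p Fp Fm) (fun m => X m ω) t z)
          (flow α (rate p Fp Fm) (fun m => X m ω) t z')) ℱ P.completion := by
  have hnull : ∀ t, flowSigma P (rate p Fp Fm) X t ≤ eventuallyMeasurableSpace ‹MeasurableSpace Ω› (ae P) := by
    intro t G hG
    obtain ⟨G', hG', h⟩ := flowSigma_le hp hF hX t _ hG
    exact ⟨G', regionSigma_le hX _ _ hG', h⟩
  let ℱ : Filtration ℝ≥0 (inferInstance : MeasurableSpace (NullMeasurableSpace Ω P)) :=
    { seq := fun t => flowSigma (Ω := Ω) P (rate p Fp Fm) X t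
      mono' := flowSigma_mono (Ω := Ω) P (rate p Fp Fm) X
      le' := hnull }
  have hfin : IsFiniteMeasure P.completion := ⟨by
    exact (Measure.completion_apply P _).trans_lt (measure_lt_top P Set.univ)⟩
  refine ⟨ℱ, fun t => rfl, ?_⟩
  simp only [distα_eq_toReal fun x => (hα.pos x).le]
  exact supermartingale_edistα_flow (Ω := Ω) (P := P) (Q := P.completion) (ℱ := ℱ)
    (fun s hs => hs.nullMeasurableSet) hfin (fun s _ => Measure.completion_apply P s) rfl hp hα hF hX hz
    hz' fun t => rfl

end Filtration

end ReactionDiffusion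

/-! ### The distance process in `E_α` -/

theorem mainTheorem5 {V Ω : Type*} [Countable V] [MeasurableSpace Ω]
    (P : Measure Ω) [IsProbabilityMeasure P]
    (p : V → V → ℝ) (hp : ReactionDiffusion.IsTransitionKernel p)
    (α : V → ℝ) (C : ℝ) (hα : ReactionDiffusion.IsLocalization p α C)
    (Fp Fm : ℕ → ℝ) (hF : ReactionDiffusion.IsReactionPair Fp Fm)
    (X : ReactionDiffusion.Mark V → Ω → Set (ℝ × ℝ))
    (hX : ReactionDiffusion.IsPoissonClocks X P)
    (η η' : V → ℕ) (hη : η ∈ ReactionDiffusion.Eα α) (hη' : η' ∈ ReactionDiffusion.Eα α) :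
    let R := ReactionDiffusion.rate p Fp Fm
    let Φ : ℝ≥0 → (V → ℕ) → Ω → V → ℕ :=
      fun t ξ ω => ReactionDiffusion.flow α R (fun m => X m ω) t ξ
    -- the limits that define the two processes exist at all times, almost surely
    (∀ᵐ ω ∂P, ∀ t : ℝ≥0,
      ReactionDiffusion.IsFlowLimit α R (fun m => X m ω) t η (Φ t η ω) ∧
      ReactionDiffusion.IsFlowLimit α R (fun m => X m ω) t η' (Φ t η' ω)) ∧
    -- the supermartingale property, for the completed filtration on the completed space
    (∃ ℱ : Filtration ℝ≥0
        (inferInstance : MeasurableSpace (NullMeasurableSpace Ω P)),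
      (∀ t, ℱ t = ReactionDiffusion.flowSigma P R X t) ∧
      Supermartingale
        (fun (t : ℝ≥0) (ω : NullMeasurableSpace Ω P) =>
          Real.exp (-(C + 1) * t) * ReactionDiffusion.distα α (Φ t η ω) (Φ t η' ω))
        ℱ P.completion) ∧
    -- the maximal inequality
    (∀ (T : ℝ≥0) (A : ℝ), 0 < T → 0 < A →
      P {ω | ENNReal.ofReal A <
          ⨆ (t : ℝ≥0) (_ : t ≤ T),
            ENNReal.ofReal (ReactionDiffusion.distα α (Φ t η ω) (Φ t η' ω))} ≤
        ENNReal.ofReal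
          (Real.exp ((C + 1) * T) * ReactionDiffusion.distα α η η' / A)) := by
  intro R Φ
  have hα' : ∀ x, 0 ≤ α x := fun x => (hα.pos x).le
  have hflow := ReactionDiffusion.ae_isFlowLimit_flow hp hα hF hX hη
  have hflow' := ReactionDiffusion.ae_isFlowLimit_flow hp hα hF hX hη'
  refine ⟨?_, ?_, fun T A _ hA => ?_⟩
  · filter_upwards [hflow, hflow'] with ω h h' t
    exact ⟨h t, h' t⟩
  · exact ReactionDiffusion.exists_filtration_supermartingale hp hα hF hX hη hη'
  · have hmax := ReactionDiffusion.measure_exists_lt_edistα_flow_le hp hα hF hX hη hη' T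
      (ENNReal.ofReal_pos.2 hA).ne' ENNReal.ofReal_ne_top
    refine (measure_mono fun ω hω => ?_).trans (hmax.trans ?_)
    · obtain ⟨t, ht⟩ := lt_iSup_iff.1 (Set.mem_ofPred_eq ▸ hω)
      obtain ⟨htT, ht⟩ := lt_iSup_iff.1 ht
      refine ⟨t, htT, ht.trans_le ?_⟩
      rw [ReactionDiffusion.distα_eq_toReal hα']
      exact ENNReal.ofReal_toReal_le
    · rw [ENNReal.ofReal_div_of_pos hA, ENNReal.ofReal_mul (Real.exp_pos _).le,
        ReactionDiffusion.distα_eq_toReal hα',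
        ENNReal.ofReal_toReal (ReactionDiffusion.edistα_ne_top_of_mem_Eα hα' hη hη')]
      gcongr
      -- The maximal inequality was obtained with exponent `C * T`, which is at most `(C + 1) * T`.
      linarith
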